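/- **Notation.** For $\rho\ge 0$ let $U_n(\rho)=\{x\in\mathbb R^n : |x_j|\le\rho \text{ for } 1\le j\le n\}$. For a matrix, $\|\cdot\|_1$ and $\|\cdot\|_\infty$ are the induced norms (maximum absolute column sum and maximum absolute row sum). $f_j=\partial f/\partial x_j$ and $f_{jk}=\partial^2 f/\partial x_j\partial x_k$. If $f$ is twice differentiable in an open set containing $B$, then $H(f,B)=(h_{jk})$ with $h_{jk}=\sup_{y\in B}|f_{jk}(y)|$ (the suprema being assumed finite). For a complex random variable $Z$, $\mathbb V Z=\mathbb E(Z-\mathbb E Z)^2$ is the pseudovariance. $|A|$ is the determinant of $A$. **Theorem.** Let $c_1,c_2,c_3,\varepsilon$ be nonnegative real constants with $c_1,\varepsilon>0$. Then there is a constant $C$, depending only on $c_1,c_2,c_3,\varepsilon$, such that the following holds. Let $n\ge 1$ be an integer with $n\ge 4c_2$, and let $\rho_1,\rho_2,\phi_1,\phi_2\ge 0$. Let $A$ be an $n\times n$ positive-definite symmetric real matrix and $T$ an $n\times n$ real matrix with $T^{\mathsf T}AT=I$. Let $\Omega\subseteq\mathbb R^n$ be a measurable set with $U_n(\rho_1)\subseteq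 T^{-1}(\Omega)\subseteq U_n(\rho_2)$, and let $f:\mathbb R^n\to\mathbb C$, $g:\mathbb R^n\to\mathbb R$, $h:\Omega\to\mathbb C$ be measurable. Assume: (a) $c_1(\log n)^{1/2+\varepsilon}\le\rho_1\le\rho_2$. (b) $f$ is twice differentiable in an open set containing $T(U_n(\rho_1))$; for $x\in T(U_n(\rho_1))$ and $1\le j\le n$, $\;2\rho_1\|T\|_1|f_j(x)|\le\phi_1 n^{-1/3}$; moreover $\phi_1n^{-1/3}\le\frac23$ and $\;4\rho_1^2\|T\|_1\|T\|_\infty\|H(f,T(U_n(\rho_1)))\|_\infty\le\phi_1n^{-1/3}$. (c) $\Re f(x)\le g(x)$ for $x\in\Omega$, and either (i) $g$ is differentiable in an open set containing $T(U_n(\rho_2))$ and $2\rho_2\|T\|_1|g_j(x)|\le(2\phi_2)^{3/2}n^{-1/2}$ for $x\in T(U_n(\rho_2))$ and $1\le j\le n$; or (ii) $g$ is twice differentiable in an open set containing $T(U_n(\rho_2))$, $2\rho_2\|T\|_1|g_j(x)|\le\phi_2n^{-1/3}$ for $x\in T(U_n(\rho_2))$ and $1\le j\le n$, and $4\rho_2^2\|T\|_1\|T\|_\infty\|H(g,T(U_n(\rho_2)))\|_\infty\le\phi_2n^{-1/3}$.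 (d) $|f(x)|,|g(x)|\le n^{c_3}e^{c_2x^{\mathsf T}Ax/n}$ for all $x\in\mathbb R^n$. Let $X$ be a random variable with density $\pi^{-n/2}|A|^{1/2}e^{-x^{\mathsf T}Ax}$. Suppose $\mathbb V f(X)$ and $\mathbb V g(X)$ are finite (that is, $f(X)$ and $g(X)$ are square-integrable) and $h$ is bounded in $\Omega$. Then the integral below converges absolutely and $$\int_\Omega e^{-x^{\mathsf T}Ax+f(x)+h(x)}\,dx=(1+K)\,\pi^{n/2}|A|^{-1/2}e^{\mathbb E f(X)+\frac12\mathbb V f(X)},$$ where $$|K|\le C\,e^{\frac12\operatorname{Var}\Im f(X)}\Bigl(e^{\phi_1^3+e^{-\rho_1^2/2}}-1+\bigl(2e^{\phi_2^3+e^{-\rho_1^2/2}}-2+e^{\phi_2^3+e^{-\rho_1^2/2}}\sup_{x\in\Omega}|e^{h(x)}-1|\bigr)\,e^{\mathbb E(g(X)-\Re f(X))+\frac12(\operatorname{Var}g(X)-\operatorname{Var}\Re f(X))}\Bigr).$$ Moreover, if $n\ge(1+2c_2)^2$ and $\rho_1^2\ge 15+4c_2+(3+8c_3)\log n$, then the same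 bound holds with $C=1$. -/

import Mathlib

open scoped Matrix
open MeasureTheory ProbabilityTheory

noncomputable section

/-- The cube of all `x` in `ℝⁿ` with `|x j| ≤ ρ` for every `j`. -/
def cube (n : ℕ) (ρ : ℝ) : Set (Fin n → ℝ) :=
  {x | ∀ j, |x j| ≤ ρ}

/-- The quadratic form `xᵀ A x`. -/
def quadForm {n : ℕ} (A : Matrix (Fin n) (Fin n) ℝ) (x : Fin n → ℝ) : ℝ :=
  x ⬝ᵥ (A *ᵥ x)

/-- The measure on `ℝⁿ` with the normal density `π^(-n/2) |A|^(1/2) exp(-xᵀ A x)`. -/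
def normalMeasure {n : ℕ} (A : Matrix (Fin n) (Fin n) ℝ) : Measure (Fin n → ℝ) :=
  volume.withDensity fun x =>
    ENNReal.ofReal
      (Real.pi ^ (-(n : ℝ) / 2) * A.det ^ (1 / 2 : ℝ) * Real.exp (-quadForm A x))

/-- The pseudovariance `E (Z - E Z)²` of a complex random variable. -/
def pseudoVariance {α : Type*} [MeasurableSpace α] (μ : Measure α) (Z : α → ℂ) : ℂ :=
  ∫ x, (Z x - ∫ y, Z y ∂μ) ^ 2 ∂μ

section MatrixNorms

attribute [local instance] Matrix.linftyOpNormedAddCommGroup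

/-- The matrix norm induced by the vector norm `‖·‖_∞` (largest absolute row sum). -/
def matrixNormInf {n : ℕ} (M : Matrix (Fin n) (Fin n) ℝ) : ℝ :=
  ‖M‖

/-- The matrix norm induced by the vector norm `‖·‖₁` (largest absolute column sum). -/
def matrixNormOne {n : ℕ} (M : Matrix (Fin n) (Fin n) ℝ) : ℝ :=
  ‖Mᵀ‖

end MatrixNorms

/-- The partial derivative `∂f/∂x_j`. -/
def partialDerivative {n : ℕ} {F : Type*} [NormedAddCommGroup F] [NormedSpace ℝ F]
    (f : (Fin n → ℝ) → F) (j : Fin n) (x : Fin n → ℝ) : F :=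
  fderiv ℝ f x (Pi.single j 1)

/-- `f` is differentiable in some open set containing `B`. -/
def DifferentiableNear {n : ℕ} {F : Type*} [NormedAddCommGroup F] [NormedSpace ℝ F]
    (f : (Fin n → ℝ) → F) (B : Set (Fin n → ℝ)) : Prop :=
  ∃ S : Set (Fin n → ℝ), IsOpen S ∧ B ⊆ S ∧ DifferentiableOn ℝ f S

/-- `f` is twice differentiable in some open set containing `B`. -/
def TwiceDifferentiableNear {n : ℕ} {F : Type*} [NormedAddCommGroup F] [NormedSpace ℝ F]
    (f : (Fin n → ℝ) → F) (B : Set (Fin n → ℝ)) : Prop :=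
  ∃ S : Set (Fin n → ℝ), IsOpen S ∧ B ⊆ S ∧
    DifferentiableOn ℝ f S ∧ DifferentiableOn ℝ (fderiv ℝ f) S

/-- The suprema over `B` of the absolute values of all second partial derivatives of `f`
exist. -/
def HessianBddOn {n : ℕ} {F : Type*} [NormedAddCommGroup F] [NormedSpace ℝ F]
    (f : (Fin n → ℝ) → F) (B : Set (Fin n → ℝ)) : Prop :=
  ∀ j k : Fin n,
    BddAbove ((fun y => ‖partialDerivative (partialDerivative f j) k y‖) '' B)

/-- The matrix `H(f, B)` with entries `h_jk = sup_{y ∈ B} |f_jk(y)|`. -/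
def hessianSup {n : ℕ} {F : Type*} [NormedAddCommGroup F] [NormedSpace ℝ F]
    (f : (Fin n → ℝ) → F) (B : Set (Fin n → ℝ)) : Matrix (Fin n) (Fin n) ℝ :=
  Matrix.of fun j k =>
    sSup ((fun y => ‖partialDerivative (partialDerivative f j) k y‖) '' B)

/-- The quantity that, up to a constant, bounds the relative error of the estimate. -/
def errorBound {n : ℕ} (A : Matrix (Fin n) (Fin n) ℝ) (Ω : Set (Fin n → ℝ))
    (ρ₁ φ₁ φ₂ : ℝ) (f : (Fin n → ℝ) → ℂ) (g : (Fin n → ℝ) → ℝ) (h : (Fin n → ℝ) → ℂ) : ℝ :=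
  Real.exp (1 / 2 * variance (fun x => (f x).im) (normalMeasure A)) *
    ((Real.exp (φ₁ ^ 3 + Real.exp (-ρ₁ ^ 2 / 2)) - 1) +
      (2 * Real.exp (φ₂ ^ 3 + Real.exp (-ρ₁ ^ 2 / 2)) - 2 +
          Real.exp (φ₂ ^ 3 + Real.exp (-ρ₁ ^ 2 / 2)) *
            sSup ((fun x => ‖Complex.exp (h x) - 1‖) '' Ω)) *
        Real.exp
          ((∫ x, (g x - (f x).re) ∂normalMeasure A) +
            1 / 2 * (variance g (normalMeasure A) -
              variance (fun x => (f x).re) (normalMeasure A))))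

end

/-! Under `x = T y` the form `xᵀAx` becomes `|y|²`, so `X = T Y`, where `Y` has independent normal
coordinates of variance `1/2`. After division by `π^(n/2) |A|^(-1/2)` the integral is the
expectation of `e^{F+H}` over the preimage of `Ω`, where `F`, `G`, `H` are `f`, `g`, `h` composed
with `T`. Write `U(F) = E F + V F / 2` (`secondCumulantSum`); the claim is that this expectation is
close to `e^{U(F)}`.

The core is a statement about product probability spaces,
`SmallDifferences.norm_integral_cexp_sub_le`. If changing one coordinate changes `F` by at most `a ≤
2/3`, and for each coordinate the mixed second differences with the others are bounded by numbers of
sum at most `a`, then `|E e^F - e^{U(F)}| ≤ e^{U(Re F)} (e^{n a³} - 1)`. It is proved one coordinate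
at a time. Fixing the first coordinate at `x` and averaging over the rest replaces `F` by `w(x) +
v(x)/2`, with `w` the conditional mean and `v` the conditional pseudovariance. The hypotheses make
`w` oscillate by at most `a` and `v` by at most `a²`. By the law of total covariance `E w + (E v + V
w)/2 = U(F)`, so a third order Taylor estimate in the single variable `x` costs a factor `1 +
O(a³)`. With `a = φ₁ n^(-1/3)` the accumulated exponent `n a³` is `φ₁³`. Since `U(Re F) - Re U(F) =
Var(Im F)/2`, the relative error carries the factor `e^{Var(Im F)/2}`.

Differences are controlled only on a cube, so the core is applied to the normal law conditioned on
the cube, which is again a product. The growth bound on `F` and Gaussian tails show that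
conditioning changes the means and cumulants in play, together with the logarithm of the cube's
probability, by at most `e^{-ρ²/2}` (`truncationError_of_le_sq`).

Outside the smaller cube `|e^F| ≤ e^G`, and the integral of `e^G` over the shell between the cubes
is a difference of two integrals with nearly equal values. These come from the core in the second
order case, and from Hoeffding's lemma, iterated over coordinates, with Jensen's inequality in the
first order case (`setIntegral_exp_sub_le_of_expControl`). Finally `H` enters through `e^{F+H} = e^F
+ e^F (e^H - 1)`.

For large `n`, hypothesis (a) forces the explicit lower bound on `ρ₁²`, and the constant is `1`.
Only finitely many `n` remain, and a constant may depend on each: for `ρ₁ ≥ 1` the truncation error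
is still `O(e^{-ρ₁²/2})`, and for `ρ₁ < 1` the claimed error is so large that the triangle
inequality and a crude bound on the integral suffice. -/

/-- A bounded measurable function. -/
structure BddMeasurable {α E : Type*} [MeasurableSpace α] [NormedAddCommGroup E]
    [MeasurableSpace E] (F : α → E) : Prop where
  measurable : Measurable F
  bounded : ∃ B : ℝ, ∀ x, ‖F x‖ ≤ B

/-! ### Closure properties of bounded measurable functions. -/

namespace BddMeasurable

variable {α β : Type*} [MeasurableSpace α] [MeasurableSpace β]

lemma integrable {E : Type*} [NormedAddCommGroup E] [MeasurableSpace E] [BorelSpace E]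
    [SecondCountableTopology E] {F : α → E} (hF : BddMeasurable F) {μ : Measure α}
    [IsFiniteMeasure μ] : Integrable F μ := by
  obtain ⟨B, hB⟩ := hF.bounded
  exact Integrable.of_bound hF.measurable.aestronglyMeasurable B (.of_forall hB)

lemma memLp {E : Type*} [NormedAddCommGroup E] [MeasurableSpace E] [BorelSpace E]
    [SecondCountableTopology E] {F : α → E} (hF : BddMeasurable F) {μ : Measure α}
    [IsFiniteMeasure μ] {p : ENNReal} : MemLp F p μ := by
  obtain ⟨B, hB⟩ := hF.bounded
  exact MemLp.of_bound hF.measurable.aestronglyMeasurable B (.of_forall hB)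

lemma comp {E : Type*} [NormedAddCommGroup E] [MeasurableSpace E] {F : α → E}
    (hF : BddMeasurable F) {p : β → α} (hp : Measurable p) : BddMeasurable fun x => F (p x) := by
  obtain ⟨B, hB⟩ := hF.bounded
  exact ⟨hF.measurable.comp hp, B, fun x => hB _⟩

lemma const {E : Type*} [NormedAddCommGroup E] [MeasurableSpace E] (c : E) :
    BddMeasurable fun _ : α => c := ⟨measurable_const, ‖c‖, fun _ => le_rfl⟩

variable {F G : α → ℂ}

lemma add (hF : BddMeasurable F) (hG : BddMeasurable G) :
    BddMeasurable fun x => F x + G x := by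
  obtain ⟨B, hB⟩ := hF.bounded
  obtain ⟨B', hB'⟩ := hG.bounded
  exact ⟨hF.measurable.add hG.measurable, B + B',
    fun x => (norm_add_le _ _).trans (add_le_add (hB x) (hB' x))⟩

lemma sub (hF : BddMeasurable F) (hG : BddMeasurable G) :
    BddMeasurable fun x => F x - G x := by
  obtain ⟨B, hB⟩ := hF.bounded
  obtain ⟨B', hB'⟩ := hG.bounded
  exact ⟨hF.measurable.sub hG.measurable, B + B',
    fun x => (norm_sub_le _ _).trans (add_le_add (hB x) (hB' x))⟩

lemma mul (hF : BddMeasurable F) (hG : BddMeasurable G) :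
    BddMeasurable fun x => F x * G x := by
  obtain ⟨B, hB⟩ := hF.bounded
  obtain ⟨B', hB'⟩ := hG.bounded
  refine ⟨hF.measurable.mul hG.measurable, B * B', fun x => ?_⟩
  rw [norm_mul]
  exact mul_le_mul (hB x) (hB' x) (norm_nonneg _) ((norm_nonneg _).trans (hB x))

lemma pow_two (hF : BddMeasurable F) : BddMeasurable fun x => F x ^ 2 := by
  simpa only [_root_.pow_two] using hF.mul hF

lemma const_mul (c : ℂ) (hF : BddMeasurable F) : BddMeasurable fun x => c * F x :=
  (BddMeasurable.const c).mul hF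

lemma cexp (hF : BddMeasurable F) : BddMeasurable fun x => Complex.exp (F x) := by
  obtain ⟨B, hB⟩ := hF.bounded
  refine ⟨hF.measurable.cexp, Real.exp B, fun x => ?_⟩
  rw [Complex.norm_exp]
  exact Real.exp_le_exp.2 ((Complex.re_le_norm _).trans (hB x))

lemma conj (hF : BddMeasurable F) : BddMeasurable fun x => (starRingEnd ℂ) (F x) := by
  obtain ⟨B, hB⟩ := hF.bounded
  exact ⟨Complex.continuous_conj.measurable.comp hF.measurable, B,
    fun x => by rw [RCLike.norm_conj]; exact hB x⟩

lemma re (hF : BddMeasurable F) : BddMeasurable fun x => (F x).re := by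
  obtain ⟨B, hB⟩ := hF.bounded
  exact ⟨Complex.measurable_re.comp hF.measurable, B,
    fun x => (Complex.abs_re_le_norm _).trans (hB x)⟩

lemma ofReal {f : α → ℝ} (hf : BddMeasurable f) : BddMeasurable fun x => (f x : ℂ) := by
  obtain ⟨B, hB⟩ := hf.bounded
  exact ⟨Complex.measurable_ofReal.comp hf.measurable, B, fun x => by
    rw [Complex.norm_real]; exact hB x⟩

lemma exp_real {f : α → ℝ} (hf : BddMeasurable f) : BddMeasurable fun x => Real.exp (f x) := by
  obtain ⟨B, hB⟩ := hf.bounded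
  refine ⟨hf.measurable.exp, Real.exp B, fun x => ?_⟩
  rw [Real.norm_eq_abs, Real.abs_exp]
  exact Real.exp_le_exp.2 ((le_abs_self _).trans (hB x))

end BddMeasurable

/-! ### Covariance under bounded oscillation, and the expansion in one variable. -/

section Covariance

/-- The bilinear covariance `E (AB) - E A E B` of complex random variables. -/
noncomputable def bilinearCov {α : Type*} [MeasurableSpace α] (μ : Measure α) (A B : α → ℂ) : ℂ :=
  ∫ x, A x * B x ∂μ - (∫ x, A x ∂μ) * ∫ x, B x ∂μ

variable {Y : Type*} [MeasurableSpace Y] {μ : Measure Y} [IsProbabilityMeasure μ]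

/-- Symmetrisation with an independent copy: it expresses the covariance through differences of
values, which are what the oscillation hypotheses bound. -/
lemma integral_sub_mul_sub_eq {A B : Y → ℂ} (hA : BddMeasurable A) (hB : BddMeasurable B) :
    ∫ x, ∫ x', (A x - A x') * (B x - B x') ∂μ ∂μ = 2 * bilinearCov μ A B := by
  have key : ∀ x, ∫ x', (A x - A x') * (B x - B x') ∂μ =
      A x * B x - A x * ∫ x', B x' ∂μ - (∫ x', A x' ∂μ) * B x + ∫ x', A x' * B x' ∂μ := by
    intro x
    have : ∀ x', (A x - A x') * (B x - B x') =
        A x * B x - A x * B x' - A x' * B x + A x' * B x' := fun x' => by ring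
    simp_rw [this]
    rw [integral_add, integral_sub, integral_sub, integral_const_mul, integral_mul_const]
    · simp [integral_const_mul]
    · exact integrable_const _
    · exact hB.integrable.const_mul _
    · exact (integrable_const _).sub (hB.integrable.const_mul _)
    · exact hA.integrable.mul_const _
    · exact ((integrable_const _).sub (hB.integrable.const_mul _)).sub (hA.integrable.mul_const _)
    · exact (hA.mul hB).integrable
  simp_rw [key]
  rw [integral_add, integral_sub, integral_sub, integral_const_mul, integral_mul_const, bilinearCov]
  · simp; ring
  · exact (hA.mul hB).integrable
  · exact hA.integrable.mul_const _
  · exact (hA.mul hB).integrable.sub (hA.integrable.mul_const _)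
  · exact hB.integrable.const_mul _
  · exact ((hA.mul hB).integrable.sub (hA.integrable.mul_const _)).sub (hB.integrable.const_mul _)
  · exact integrable_const _

/-- The factor `1/2` is the gain of symmetrisation over bounding the two centred variables
separately; the constants in the expansion below depend on it. -/
lemma norm_bilinearCov_le {A B : Y → ℂ} (hA : BddMeasurable A) (hB : BddMeasurable B)
    {a b : ℝ} (ha : ∀ x x', ‖A x - A x'‖ ≤ a) (hb : ∀ x x', ‖B x - B x'‖ ≤ b) :
    ‖bilinearCov μ A B‖ ≤ a * b / 2 := by
  have h := integral_sub_mul_sub_eq (μ := μ) hA hB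
  have h2 : ‖∫ x, ∫ x', (A x - A x') * (B x - B x') ∂μ ∂μ‖ ≤ a * b := by
    have : ∀ x, ‖∫ x', (A x - A x') * (B x - B x') ∂μ‖ ≤ a * b := by
      intro x
      have := norm_integral_le_of_norm_le_const (μ := μ) (C := a * b)
        (f := fun x' => (A x - A x') * (B x - B x')) (.of_forall fun x' => by
          rw [norm_mul]
          exact mul_le_mul (ha _ _) (hb _ _) (norm_nonneg _) ((norm_nonneg _).trans (ha x x')))
      simpa using this
    simpa using norm_integral_le_of_norm_le_const (μ := μ) (.of_forall this)
  rw [h, norm_mul] at h2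
  simp at h2
  linarith

lemma norm_sub_integral_le {A : Y → ℂ} (hA : BddMeasurable A) {a : ℝ}
    (ha : ∀ x x', ‖A x - A x'‖ ≤ a) (x : Y) : ‖A x - ∫ y, A y ∂μ‖ ≤ a := by
  have : A x - ∫ y, A y ∂μ = ∫ y, (A x - A y) ∂μ := by
    rw [integral_sub (integrable_const _) hA.integrable]; simp
  rw [this]
  simpa using norm_integral_le_of_norm_le_const (μ := μ) (.of_forall fun y => ha x y)

/-- Here `w` has first order size `a` and `v` second order size `a²`. Subtracting `P/2` in the
exponent cancels the contribution of `w²/2`, so everything left has order `a³`: the Taylor remainder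
gives at most `a³/2`, the cross term `E(wv)/2` at most `a³/4`, and the terms in `v²` and `P²` at
most `3a⁴/32 ≤ a³/16`. -/
lemma norm_integral_cexp_sub_one_le {w v : Y → ℂ} (hw : BddMeasurable w) (hv : BddMeasurable v)
    {a : ℝ} (ha0 : 0 ≤ a) (ha1 : a ≤ 2 / 3) (hwa : ∀ x x', ‖w x - w x'‖ ≤ a)
    (hva : ∀ x x', ‖v x - v x'‖ ≤ a ^ 2) (hw0 : ∫ x, w x ∂μ = 0) (hv0 : ∫ x, v x ∂μ = 0) :
    ‖∫ x, Complex.exp (w x + (v x - ∫ y, w y ^ 2 ∂μ) / 2) ∂μ - 1‖ ≤ a ^ 3 := by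
  set P := ∫ y, w y ^ 2 ∂μ with hP
  have hw2 := norm_bilinearCov_le (μ := μ) hw hw hwa hwa
  have hv2 := norm_bilinearCov_le (μ := μ) hv hv hva hva
  have hwv := norm_bilinearCov_le (μ := μ) hw hv hwa hva
  -- Pairing `w` with its conjugate gives `E|w|² ≤ a²/2`, half of the pointwise bound. With the
  -- pointwise bound alone the terms would add up to more than `a³`.
  have hww := norm_bilinearCov_le (μ := μ) hw hw.conj hwa (b := a) (fun x x' => by
    rw [← map_sub, RCLike.norm_conj]; exact hwa x x')
  simp only [bilinearCov, hw0, hv0, mul_zero, zero_mul, sub_zero] at hw2 hv2 hwv hww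
  have hPn : ‖P‖ ≤ a * a / 2 := by simpa only [hP, pow_two] using hw2
  have hsq : ∫ x, ‖w x‖ ^ 2 ∂μ ≤ a ^ 2 / 2 := by
    have : ∫ x, w x * (starRingEnd ℂ) (w x) ∂μ = ((∫ x, ‖w x‖ ^ 2 ∂μ : ℝ) : ℂ) := by
      rw [← integral_complex_ofReal]
      congr 1; ext x
      rw [Complex.mul_conj, Complex.normSq_eq_norm_sq]
    rw [this, Complex.norm_real] at hww
    calc _ ≤ _ := le_abs_self _
      _ ≤ _ := hww
      _ = _ := by ring
  set X : Y → ℂ := fun x => w x + (v x - P) / 2 with hX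
  have hXb : BddMeasurable X := by
    have := hw.add ((hv.sub (.const P)).const_mul (1 / 2))
    convert this using 2; simp only [hX]; ring
  have hwn : ∀ x, ‖w x‖ ≤ a := fun x => by
    simpa [hw0] using norm_sub_integral_le (μ := μ) hw hwa x
  have hvn : ∀ x, ‖v x‖ ≤ a ^ 2 := fun x => by
    simpa [hv0] using norm_sub_integral_le (μ := μ) hv hva x
  have hvP : ∀ x, ‖(v x - P) / 2‖ ≤ 3 / 4 * a ^ 2 := fun x => by
    rw [norm_div]
    have := norm_sub_le (v x) P
    have := hvn x
    simp; nlinarith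
  -- `a + 3a²/4 ≤ 3a/2` because `a ≤ 2/3`; the same condition gives `3a/2 ≤ 1`, which the
  -- exponential remainder estimate requires.
  have hXn : ∀ x, ‖X x‖ ≤ 3 / 2 * a := fun x => by
    have := norm_add_le (w x) ((v x - P) / 2)
    have := hvP x
    have := hwn x
    have : ‖X x‖ ≤ a + 3 / 4 * a ^ 2 := by simp only [hX]; linarith
    nlinarith
  have hXsq : ∀ x, ‖X x‖ ^ 2 ≤ 3 / 2 * ‖w x‖ ^ 2 + 3 / 4 * a ^ 2 := fun x => by
    have h1 := norm_add_le (w x) ((v x - P) / 2)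
    have h2 := hvP x
    have h3 : ‖(v x - P) / 2‖ ≤ a / 2 := by nlinarith
    have h4 : ‖X x‖ ≤ ‖w x‖ + a / 2 := by simp only [hX]; linarith
    have h5 := norm_nonneg (X x)
    have h6 : ‖X x‖ ^ 2 ≤ (‖w x‖ + a / 2) ^ 2 := by gcongr
    nlinarith [sq_nonneg (‖w x‖ - a)]
  have hR : ∀ x, ‖Complex.exp (X x) - (1 + X x + X x ^ 2 / 2)‖ ≤
      1 / 3 * a * (3 / 2 * ‖w x‖ ^ 2 + 3 / 4 * a ^ 2) := fun x => by
    have h1 := hXn x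
    have h2 := Complex.exp_bound (x := X x) (by linarith) (n := 3) (by norm_num)
    simp [Finset.sum_range_succ, Nat.factorial] at h2
    refine h2.trans ?_
    have h3 := hXsq x
    have h4 := norm_nonneg (X x)
    calc _ = 2 / 9 * ‖X x‖ * ‖X x‖ ^ 2 := by ring
      _ ≤ 2 / 9 * (3 / 2 * a) * (3 / 2 * ‖w x‖ ^ 2 + 3 / 4 * a ^ 2) := by gcongr
      _ = _ := by ring
  have hwnb : BddMeasurable fun x => ‖w x‖ ^ 2 :=
    ⟨hw.measurable.norm.pow_const 2, a ^ 2, fun x => by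
      rw [norm_pow, norm_norm]; exact pow_le_pow_left₀ (norm_nonneg _) (hwn x) 2⟩
  have hRint : ‖∫ x, (Complex.exp (X x) - (1 + X x + X x ^ 2 / 2)) ∂μ‖ ≤ a ^ 3 / 2 := by
    refine (norm_integral_le_of_norm_le (g := fun x => 1 / 3 * a * (3 / 2 * ‖w x‖ ^ 2 + 3 / 4 * a ^ 2))
      ?_ (.of_forall hR)).trans ?_
    · exact ((hwnb.integrable.const_mul _).add (integrable_const _)).const_mul _
    · rw [integral_const_mul, integral_add (hwnb.integrable.const_mul _) (integrable_const _),
        integral_const_mul]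
      simp
      nlinarith
  -- The mean `-P/2` of the linear term cancels `E w²/2 = P/2` from the quadratic one, and the mixed
  -- terms with `P` vanish by centring.
  have hmain : ∫ x, (1 + X x + X x ^ 2 / 2) ∂μ =
      1 + (∫ x, w x * v x ∂μ) / 2 + (∫ x, v x * v x ∂μ) / 8 + P ^ 2 / 8 := by
    have : ∀ x, 1 + X x + X x ^ 2 / 2 = (1 - P / 2 + P ^ 2 / 8) + (1 - P / 2) * w x
        + (1 / 2 - P / 4) * v x + 1 / 2 * w x ^ 2 + 1 / 2 * (w x * v x) + 1 / 8 * (v x * v x) :=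
      fun x => by simp only [hX]; ring
    simp_rw [this]
    have i1 := hw.integrable (μ := μ)
    have i2 := hv.integrable (μ := μ)
    have i3 := hw.pow_two.integrable (μ := μ)
    have i4 := (hw.mul hv).integrable (μ := μ)
    have i5 := (hv.mul hv).integrable (μ := μ)
    rw [integral_add (by fun_prop) (by fun_prop), integral_add (by fun_prop) (by fun_prop),
      integral_add (by fun_prop) (by fun_prop), integral_add (by fun_prop) (by fun_prop),
      integral_add (by fun_prop) (by fun_prop)]
    simp only [integral_const_mul, hw0, hv0, ← hP]
    simp
    ring
  have hsplit : ∫ x, Complex.exp (X x) ∂μ - 1 =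
      ∫ x, (Complex.exp (X x) - (1 + X x + X x ^ 2 / 2)) ∂μ +
        ((∫ x, w x * v x ∂μ) / 2 + (∫ x, v x * v x ∂μ) / 8 + P ^ 2 / 8) := by
    have hb : BddMeasurable fun x => 1 + X x + X x ^ 2 / 2 := by
      have := ((BddMeasurable.const (1 : ℂ)).add hXb).add (hXb.pow_two.const_mul (1 / 2))
      convert this using 2; ring
    rw [integral_sub hXb.cexp.integrable hb.integrable, hmain]
    ring
  rw [hsplit]
  have e1 : ‖(∫ x, w x * v x ∂μ) / 2‖ ≤ a ^ 3 / 4 := by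
    rw [norm_div]; simp; nlinarith
  have e2 : ‖(∫ x, v x * v x ∂μ) / 8‖ ≤ a ^ 4 / 16 := by
    rw [norm_div]; simp; nlinarith
  have e3 : ‖P ^ 2 / 8‖ ≤ a ^ 4 / 32 := by
    rw [norm_div, norm_pow]
    have : ‖P‖ ^ 2 ≤ (a * a / 2) ^ 2 := by gcongr
    simp; nlinarith
  have e4 : a ^ 4 ≤ 2 / 3 * a ^ 3 := by
    have := pow_nonneg ha0 3
    nlinarith
  calc _ ≤ _ := norm_add_le _ _
    _ ≤ a ^ 3 / 2 + (a ^ 3 / 4 + a ^ 4 / 16 + a ^ 4 / 32) :=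
      add_le_add hRint (norm_add₃_le.trans (add_le_add (add_le_add e1 e2) e3))
    _ ≤ a ^ 3 := by nlinarith [pow_nonneg ha0 3]

/-- Factoring out `e^U` centres `w` and `v`. The error `a³` is weakened to `e^{a³} - 1`, the form in
which relative errors compose under iteration. -/
lemma norm_integral_cexp_sub_le {w v : Y → ℂ} (hw : BddMeasurable w) (hv : BddMeasurable v)
    {a : ℝ} (ha0 : 0 ≤ a) (ha1 : a ≤ 2 / 3) (hwa : ∀ x x', ‖w x - w x'‖ ≤ a)
    (hva : ∀ x x', ‖v x - v x'‖ ≤ a ^ 2) {U : ℂ}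
    (hU : U = ∫ x, w x ∂μ + (∫ x, v x ∂μ + bilinearCov μ w w) / 2) :
    ‖∫ x, Complex.exp (w x + v x / 2) ∂μ - Complex.exp U‖ ≤
      ‖Complex.exp U‖ * (Real.exp (a ^ 3) - 1) := by
  set w' : Y → ℂ := fun x => w x - ∫ y, w y ∂μ with hw'
  set v' : Y → ℂ := fun x => v x - ∫ y, v y ∂μ with hv'
  have h := norm_integral_cexp_sub_one_le (μ := μ) (w := w') (v := v') (hw.sub (.const _))
    (hv.sub (.const _)) ha0 ha1 (fun x x' => by simpa [hw'] using hwa x x')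
    (fun x x' => by simpa [hv'] using hva x x')
    (by simp only [hw']; rw [integral_sub hw.integrable (integrable_const _)]; simp)
    (by simp only [hv']; rw [integral_sub hv.integrable (integrable_const _)]; simp)
  have hP : ∫ y, w' y ^ 2 ∂μ = bilinearCov μ w w := by
    have : ∀ y, w' y ^ 2 = w y * w y - 2 * (∫ y, w y ∂μ) * w y + (∫ y, w y ∂μ) ^ 2 :=
      fun y => by simp only [hw']; ring
    simp_rw [this]
    have i1 := hw.integrable (μ := μ)
    have i2 := (hw.mul hw).integrable (μ := μ)
    rw [integral_add (by fun_prop) (by fun_prop), integral_sub (by fun_prop) (by fun_prop),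
      integral_const_mul, bilinearCov]
    simp; ring
  rw [hP] at h
  have hexp : ∀ x, Complex.exp (w x + v x / 2) = Complex.exp U *
      Complex.exp (w' x + (v' x - bilinearCov μ w w) / 2) := fun x => by
    rw [← Complex.exp_add, hU]; congr 1; simp only [hw', hv']; ring
  simp_rw [hexp]
  rw [integral_const_mul, ← mul_sub_one, norm_mul]
  gcongr
  refine h.trans ?_
  have := Real.add_one_le_exp (a ^ 3)
  linarith

end Covariance

/-! ### Tensorisation over independent coordinates. -/

section Product

variable {Y : Type*} [MeasurableSpace Y] {n : ℕ}

lemma measurable_finCons :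
    Measurable fun p : Y × (Fin n → Y) => (Fin.cons p.1 p.2 : Fin (n + 1) → Y) := by
  rw [measurable_pi_iff]
  refine Fin.cases ?_ fun i => ?_
  · simpa using measurable_fst
  · simp only [Fin.cons_succ]; fun_prop

lemma measurable_finCons_right (x : Y) :
    Measurable fun y : Fin n → Y => (Fin.cons x y : Fin (n + 1) → Y) :=
  measurable_finCons.comp (measurable_const.prodMk measurable_id)

variable {μ : Measure Y} [IsProbabilityMeasure μ]

lemma measurePreserving_finCons :
    MeasurePreserving (fun p : Y × (Fin n → Y) => (Fin.cons p.1 p.2 : Fin (n + 1) → Y))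
      (μ.prod (Measure.pi fun _ => μ)) (Measure.pi fun _ => μ) := by
  have := (measurePreserving_piFinSuccAbove (fun _ : Fin (n + 1) => μ) 0).symm
  convert this using 1
  ext p i
  simp [MeasurableEquiv.piFinSuccAbove, Fin.insertNthEquiv]

variable {E : Type*} [NormedAddCommGroup E] [MeasurableSpace E] [BorelSpace E]
  [SecondCountableTopology E] [NormedSpace ℝ E]

lemma integral_pi_finSucc {F : (Fin (n + 1) → Y) → E} (hF : BddMeasurable F) :
    ∫ z, F z ∂Measure.pi (fun _ => μ) =
      ∫ x, ∫ y, F (Fin.cons x y) ∂Measure.pi (fun _ => μ) ∂μ := by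
  have hmp := measurePreserving_finCons (μ := μ) (n := n)
  rw [← hmp.map_eq, integral_map hmp.measurable.aemeasurable
    hF.measurable.aestronglyMeasurable]
  exact integral_prod _ (hF.comp hmp.measurable).integrable

lemma BddMeasurable.finCons {E : Type*} [NormedAddCommGroup E] [MeasurableSpace E]
    {F : (Fin (n + 1) → Y) → E} (hF : BddMeasurable F) (x : Y) :
    BddMeasurable fun y : Fin n → Y => F (Fin.cons x y) :=
  hF.comp (measurable_finCons_right x)

lemma BddMeasurable.integral_finCons {F : (Fin (n + 1) → Y) → E} (hF : BddMeasurable F) :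
    BddMeasurable fun x => ∫ y, F (Fin.cons x y) ∂Measure.pi (fun _ => μ) := by
  obtain ⟨B, hB⟩ := hF.bounded
  refine ⟨?_, B, fun x => ?_⟩
  · have h : StronglyMeasurable fun p : Y × (Fin n → Y) => F (Fin.cons p.1 p.2) :=
      (hF.measurable.comp measurable_finCons).stronglyMeasurable
    exact (h.integral_prod_right (ν := Measure.pi fun _ => μ)).measurable
  · simpa using norm_integral_le_of_norm_le_const (μ := Measure.pi fun _ : Fin n => μ)
      (.of_forall fun y => hB (Fin.cons x y))

lemma integral_pi_finZero {Y E : Type*} [MeasurableSpace Y] {μ : Measure Y} [SigmaFinite μ]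
    [NormedAddCommGroup E] [NormedSpace ℝ E] [CompleteSpace E] (F : (Fin 0 → Y) → E) (z : Fin 0 → Y) :
    ∫ y, F y ∂Measure.pi (fun _ => μ) = F z := by
  rw [Measure.pi_of_empty (fun _ : Fin 0 => μ) z, integral_dirac]

/-- Changing the `j`-th coordinate changes `F` by at most `α j`. -/
def OscillationLE {Y E : Type*} [NormedAddCommGroup E] (F : (Fin n → Y) → E) (α : Fin n → ℝ) :
    Prop :=
  ∀ y j t, ‖F (Function.update y j t) - F y‖ ≤ α j

lemma OscillationLE.finCons {Y E : Type*} [NormedAddCommGroup E] {F : (Fin (n + 1) → Y) → E}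
    {α : Fin (n + 1) → ℝ} (h : OscillationLE F α) (x : Y) :
    OscillationLE (fun y : Fin n → Y => F (Fin.cons x y)) fun j => α j.succ := fun y j t => by
  simpa only [Fin.cons_update] using h _ _ _

lemma OscillationLE.finCons_sub {Y E : Type*} [NormedAddCommGroup E] {F : (Fin (n + 1) → Y) → E}
    {α : Fin (n + 1) → ℝ} (h : OscillationLE F α) (x x' : Y) (y : Fin n → Y) :
    ‖F (Fin.cons x y) - F (Fin.cons x' y)‖ ≤ α 0 := by
  have := h (Fin.cons x' y) 0 x
  rwa [Fin.update_cons_zero] at this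

lemma OscillationLE.integral_finCons {F : (Fin (n + 1) → Y) → E}
    {α : Fin (n + 1) → ℝ} (h : OscillationLE F α) (hF : BddMeasurable F) (x x' : Y) :
    ‖∫ y, F (Fin.cons x y) ∂Measure.pi (fun _ => μ) -
      ∫ y, F (Fin.cons x' y) ∂Measure.pi (fun _ => μ)‖ ≤ α 0 := by
  rw [← integral_sub (hF.finCons x).integrable (hF.finCons x').integrable]
  simpa using norm_integral_le_of_norm_le_const (μ := Measure.pi fun _ : Fin n => μ)
      (.of_forall fun y => h.finCons_sub x x' y)

lemma BddMeasurable.bilinearCov_finCons {A B : (Fin (n + 1) → Y) → ℂ} (hA : BddMeasurable A)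
    (hB : BddMeasurable B) :
    BddMeasurable fun x => bilinearCov (Measure.pi fun _ => μ) (fun y => A (Fin.cons x y))
      fun y => B (Fin.cons x y) :=
  ((hA.mul hB).integral_finCons).sub (hA.integral_finCons.mul hB.integral_finCons)

/-- The law of total covariance. -/
lemma bilinearCov_pi_finSucc {A B : (Fin (n + 1) → Y) → ℂ} (hA : BddMeasurable A)
    (hB : BddMeasurable B) :
    bilinearCov (Measure.pi fun _ => μ) A B =
      ∫ x, bilinearCov (Measure.pi fun _ => μ) (fun y => A (Fin.cons x y))
        (fun y => B (Fin.cons x y)) ∂μ +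
      bilinearCov μ (fun x => ∫ y, A (Fin.cons x y) ∂Measure.pi (fun _ => μ))
        (fun x => ∫ y, B (Fin.cons x y) ∂Measure.pi (fun _ => μ)) := by
  rw [bilinearCov, integral_pi_finSucc (hA.mul hB), integral_pi_finSucc hA,
    integral_pi_finSucc hB]
  simp only [bilinearCov]
  rw [integral_sub (hA.mul hB).integral_finCons.integrable
    (hA.integral_finCons.mul hB.integral_finCons).integrable]
  ring

/-- An Efron–Stein type bound: by the law of total covariance the coordinates are peeled off one at
a time, and each contributes at most `α j * β j / 2`, because averaging over the others does not
increase an oscillation. -/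
lemma norm_bilinearCov_pi_le {n : ℕ} : ∀ {A B : (Fin n → Y) → ℂ}, BddMeasurable A →
    BddMeasurable B → ∀ {α β : Fin n → ℝ}, OscillationLE A α → OscillationLE B β →
    ‖bilinearCov (Measure.pi fun _ => μ) A B‖ ≤ (∑ j, α j * β j) / 2 := by
  induction n with
  | zero =>
    intro A B hA hB α β _ _
    simp only [bilinearCov]
    have z : Fin 0 → Y := fun i => i.elim0
    rw [integral_pi_finZero _ z, integral_pi_finZero _ z, integral_pi_finZero _ z]
    simp
  | succ n ih =>
    intro A B hA hB α β hα hβ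
    rw [bilinearCov_pi_finSucc hA hB, Fin.sum_univ_succ]
    have h1 := norm_integral_le_of_norm_le_const (μ := μ) (.of_forall fun x =>
      ih (hA.finCons x) (hB.finCons x) (hα.finCons x) (hβ.finCons x))
    have h2 := norm_bilinearCov_le (μ := μ) hA.integral_finCons hB.integral_finCons
      (hα.integral_finCons (μ := μ) hA) (hβ.integral_finCons (μ := μ) hB)
    simp only [probReal_univ, mul_one] at h1
    refine (norm_add_le _ _).trans ?_
    linarith

/-- The second order differences of `F` in the coordinates `k` and `j` are at most `D j`. -/
def MixedOscillationLE {Y E : Type*} [NormedAddCommGroup E] (F : (Fin n → Y) → E) (k : Fin n) (D : Fin n → ℝ) : Prop :=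
  ∀ j, j ≠ k → ∀ y s t, ‖F (Function.update (Function.update y k s) j t) -
    F (Function.update y k s) - F (Function.update y j t) + F y‖ ≤ D j

/-- `F` is bounded and measurable, its first differences are at most `a`, and for each
coordinate `k` the second differences in `k` and `j` have bounds with sum at most `a`. -/
structure SmallDifferences (a : ℝ) (F : (Fin n → Y) → ℂ) : Prop where
  bdd : BddMeasurable F
  osc : OscillationLE F fun _ => a
  mixed : ∀ k, ∃ D : Fin n → ℝ, (∀ j, 0 ≤ D j) ∧ ∑ j, D j ≤ a ∧ MixedOscillationLE F k D

lemma SmallDifferences.ofReal_re {a : ℝ} {F : (Fin n → Y) → ℂ} (h : SmallDifferences a F) :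
    SmallDifferences a fun y => ((F y).re : ℂ) := by
  refine ⟨h.bdd.re.ofReal, fun y j t => ?_, fun k => ?_⟩
  · rw [← Complex.ofReal_sub, Complex.norm_real, ← Complex.sub_re]
    exact (Complex.abs_re_le_norm _).trans (h.osc y j t)
  · obtain ⟨D, h0, hs, hD⟩ := h.mixed k
    refine ⟨D, h0, hs, fun j hj y s t => ?_⟩
    rw [← Complex.ofReal_sub, ← Complex.ofReal_sub, ← Complex.ofReal_add, Complex.norm_real,
      ← Complex.sub_re, ← Complex.sub_re, ← Complex.add_re]
    exact (Complex.abs_re_le_norm _).trans (hD j hj y s t)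

lemma SmallDifferences.finCons {a : ℝ} {F : (Fin (n + 1) → Y) → ℂ} (h : SmallDifferences a F)
    (x : Y) : SmallDifferences a fun y : Fin n → Y => F (Fin.cons x y) := by
  refine ⟨h.bdd.finCons x, h.osc.finCons x, fun k => ?_⟩
  obtain ⟨D, h0, hs, hD⟩ := h.mixed k.succ
  refine ⟨fun j => D j.succ, fun j => h0 _, ?_, fun j hj y s t => ?_⟩
  · rw [Fin.sum_univ_succ] at hs
    linarith [h0 0]
  · simp only [Fin.cons_update]
    exact hD j.succ (by simpa using hj) _ s t

/-- With `A`, `B` the two sections, `Cov(A,A) - Cov(B,B) = Cov(A - B, A + B)`. The oscillations of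
`A - B` are mixed second differences of `F`, of sum at most `a`, and those of `A + B` are at most
`2a`. This is where second derivatives are needed: the conditional pseudovariance varies by `a²`
only. -/
lemma SmallDifferences.norm_bilinearCov_sub_le {a : ℝ} {F : (Fin (n + 1) → Y) → ℂ}
    (ha : 0 ≤ a) (h : SmallDifferences a F) (x x' : Y) :
    ‖bilinearCov (Measure.pi fun _ => μ) (fun y => F (Fin.cons x y)) (fun y => F (Fin.cons x y)) -
      bilinearCov (Measure.pi fun _ => μ) (fun y => F (Fin.cons x' y))
        (fun y => F (Fin.cons x' y))‖ ≤ a ^ 2 := by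
  obtain ⟨D, h0, hs, hD⟩ := h.mixed 0
  have hx := h.bdd.finCons x
  have hx' := h.bdd.finCons x'
  have key := norm_bilinearCov_pi_le (μ := μ) (hx.sub hx') (hx.add hx')
    (α := fun j => D j.succ) (β := fun _ => 2 * a)
    (fun y j t => by
      have := hD j.succ (Fin.succ_ne_zero j) (Fin.cons x' y) x t
      simp only [Fin.update_cons_zero, ← Fin.cons_update] at this
      refine le_of_eq_of_le (congrArg norm ?_) this
      ring)
    (fun y j t => by
      have h1 := (h.osc.finCons x) y j t
      have h2 := (h.osc.finCons x') y j t
      have h3 := norm_add_le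
        (F (Fin.cons x (Function.update y j t)) - F (Fin.cons x y))
        (F (Fin.cons x' (Function.update y j t)) - F (Fin.cons x' y))
      have h4 : ∀ p q r s : ℂ, p + q - (r + s) = p - r + (q - s) := fun _ _ _ _ => by ring
      rw [h4]
      linarith)
  have heq : bilinearCov (Measure.pi fun _ => μ) (fun y => F (Fin.cons x y) - F (Fin.cons x' y))
      (fun y => F (Fin.cons x y) + F (Fin.cons x' y)) =
      bilinearCov (Measure.pi fun _ => μ) (fun y => F (Fin.cons x y)) (fun y => F (Fin.cons x y)) -
      bilinearCov (Measure.pi fun _ => μ) (fun y => F (Fin.cons x' y))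
        (fun y => F (Fin.cons x' y)) := by
    simp only [bilinearCov]
    rw [integral_sub hx.integrable hx'.integrable, integral_add hx.integrable hx'.integrable]
    have : ∀ y : Fin n → Y, (F (Fin.cons x y) - F (Fin.cons x' y)) *
      (F (Fin.cons x y) + F (Fin.cons x' y)) =
        F (Fin.cons x y) * F (Fin.cons x y) - F (Fin.cons x' y) * F (Fin.cons x' y) :=
      fun y => by ring
    simp_rw [this]
    rw [integral_sub (hx.mul hx).integrable (hx'.mul hx').integrable]
    ring
  rw [heq] at key
  refine key.trans ?_
  rw [← Finset.sum_mul]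
  have : ∑ j : Fin n, D j.succ ≤ a := by
    rw [Fin.sum_univ_succ] at hs
    linarith [h0 0]
  nlinarith

/-- The mean plus half of the pseudovariance. -/
noncomputable def secondCumulantSum {α : Type*} [MeasurableSpace α] (μ : Measure α) (F : α → ℂ) :
    ℂ :=
  ∫ x, F x ∂μ + bilinearCov μ F F / 2

/-- The one-variable expansion with `w` the conditional mean and `v` the conditional pseudovariance
given the first coordinate; the law of total covariance identifies the resulting exponent. -/
lemma SmallDifferences.norm_integral_cexp_secondCumulantSum_sub_le {a : ℝ}
    {F : (Fin (n + 1) → Y) → ℂ} (ha0 : 0 ≤ a) (ha1 : a ≤ 2 / 3) (h : SmallDifferences a F) :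
    ‖∫ x, Complex.exp (secondCumulantSum (Measure.pi fun _ => μ) fun y => F (Fin.cons x y)) ∂μ -
        Complex.exp (secondCumulantSum (Measure.pi fun _ => μ) F)‖ ≤
      ‖Complex.exp (secondCumulantSum (Measure.pi fun _ => μ) F)‖ * (Real.exp (a ^ 3) - 1) := by
  refine norm_integral_cexp_sub_le (μ := μ) h.bdd.integral_finCons
    (h.bdd.bilinearCov_finCons h.bdd) ha0 ha1 (h.osc.integral_finCons h.bdd)
    (h.norm_bilinearCov_sub_le ha0) ?_
  rw [secondCumulantSum, bilinearCov_pi_finSucc h.bdd h.bdd, integral_pi_finSucc h.bdd]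

lemma BddMeasurable.secondCumulantSum_finCons {F : (Fin (n + 1) → Y) → ℂ}
    (hF : BddMeasurable F) :
    BddMeasurable fun x => secondCumulantSum (Measure.pi fun _ => μ) fun y => F (Fin.cons x y) := by
  have := (hF.integral_finCons (μ := μ)).add ((hF.bilinearCov_finCons hF (μ := μ)).const_mul (1 / 2))
  convert this using 2
  rw [secondCumulantSum]; ring

lemma secondCumulantSum_ofReal_re {α : Type*} [MeasurableSpace α] (ν : Measure α) (F : α → ℂ) :
    ((secondCumulantSum ν fun y => ((F y).re : ℂ)).re : ℂ) =
      secondCumulantSum ν fun y => ((F y).re : ℂ) := by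
  have h1 : bilinearCov ν (fun y => ((F y).re : ℂ)) (fun y => ((F y).re : ℂ)) =
      ((∫ y, (F y).re * (F y).re ∂ν - (∫ y, (F y).re ∂ν) * ∫ y, (F y).re ∂ν : ℝ) : ℂ) := by
    simp only [bilinearCov, ← Complex.ofReal_mul, integral_complex_ofReal, ← Complex.ofReal_sub]
  rw [secondCumulantSum, h1, integral_complex_ofReal]
  norm_cast

lemma re_secondCumulantSum_ofReal {α : Type*} [MeasurableSpace α] (ν : Measure α)
    [IsProbabilityMeasure ν] {f : α → ℝ} (hf : MemLp f 2 ν) :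
    (secondCumulantSum ν fun y => (f y : ℂ)).re = ∫ y, f y ∂ν + variance f ν / 2 := by
  simp only [secondCumulantSum, bilinearCov, ← Complex.ofReal_mul, integral_complex_ofReal]
  rw [variance_eq_sub hf]
  norm_cast
  simp only [pow_two, Pi.mul_apply]

/-- The variance of the imaginary part enters a pseudovariance with a minus sign, so `|e^{U(F)}|`
can be much smaller than `e^{U(Re F)}`. Their ratio is the factor `e^{Var(Im F)/2}` in the final
bound. -/
lemma re_secondCumulantSum {α : Type*} [MeasurableSpace α] (ν : Measure α)
    [IsProbabilityMeasure ν] {F : α → ℂ} (hF : MemLp F 2 ν) :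
    (secondCumulantSum ν F).re = ∫ y, (F y).re ∂ν +
      (variance (fun y => (F y).re) ν - variance (fun y => (F y).im) ν) / 2 := by
  have hre : MemLp (fun y => (F y).re) 2 ν := hF.re
  have him : MemLp (fun y => (F y).im) 2 ν := hF.im
  have i0 : Integrable F ν := hF.integrable (by norm_num)
  have i1 : Integrable (fun y => (F y).re * (F y).re) ν := hre.integrable_mul hre
  have i2 : Integrable (fun y => (F y).im * (F y).im) ν := him.integrable_mul him
  have i3 : Integrable (fun y => F y * F y) ν := hF.integrable_mul hF
  have h1 : (∫ y, F y * F y ∂ν).re = ∫ y, (F y).re * (F y).re ∂ν - ∫ y, (F y).im * (F y).im ∂ν := by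
    rw [← integral_sub i1 i2]
    exact (integral_re i3).symm
  have h2 : (∫ y, F y ∂ν).re = ∫ y, (F y).re ∂ν := (integral_re i0).symm
  have h3 : (∫ y, F y ∂ν).im = ∫ y, (F y).im ∂ν := (integral_im i0).symm
  have h6 : (secondCumulantSum ν F).re = (∫ y, F y ∂ν).re +
    ((∫ y, F y * F y ∂ν).re - ((∫ y, F y ∂ν).re * (∫ y, F y ∂ν).re -
      (∫ y, F y ∂ν).im * (∫ y, F y ∂ν).im)) / 2 := by
    simp only [secondCumulantSum, bilinearCov]
    simp
  rw [h6, h1, h2, h3, variance_eq_sub hre, variance_eq_sub him]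
  simp only [pow_two, Pi.mul_apply]
  ring

lemma re_secondCumulantSum_le {α : Type*} [MeasurableSpace α] (ν : Measure α)
    [IsProbabilityMeasure ν] {F : α → ℂ} (hF : MemLp F 2 ν) :
    (secondCumulantSum ν F).re ≤ (secondCumulantSum ν fun y => ((F y).re : ℂ)).re := by
  have hre : MemLp (fun y => (F y).re) 2 ν := hF.re
  rw [re_secondCumulantSum ν hF, re_secondCumulantSum_ofReal ν hre]
  have := variance_nonneg (fun y => (F y).im) ν
  linarith

/-- The expansion for the real part, used to integrate the inductive error over the first
coordinate. -/
lemma SmallDifferences.integral_exp_secondCumulantSum_le {a : ℝ}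
    {F : (Fin (n + 1) → Y) → ℂ} (ha0 : 0 ≤ a) (ha1 : a ≤ 2 / 3) (h : SmallDifferences a F) :
    ∫ x, Real.exp (secondCumulantSum (Measure.pi fun _ => μ)
        fun y => ((F (Fin.cons x y)).re : ℂ)).re ∂μ ≤
      Real.exp (secondCumulantSum (Measure.pi fun _ => μ) fun y => ((F y).re : ℂ)).re *
        Real.exp (a ^ 3) := by
  have key := h.ofReal_re.norm_integral_cexp_secondCumulantSum_sub_le (μ := μ) ha0 ha1
  set U := (secondCumulantSum (Measure.pi fun _ => μ) fun y => ((F y).re : ℂ)).re with hU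
  rw [← secondCumulantSum_ofReal_re _ F] at key
  have : ∀ x, Complex.exp (secondCumulantSum (Measure.pi fun _ => μ)
      fun y : Fin n → Y => ((F (Fin.cons x y)).re : ℂ)) = ((Real.exp (secondCumulantSum
        (Measure.pi fun _ => μ) fun y : Fin n → Y => ((F (Fin.cons x y)).re : ℂ)).re : ℝ) : ℂ) := by
    intro x
    rw [Complex.ofReal_exp, secondCumulantSum_ofReal_re _ fun y : Fin n → Y => F (Fin.cons x y)]
  simp_rw [this] at key
  rw [integral_complex_ofReal, ← hU, ← Complex.ofReal_exp, ← Complex.ofReal_sub,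
    Complex.norm_real, Complex.norm_real, Real.norm_eq_abs, Real.norm_eq_abs, Real.abs_exp] at key
  have := (le_abs_self _).trans key
  linarith

/-- Induction on the dimension. The inductive error is integrated in absolute value over the first
coordinate, so it must be measured by a quantity that reproduces itself under this integration up to
`e^{a³}`. The exponential of the real cumulant sum does; the modulus of the complex main term does
not, because taking moduli discards the phase of the conditional means. -/
theorem SmallDifferences.norm_integral_cexp_sub_le {a : ℝ} (ha0 : 0 ≤ a) (ha1 : a ≤ 2 / 3)
    {n : ℕ} : ∀ {F : (Fin n → Y) → ℂ}, SmallDifferences a F →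
    ‖∫ y, Complex.exp (F y) ∂Measure.pi (fun _ => μ) -
        Complex.exp (secondCumulantSum (Measure.pi fun _ => μ) F)‖ ≤
      Real.exp (secondCumulantSum (Measure.pi fun _ => μ) fun y => ((F y).re : ℂ)).re *
        (Real.exp (n * a ^ 3) - 1) := by
  induction n with
  | zero =>
    intro F hF
    have z : Fin 0 → Y := fun i => i.elim0
    simp only [secondCumulantSum, bilinearCov]
    rw [integral_pi_finZero _ z, integral_pi_finZero _ z, integral_pi_finZero _ z]
    simp
  | succ n ih =>
    intro F hF
    have h1 := hF.norm_integral_cexp_secondCumulantSum_sub_le (μ := μ) ha0 ha1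
    have h2 := hF.integral_exp_secondCumulantSum_le (μ := μ) ha0 ha1
    have h3 : ‖∫ y, Complex.exp (F y) ∂Measure.pi (fun _ => μ) -
        ∫ x, Complex.exp (secondCumulantSum (Measure.pi fun _ => μ)
          fun y => F (Fin.cons x y)) ∂μ‖ ≤
        (∫ x, Real.exp (secondCumulantSum (Measure.pi fun _ => μ)
          fun y => ((F (Fin.cons x y)).re : ℂ)).re ∂μ) * (Real.exp (n * a ^ 3) - 1) := by
      rw [integral_pi_finSucc hF.bdd.cexp, ← integral_sub hF.bdd.cexp.integral_finCons.integrable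
        hF.bdd.secondCumulantSum_finCons.cexp.integrable, ← integral_mul_const]
      exact norm_integral_le_of_norm_le
        ((hF.ofReal_re.bdd.secondCumulantSum_finCons.re.exp_real.integrable).mul_const _)
        (.of_forall fun x => ih (hF.finCons x))
    have h4 := re_secondCumulantSum_le (Measure.pi fun _ : Fin (n + 1) => μ) hF.bdd.memLp
    rw [Complex.norm_exp] at h1
    set U := (secondCumulantSum (Measure.pi fun _ : Fin (n + 1) => μ)
      fun y => ((F y).re : ℂ)).re with hU
    have h5 : (0 : ℝ) ≤ Real.exp (a ^ 3) - 1 := by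
      linarith [Real.one_le_exp (pow_nonneg ha0 3)]
    have h6 : (0 : ℝ) ≤ Real.exp (n * a ^ 3) - 1 := by
      linarith [Real.one_le_exp (mul_nonneg (Nat.cast_nonneg n) (pow_nonneg ha0 3))]
    have h7 : Real.exp ((n + 1 : ℕ) * a ^ 3) = Real.exp (n * a ^ 3) * Real.exp (a ^ 3) := by
      rw [← Real.exp_add]; congr 1; push_cast; ring
    rw [h7]
    calc _ ≤ _ := norm_sub_le_norm_sub_add_norm_sub _ _ _
      -- The inductive error and the new one telescope: `e^{a³}(e^{n a³} - 1) + (e^{a³} - 1) =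
      -- e^{(n+1) a³} - 1`.
      _ ≤ Real.exp U * Real.exp (a ^ 3) * (Real.exp (n * a ^ 3) - 1) +
          Real.exp U * (Real.exp (a ^ 3) - 1) := by
        refine add_le_add (h3.trans ?_) (h1.trans ?_)
        · gcongr
        · gcongr
      _ = _ := by ring

/-- Hoeffding's lemma at parameter `1`: the values lie in an interval of length `a` starting at the
infimum. -/
lemma integral_exp_le_of_forall_sub_le {G : Y → ℝ} (hG : BddMeasurable G) {a : ℝ}
    (ha : ∀ x x', ‖G x - G x'‖ ≤ a) :
    ∫ x, Real.exp (G x) ∂μ ≤ Real.exp (∫ x, G x ∂μ + a ^ 2 / 8) := by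
  have : Nonempty Y := nonempty_of_isProbabilityMeasure μ
  obtain ⟨B, hB⟩ := hG.bounded
  have hbdd : BddBelow (Set.range G) := ⟨-B, by
    rintro _ ⟨x, rfl⟩
    exact (abs_le.1 (hB x)).1⟩
  have ha0 : 0 ≤ a := (norm_nonneg _).trans (ha (Classical.arbitrary Y) (Classical.arbitrary Y))
  have hmem : ∀ x, G x ∈ Set.Icc (⨅ x, G x) ((⨅ x, G x) + a) := fun x => by
    refine ⟨ciInf_le hbdd x, ?_⟩
    have : G x - a ≤ ⨅ x, G x := le_ciInf fun x' => by
      have := (le_abs_self _).trans (ha x x')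
      linarith
    linarith
  have h := (hasSubgaussianMGF_of_mem_Icc (μ := μ) hG.measurable.aemeasurable
    (.of_forall hmem)).mgf_le 1
  have hmgf : mgf (fun x => G x - ∫ y, G y ∂μ) μ 1 =
      (∫ x, Real.exp (G x) ∂μ) * Real.exp (-∫ y, G y ∂μ) := by
    rw [mgf, ← integral_mul_const]
    simp_rw [← Real.exp_add, one_mul, sub_eq_add_neg]
  rw [hmgf] at h
  have hc : (((‖(⨅ x, G x) + a - ⨅ x, G x‖₊ / 2) ^ 2 : NNReal) : ℝ) * 1 ^ 2 / 2 = a ^ 2 / 8 := by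
    simp [abs_of_nonneg ha0]; ring
  rw [hc] at h
  rw [Real.exp_add]
  calc _ = (∫ x, Real.exp (G x) ∂μ) * Real.exp (-∫ y, G y ∂μ) * Real.exp (∫ y, G y ∂μ) := by
        rw [mul_assoc, ← Real.exp_add]; simp
    _ ≤ Real.exp (a ^ 2 / 8) * Real.exp (∫ y, G y ∂μ) := by gcongr
    _ = _ := mul_comm _ _

/-- The bounded differences argument: Hoeffding's lemma is applied to the conditional mean given the
first coordinate, after the inductive bound on the sections. Only first differences are needed, at
the price of the exponent `a²/8` per coordinate. -/
theorem integral_exp_pi_le {n : ℕ} : ∀ {G : (Fin n → Y) → ℝ}, BddMeasurable G →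
    ∀ {α : Fin n → ℝ}, OscillationLE G α →
    ∫ y, Real.exp (G y) ∂Measure.pi (fun _ => μ) ≤
      Real.exp (∫ y, G y ∂Measure.pi (fun _ => μ) + (∑ j, α j ^ 2) / 8) := by
  induction n with
  | zero =>
    intro G _ α _
    have z : Fin 0 → Y := fun i => i.elim0
    rw [integral_pi_finZero _ z, integral_pi_finZero _ z]
    simp
  | succ n ih =>
    intro G hG α hα
    rw [integral_pi_finSucc hG.exp_real, integral_pi_finSucc hG, Fin.sum_univ_succ]
    have h1 := integral_exp_le_of_forall_sub_le (μ := μ) (hG.integral_finCons (μ := μ))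
      (hα.integral_finCons hG)
    calc _ ≤ ∫ x, Real.exp (∫ y, G (Fin.cons x y) ∂Measure.pi (fun _ => μ)) *
          Real.exp ((∑ j : Fin n, α j.succ ^ 2) / 8) ∂μ := by
          refine integral_mono hG.exp_real.integral_finCons.integrable
            (hG.integral_finCons.exp_real.integrable.mul_const _) fun x => ?_
          simp only [← Real.exp_add]
          exact ih (hG.finCons x) (hα.finCons x)
      _ ≤ _ := by
          rw [integral_mul_const]
          refine (mul_le_mul_of_nonneg_right h1 (Real.exp_nonneg _)).trans ?_
          rw [← Real.exp_add]
          apply le_of_eq; congr 1; ring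

end Product

/-! ### Clamping to a cube, which extends functions controlled only there to the whole space. -/

section Cube

variable {n : ℕ} {ρ : ℝ}

/-- The projection of `ℝⁿ` onto the cube. -/
def clampCube (ρ : ℝ) (y : Fin n → ℝ) : Fin n → ℝ := fun j => max (-ρ) (min ρ (y j))

lemma abs_clamp_le (hρ : 0 ≤ ρ) (t : ℝ) : |max (-ρ) (min ρ t)| ≤ ρ :=
  abs_le.2 ⟨le_max_left _ _, max_le (by linarith) (min_le_left _ _)⟩

lemma clampCube_mem (hρ : 0 ≤ ρ) (y : Fin n → ℝ) : clampCube ρ y ∈ cube n ρ :=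
  fun j => abs_clamp_le hρ (y j)

lemma clampCube_of_mem {y : Fin n → ℝ} (hy : y ∈ cube n ρ) : clampCube ρ y = y := by
  ext j
  have := abs_le.1 (hy j)
  simp [clampCube, this.1, this.2]

lemma clampCube_update (y : Fin n → ℝ) (j : Fin n) (t : ℝ) :
    clampCube ρ (Function.update y j t) =
      Function.update (clampCube ρ y) j (max (-ρ) (min ρ t)) := by
  ext i
  by_cases h : i = j
  · subst h; simp [clampCube]
  · simp [clampCube, h]

lemma measurable_clampCube : Measurable (clampCube ρ : (Fin n → ℝ) → Fin n → ℝ) := by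
  unfold clampCube
  fun_prop

lemma update_mem_cube {y : Fin n → ℝ} (hy : y ∈ cube n ρ) (j : Fin n) {t : ℝ} (ht : |t| ≤ ρ) :
    Function.update y j t ∈ cube n ρ := by
  intro i
  by_cases h : i = j
  · subst h; simpa using ht
  · simpa [h] using hy i

end Cube

/-! ### Row and column sums of a matrix. -/

section MatrixNormBounds

variable {n : ℕ} (M : Matrix (Fin n) (Fin n) ℝ)

lemma sum_abs_row_le_matrixNormInf (i : Fin n) : ∑ j, |M i j| ≤ matrixNormInf M := by
  rw [matrixNormInf, Matrix.linfty_opNorm_def]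
  have := Finset.le_sup (f := fun i => ∑ j, ‖M i j‖₊) (Finset.mem_univ i)
  have h2 : ((∑ j, ‖M i j‖₊ : NNReal) : ℝ) ≤ _ := NNReal.coe_le_coe.2 this
  simpa using h2

lemma sum_abs_col_le_matrixNormOne (j : Fin n) : ∑ i, |M i j| ≤ matrixNormOne M :=
  sum_abs_row_le_matrixNormInf Mᵀ j

lemma matrixNormInf_nonneg : 0 ≤ matrixNormInf M := by
  rw [matrixNormInf, Matrix.linfty_opNorm_def]; exact NNReal.coe_nonneg _

lemma matrixNormOne_nonneg : 0 ≤ matrixNormOne M := matrixNormInf_nonneg Mᵀ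

end MatrixNormBounds

/-! ### From bounds on derivatives to bounds on coordinate differences. -/

section MeanValue

variable {n : ℕ} {ρ : ℝ} {E : Type*} [NormedAddCommGroup E] [NormedSpace ℝ E]

lemma norm_sub_le_of_hasDerivAt_Icc {u u' : ℝ → E} {C : ℝ}
    (hu : ∀ s, |s| ≤ ρ → HasDerivAt u (u' s) s) (hC : ∀ s, |s| ≤ ρ → ‖u' s‖ ≤ C)
    {s t : ℝ} (hs : |s| ≤ ρ) (ht : |t| ≤ ρ) : ‖u t - u s‖ ≤ 2 * ρ * C := by
  have h := (convex_Icc (-ρ) ρ).norm_image_sub_le_of_norm_hasDerivWithin_le (f := u) (f' := u')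
    (C := C) (fun x hx => (hu x (abs_le.2 hx)).hasDerivWithinAt) (fun x hx => hC x (abs_le.2 hx))
    (abs_le.1 hs) (abs_le.1 ht)
  refine h.trans ?_
  have h0 : 0 ≤ C := (norm_nonneg _).trans (hC s hs)
  have : ‖t - s‖ ≤ 2 * ρ := (norm_sub_le t s).trans (by simp only [Real.norm_eq_abs]; linarith)
  calc _ ≤ C * (2 * ρ) := by gcongr
    _ = _ := by ring

lemma fderiv_mulVec_single (G : (Fin n → ℝ) → E) (T : Matrix (Fin n) (Fin n) ℝ) (x : Fin n → ℝ)
    (j : Fin n) : fderiv ℝ G x (T *ᵥ Pi.single j 1) = ∑ i, T i j • partialDerivative G i x := by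
  have : T *ᵥ Pi.single j 1 = ∑ i, T i j • (Pi.single i 1 : Fin n → ℝ) := by
    ext i
    simp [Finset.sum_apply, Pi.single_apply]
  rw [this, map_sum]
  simp [partialDerivative]

lemma hasDerivAt_comp_mulVec_update {G : (Fin n → ℝ) → E} (T : Matrix (Fin n) (Fin n) ℝ)
    (y : Fin n → ℝ) (j : Fin n) (s : ℝ)
    (hG : DifferentiableAt ℝ G (T *ᵥ Function.update y j s)) :
    HasDerivAt (fun s => G (T *ᵥ Function.update y j s))
      (∑ i, T i j • partialDerivative G i (T *ᵥ Function.update y j s)) s := by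
  rw [← fderiv_mulVec_single]
  have h1 : HasDerivAt (fun s => T *ᵥ Function.update y j s) (T *ᵥ Pi.single j 1) s :=
    ((LinearMap.toContinuousLinearMap (Matrix.mulVecLin T)).hasFDerivAt).comp_hasDerivAt s
      (hasDerivAt_update y j s)
  exact hG.hasFDerivAt.comp_hasDerivAt s h1

/-- Moving the `j`-th coordinate of `y` moves `T y` along the `j`-th column of `T`; a segment inside
the cube has length at most `2ρ`. -/
lemma norm_comp_update_sub_le {G : (Fin n → ℝ) → E} {T : Matrix (Fin n) (Fin n) ℝ} {j : Fin n}
    {b : Fin n → ℝ}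
    (hG : ∀ y ∈ cube n ρ, DifferentiableAt ℝ G (T *ᵥ y))
    (hb : ∀ y ∈ cube n ρ, ∀ i, ‖partialDerivative G i (T *ᵥ y)‖ ≤ b i)
    {y : Fin n → ℝ} (hy : y ∈ cube n ρ) {t : ℝ} (ht : |t| ≤ ρ) :
    ‖G (T *ᵥ Function.update y j t) - G (T *ᵥ y)‖ ≤ 2 * ρ * ∑ i, |T i j| * b i := by
  have h := norm_sub_le_of_hasDerivAt_Icc (ρ := ρ)
    (u := fun s => G (T *ᵥ Function.update y j s)) (C := ∑ i, |T i j| * b i)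
    (fun s hs => hasDerivAt_comp_mulVec_update T y j s (hG _ (update_mem_cube hy j hs)))
    (fun s hs => (norm_sum_le _ _).trans (Finset.sum_le_sum fun i _ => by
      rw [norm_smul, Real.norm_eq_abs]
      exact mul_le_mul_of_nonneg_left (hb _ (update_mem_cube hy j hs) i) (abs_nonneg _)))
    (hy j) ht
  simpa using h

/-- The hypothesis bounds products with the norm, so the norm has to be divided out; if it is zero,
the column vanishes instead. -/
lemma sum_abs_mul_le_of_matrixNormOne {T : Matrix (Fin n) (Fin n) ℝ} {b : Fin n → ℝ} {a : ℝ}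
    (ha : 0 ≤ a) (hb : ∀ i, matrixNormOne T * b i ≤ a) (j : Fin n) :
    ∑ i, |T i j| * b i ≤ a := by
  have hcol := sum_abs_col_le_matrixNormOne T j
  rcases (matrixNormOne_nonneg T).eq_or_lt with h | h
  · rw [← h] at hcol
    have hz : ∀ i, |T i j| = 0 := by
      have := (Finset.sum_eq_zero_iff_of_nonneg (s := Finset.univ) (f := fun i => |T i j|)
        (fun i _ => abs_nonneg _)).1 (le_antisymm hcol (Finset.sum_nonneg fun i _ => abs_nonneg _))
      exact fun i => this i (Finset.mem_univ i)
    simp [hz, ha]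
  · refine le_of_mul_le_mul_left ?_ h
    rw [Finset.mul_sum]
    calc _ = ∑ i, |T i j| * (matrixNormOne T * b i) := Finset.sum_congr rfl fun i _ => by ring
      _ ≤ ∑ i, |T i j| * a :=
        Finset.sum_le_sum fun i _ => mul_le_mul_of_nonneg_left (hb i) (abs_nonneg _)
      _ ≤ matrixNormOne T * a := by rw [← Finset.sum_mul]; gcongr

lemma differentiableAt_of_differentiableNear {G : (Fin n → ℝ) → E}
    {T : Matrix (Fin n) (Fin n) ℝ} (h : DifferentiableNear G ((fun y => T *ᵥ y) '' cube n ρ)) :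
    ∀ y ∈ cube n ρ, DifferentiableAt ℝ G (T *ᵥ y) := by
  obtain ⟨S, hS, hB, hd⟩ := h
  exact fun y hy => hd.differentiableAt (hS.mem_nhds (hB ⟨y, hy, rfl⟩))

/-- The clamped pullback of a function with bounded partial derivatives. -/
lemma oscillationLE_comp_clampCube {G : (Fin n → ℝ) → E} {T : Matrix (Fin n) (Fin n) ℝ}
    (hρ : 0 ≤ ρ) {a : ℝ} (ha : 0 ≤ a)
    (hG : ∀ y ∈ cube n ρ, DifferentiableAt ℝ G (T *ᵥ y))
    (hb : ∀ y ∈ cube n ρ, ∀ i, 2 * ρ * matrixNormOne T * ‖partialDerivative G i (T *ᵥ y)‖ ≤ a) :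
    OscillationLE (fun y => G (T *ᵥ clampCube ρ y)) fun _ => a := by
  intro y j t
  simp only [clampCube_update]
  have hy := clampCube_mem hρ y
  -- The factor `2ρ` is part of the derivative hypothesis, so the mean value inequality is applied
  -- to `2ρ • G` and the factor is cancelled afterwards. For `ρ = 0` the cube is a point and the
  -- difference is zero.
  have h := norm_sub_le_of_hasDerivAt_Icc (ρ := ρ)
    (u := fun s => (2 * ρ) • G (T *ᵥ Function.update (clampCube ρ y) j s)) (C := a)
    (fun s hs => (hasDerivAt_comp_mulVec_update T _ j s
      (hG _ (update_mem_cube hy j hs))).const_smul (2 * ρ))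
    (fun s hs => by
      rw [Finset.smul_sum]
      refine (norm_sum_le _ _).trans ?_
      refine le_trans (Finset.sum_le_sum fun i _ => ?_)
        (sum_abs_mul_le_of_matrixNormOne (T := T) ha (b := fun i => 2 * ρ *
          ‖partialDerivative G i (T *ᵥ Function.update (clampCube ρ y) j s)‖) (fun i => ?_) j)
      · rw [norm_smul, norm_smul, Real.norm_eq_abs, Real.norm_eq_abs, abs_of_nonneg (by linarith)]
        apply le_of_eq; ring
      · have := hb _ (update_mem_cube hy j hs) i
        linarith)
    (hy j) (abs_clamp_le hρ t)
  rcases hρ.eq_or_lt with h0 | h0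
  · have : Function.update (clampCube ρ y) j (max (-ρ) (min ρ t)) = clampCube ρ y := by
      rw [Function.update_eq_self_iff]
      have h1 := hy j
      have h2 := abs_clamp_le hρ t
      rw [← h0] at h1 h2
      rw [← h0, abs_nonpos_iff.1 h1, abs_nonpos_iff.1 h2]
    rw [this]; simpa using ha
  · simp only [Function.update_eq_self] at h
    rw [← smul_sub, norm_smul, Real.norm_eq_abs, abs_of_pos (by linarith)] at h
    exact le_of_mul_le_mul_left h (by linarith)

lemma norm_partialDerivative_le_hessianSup {G : (Fin n → ℝ) → E} {B : Set (Fin n → ℝ)}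
    (h : HessianBddOn G B) {x : Fin n → ℝ} (hx : x ∈ B) (j k : Fin n) :
    ‖partialDerivative (partialDerivative G j) k x‖ ≤ hessianSup G B j k :=
  le_csSup (h j k) ⟨x, hx, rfl⟩

lemma hessianSup_nonneg {G : (Fin n → ℝ) → E} {B : Set (Fin n → ℝ)} (j k : Fin n) :
    0 ≤ hessianSup G B j k := by
  rw [hessianSup, Matrix.of_apply]
  refine Real.sSup_nonneg ?_
  rintro _ ⟨y, _, rfl⟩
  exact norm_nonneg _

/-- Two mean value estimates: the difference in coordinate `j` is differentiated in coordinate `k`,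
which produces differences in coordinate `j` of first partial derivatives, and these are bounded
through the second ones. -/
lemma mixedOscillationLE_comp_clampCube {G : (Fin n → ℝ) → E} {T : Matrix (Fin n) (Fin n) ℝ}
    (hρ : 0 ≤ ρ)
    (hd : TwiceDifferentiableNear G ((fun y => T *ᵥ y) '' cube n ρ))
    (hH : HessianBddOn G ((fun y => T *ᵥ y) '' cube n ρ)) (k : Fin n) :
    MixedOscillationLE (fun y => G (T *ᵥ clampCube ρ y)) k fun j => 2 * ρ * ∑ i, |T i k| *
      (2 * ρ * ∑ l, |T l j| * hessianSup G ((fun y => T *ᵥ y) '' cube n ρ) i l) := by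
  obtain ⟨S, hS, hB, hd1, hd2⟩ := hd
  have hG1 : ∀ y ∈ cube n ρ, DifferentiableAt ℝ G (T *ᵥ y) := fun y hy =>
    hd1.differentiableAt (hS.mem_nhds (hB ⟨y, hy, rfl⟩))
  have hG2 : ∀ i, ∀ y ∈ cube n ρ, DifferentiableAt ℝ (partialDerivative G i) (T *ᵥ y) :=
    fun i y hy => (hd2.differentiableAt (hS.mem_nhds (hB ⟨y, hy, rfl⟩))).clm_apply
      (differentiableAt_const _)
  intro j hj y s t
  simp only [clampCube_update]
  set z := clampCube ρ y with hz
  have hzc : z ∈ cube n ρ := clampCube_mem hρ y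
  have hs := abs_clamp_le hρ s
  have ht := abs_clamp_le hρ t
  set s' := max (-ρ) (min ρ s)
  set t' := max (-ρ) (min ρ t)
  have h := norm_sub_le_of_hasDerivAt_Icc (ρ := ρ)
    (u := fun r => G (T *ᵥ Function.update (Function.update z j t') k r) -
      G (T *ᵥ Function.update z k r))
    (C := ∑ i, |T i k| *
      (2 * ρ * ∑ l, |T l j| * hessianSup G ((fun y => T *ᵥ y) '' cube n ρ) i l))
    (fun r hr => (hasDerivAt_comp_mulVec_update T _ k r
        (hG1 _ (update_mem_cube (update_mem_cube hzc j ht) k hr))).sub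
      (hasDerivAt_comp_mulVec_update T _ k r (hG1 _ (update_mem_cube hzc k hr))))
    (fun r hr => by
      rw [← Finset.sum_sub_distrib]
      refine (norm_sum_le _ _).trans (Finset.sum_le_sum fun i _ => ?_)
      rw [← smul_sub, norm_smul, Real.norm_eq_abs, Function.update_comm hj]
      refine mul_le_mul_of_nonneg_left ?_ (abs_nonneg _)
      exact norm_comp_update_sub_le (hG2 i)
        (fun w hw l => norm_partialDerivative_le_hessianSup hH ⟨w, hw, rfl⟩ i l)
        (update_mem_cube hzc k hr) ht)
    (hzc k) hs
  refine le_of_eq_of_le (congrArg norm ?_) h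
  rw [Function.update_comm hj.symm s' t' z, Function.update_eq_self k z]
  have : Function.update (Function.update z j t') k (z k) = Function.update z j t' := by
    rw [Function.update_eq_self_iff, Function.update_of_ne hj.symm]
  rw [this]
  abel

/-- Summing over `j` first produces row sums of `T`, then row sums of the Hessian matrix, and a
column sum of `T` is left. Hence the product of norms in the hypothesis. -/
lemma exists_mixedOscillationLE_comp_clampCube {G : (Fin n → ℝ) → E}
    {T : Matrix (Fin n) (Fin n) ℝ} (hρ : 0 ≤ ρ) {a : ℝ}
    (hd : TwiceDifferentiableNear G ((fun y => T *ᵥ y) '' cube n ρ))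
    (hH : HessianBddOn G ((fun y => T *ᵥ y) '' cube n ρ))
    (h2 : 4 * ρ ^ 2 * matrixNormOne T * matrixNormInf T *
      matrixNormInf (hessianSup G ((fun y => T *ᵥ y) '' cube n ρ)) ≤ a) (k : Fin n) :
    ∃ D : Fin n → ℝ, (∀ j, 0 ≤ D j) ∧ ∑ j, D j ≤ a ∧
      MixedOscillationLE (fun y => G (T *ᵥ clampCube ρ y)) k D := by
  refine ⟨_, ?_, ?_, mixedOscillationLE_comp_clampCube hρ hd hH k⟩
  · intro j
    refine mul_nonneg (by linarith) (Finset.sum_nonneg fun i _ => mul_nonneg (abs_nonneg _)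
      (mul_nonneg (by linarith) (Finset.sum_nonneg fun l _ => mul_nonneg (abs_nonneg _)
        (hessianSup_nonneg _ _))))
  · refine le_trans ?_ h2
    set H := hessianSup G ((fun y => T *ᵥ y) '' cube n ρ) with hHdef
    have e1 : ∑ j, 2 * ρ * ∑ i, |T i k| * (2 * ρ * ∑ l, |T l j| * H i l) =
        4 * ρ ^ 2 * ∑ i, |T i k| * ∑ l, H i l * ∑ j, |T l j| := by
      simp only [Finset.mul_sum]
      rw [Finset.sum_comm]
      refine Finset.sum_congr rfl fun i _ => ?_
      rw [Finset.sum_comm]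
      refine Finset.sum_congr rfl fun l _ => Finset.sum_congr rfl fun j _ => ?_
      ring
    have hrow : ∀ i, ∑ l, H i l * ∑ j, |T l j| ≤ matrixNormInf H * matrixNormInf T := fun i => by
      calc _ ≤ ∑ l, |H i l| * matrixNormInf T := Finset.sum_le_sum fun l _ =>
            mul_le_mul (le_abs_self _) (sum_abs_row_le_matrixNormInf T l)
              (Finset.sum_nonneg fun _ _ => abs_nonneg _) (abs_nonneg _)
        _ ≤ _ := by
          rw [← Finset.sum_mul]
          exact mul_le_mul_of_nonneg_right (sum_abs_row_le_matrixNormInf H i)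
            (matrixNormInf_nonneg T)
    have hcol : ∑ i, |T i k| * ∑ l, H i l * ∑ j, |T l j| ≤
        matrixNormOne T * (matrixNormInf H * matrixNormInf T) := by
      calc _ ≤ ∑ i, |T i k| * (matrixNormInf H * matrixNormInf T) :=
            Finset.sum_le_sum fun i _ => mul_le_mul_of_nonneg_left (hrow i) (abs_nonneg _)
        _ ≤ _ := by
          rw [← Finset.sum_mul]
          exact mul_le_mul_of_nonneg_right (sum_abs_col_le_matrixNormOne T k)
            (mul_nonneg (matrixNormInf_nonneg H) (matrixNormInf_nonneg T))
    rw [e1]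
    calc _ ≤ 4 * ρ ^ 2 * (matrixNormOne T * (matrixNormInf H * matrixNormInf T)) := by gcongr
      _ = _ := by ring

lemma TwiceDifferentiableNear.differentiableNear {G : (Fin n → ℝ) → E} {B : Set (Fin n → ℝ)}
    (h : TwiceDifferentiableNear G B) : DifferentiableNear G B := by
  obtain ⟨S, hS, hB, hd, -⟩ := h
  exact ⟨S, hS, hB, hd⟩

lemma smallDifferences_comp_clampCube {G : (Fin n → ℝ) → ℂ} {T : Matrix (Fin n) (Fin n) ℝ}
    (hρ : 0 ≤ ρ) {a : ℝ} (ha : 0 ≤ a) (hGb : BddMeasurable fun y => G (T *ᵥ clampCube ρ y))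
    (hd : TwiceDifferentiableNear G ((fun y => T *ᵥ y) '' cube n ρ))
    (hH : HessianBddOn G ((fun y => T *ᵥ y) '' cube n ρ))
    (h1 : ∀ x ∈ (fun y => T *ᵥ y) '' cube n ρ, ∀ j,
      2 * ρ * matrixNormOne T * ‖partialDerivative G j x‖ ≤ a)
    (h2 : 4 * ρ ^ 2 * matrixNormOne T * matrixNormInf T *
      matrixNormInf (hessianSup G ((fun y => T *ᵥ y) '' cube n ρ)) ≤ a) :
    SmallDifferences a fun y => G (T *ᵥ clampCube ρ y) :=
  ⟨hGb, oscillationLE_comp_clampCube hρ ha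
    (differentiableAt_of_differentiableNear hd.differentiableNear)
    fun y hy i => h1 _ ⟨y, hy, rfl⟩ i,
    exists_mixedOscillationLE_comp_clampCube hρ hd hH h2⟩

lemma smallDifferences_ofReal_comp_clampCube {G : (Fin n → ℝ) → ℝ}
    {T : Matrix (Fin n) (Fin n) ℝ}
    (hρ : 0 ≤ ρ) {a : ℝ} (ha : 0 ≤ a) (hGb : BddMeasurable fun y => G (T *ᵥ clampCube ρ y))
    (hd : TwiceDifferentiableNear G ((fun y => T *ᵥ y) '' cube n ρ))
    (hH : HessianBddOn G ((fun y => T *ᵥ y) '' cube n ρ))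
    (h1 : ∀ x ∈ (fun y => T *ᵥ y) '' cube n ρ, ∀ j,
      2 * ρ * matrixNormOne T * ‖partialDerivative G j x‖ ≤ a)
    (h2 : 4 * ρ ^ 2 * matrixNormOne T * matrixNormInf T *
      matrixNormInf (hessianSup G ((fun y => T *ᵥ y) '' cube n ρ)) ≤ a) :
    SmallDifferences a fun y => (G (T *ᵥ clampCube ρ y) : ℂ) := by
  have ho := oscillationLE_comp_clampCube hρ ha
    (differentiableAt_of_differentiableNear hd.differentiableNear)
    fun y hy i => h1 _ ⟨y, hy, rfl⟩ i
  refine ⟨hGb.ofReal, fun y j t => ?_, fun k => ?_⟩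
  · rw [← Complex.ofReal_sub, Complex.norm_real]
    exact ho y j t
  · obtain ⟨D, h0, hs, hD⟩ := exists_mixedOscillationLE_comp_clampCube hρ hd hH h2 k
    refine ⟨D, h0, hs, fun j hj y s t => ?_⟩
    rw [← Complex.ofReal_sub, ← Complex.ofReal_sub, ← Complex.ofReal_add, Complex.norm_real]
    exact hD j hj y s t

lemma matrixNormInf_mono {M N : Matrix (Fin n) (Fin n) ℝ} (h0 : ∀ i j, 0 ≤ M i j)
    (h : ∀ i j, M i j ≤ N i j) : matrixNormInf M ≤ matrixNormInf N := by
  rw [matrixNormInf, matrixNormInf, Matrix.linfty_opNorm_def, Matrix.linfty_opNorm_def]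
  refine NNReal.coe_le_coe.2 (Finset.sup_mono_fun fun i _ => Finset.sum_le_sum fun j _ => ?_)
  rw [← NNReal.coe_le_coe, coe_nnnorm, coe_nnnorm, Real.norm_of_nonneg (h0 i j)]
  exact (h i j).trans (le_abs_self _)

lemma hessianSup_mono {G : (Fin n → ℝ) → E} {B B' : Set (Fin n → ℝ)} (hB : B ⊆ B')
    (h : HessianBddOn G B') (j k : Fin n) : hessianSup G B j k ≤ hessianSup G B' j k := by
  -- Over the empty set the real supremum has the default value `0`.
  rcases B.eq_empty_or_nonempty with rfl | hne
  · refine le_trans (le_of_eq ?_) (hessianSup_nonneg j k)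
    simp [hessianSup]
  · exact csSup_le_csSup (h j k) (hne.image _) (Set.image_mono hB)

end MeanValue

/-! ### Reduction to independent normal coordinates. -/

section StandardNormal

/-- The law of `n` independent normal variables of variance `1/2`. -/
noncomputable abbrev halfNormal (n : ℕ) : Measure (Fin n → ℝ) :=
  Measure.pi fun _ => gaussianReal 0 (1 / 2)

lemma gaussianPDFReal_half (x : ℝ) :
    gaussianPDFReal 0 (1 / 2) x = (√Real.pi)⁻¹ * Real.exp (-x ^ 2) := by
  have h : (2 : ℝ) * Real.pi * ((1 / 2 : NNReal) : ℝ) = Real.pi := by push_cast; ring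
  rw [gaussianPDFReal, h]
  norm_num

lemma halfNormal_eq_withDensity (n : ℕ) :
    halfNormal n = volume.withDensity fun y =>
      ENNReal.ofReal (∏ i, gaussianPDFReal 0 (1 / 2) (y i)) := by
  refine Measure.pi_eq fun s hs => ?_
  rw [withDensity_apply _ (MeasurableSet.univ_pi hs), ← ofReal_integral_eq_lintegral_ofReal,
    volume_pi, Measure.restrict_pi_pi, integral_fintype_prod_eq_prod, ENNReal.ofReal_prod_of_nonneg]
  · refine Finset.prod_congr rfl fun i _ => ?_
    rw [gaussianReal_apply_eq_integral _ (by norm_num)]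
  · exact fun i _ => integral_nonneg fun x => gaussianPDFReal_nonneg _ _ _
  · rw [volume_pi, Measure.restrict_pi_pi]
    exact Integrable.fintype_prod fun i => (integrable_gaussianPDFReal 0 (1 / 2)).restrict
  · exact .of_forall fun y => Finset.prod_nonneg fun i _ => gaussianPDFReal_nonneg _ _ _

variable {n : ℕ} {A T : Matrix (Fin n) (Fin n) ℝ}

lemma prod_gaussianPDFReal_half (y : Fin n → ℝ) :
    ∏ i, gaussianPDFReal 0 (1 / 2) (y i) =
      Real.pi ^ (-(n : ℝ) / 2) * Real.exp (-∑ i, y i ^ 2) := by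
  simp_rw [gaussianPDFReal_half, Finset.prod_mul_distrib, ← Real.exp_sum, Finset.sum_neg_distrib]
  congr 1
  rw [Finset.prod_const, Finset.card_univ, Fintype.card_fin, inv_pow, Real.sqrt_eq_rpow,
    ← Real.rpow_natCast, ← Real.rpow_mul Real.pi_pos.le, ← Real.rpow_neg Real.pi_pos.le]
  congr 1; ring

lemma quadForm_mulVec (h : Tᵀ * A * T = 1) (y : Fin n → ℝ) :
    quadForm A (T *ᵥ y) = ∑ i, y i ^ 2 := by
  rw [quadForm, Matrix.mulVec_mulVec, ← Matrix.vecMul_transpose, ← Matrix.dotProduct_mulVec,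
    Matrix.mulVec_mulVec, ← Matrix.mul_assoc, h, Matrix.one_mulVec]
  simp [dotProduct, pow_two]

lemma det_ne_zero_of_transpose_mul_mul (h : Tᵀ * A * T = 1) : T.det ≠ 0 := by
  have := congrArg Matrix.det h
  rw [Matrix.det_mul, Matrix.det_one] at this
  exact right_ne_zero_of_mul_eq_one this

lemma det_rpow_mul_abs_det (hA : A.PosDef) (h : Tᵀ * A * T = 1) :
    A.det ^ (1 / 2 : ℝ) * |T.det| = 1 := by
  have h1 := congrArg Matrix.det h
  rw [Matrix.det_mul, Matrix.det_mul, Matrix.det_one, Matrix.det_transpose] at h1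
  have h2 := hA.det_pos
  rw [← Real.sqrt_eq_rpow, ← Real.sqrt_sq_eq_abs, ← Real.sqrt_mul h2.le, Real.sqrt_eq_one]
  linarith

lemma measurable_quadForm : Measurable (quadForm A) := by
  have : Continuous (quadForm A) := by
    unfold quadForm
    exact continuous_id.dotProduct (Continuous.matrix_mulVec continuous_const continuous_id)
  exact this.measurable

lemma measurable_mulVec : Measurable fun y : Fin n → ℝ => T *ᵥ y :=
  (Continuous.matrix_mulVec continuous_const continuous_id).measurable

/-- The quadratic form pulls back to `∑ y i ^ 2`, and the Jacobian `|det T|` cancels `|A|^(1/2)`. -/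
lemma normalMeasure_eq_map (hA : A.PosDef) (h : Tᵀ * A * T = 1) :
    normalMeasure A = (halfNormal n).map fun y => T *ᵥ y := by
  have hT := det_ne_zero_of_transpose_mul_mul h
  have hvol : (volume : Measure (Fin n → ℝ)).map (fun y => T *ᵥ y) =
      ENNReal.ofReal |T.det⁻¹| • volume := Real.map_matrix_volume_pi_eq_smul_volume_pi hT
  set d : (Fin n → ℝ) → ENNReal := fun x => ENNReal.ofReal
      (Real.pi ^ (-(n : ℝ) / 2) * A.det ^ (1 / 2 : ℝ) * Real.exp (-quadForm A x)) with hd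
  have hdm : Measurable d := by
    have := measurable_quadForm (A := A)
    fun_prop
  have hdT : ∀ y, ENNReal.ofReal (∏ i, gaussianPDFReal 0 (1 / 2) (y i)) =
      ENNReal.ofReal |T.det| * d (T *ᵥ y) := fun y => by
    rw [hd, ← ENNReal.ofReal_mul (abs_nonneg _), prod_gaussianPDFReal_half, quadForm_mulVec h]
    congr 1
    have := det_rpow_mul_abs_det hA h
    calc _ = (A.det ^ (1 / 2 : ℝ) * |T.det|) * (Real.pi ^ (-(n : ℝ) / 2) *
          Real.exp (-∑ i, y i ^ 2)) := by rw [this, one_mul]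
      _ = _ := by ring
  ext s hs
  rw [Measure.map_apply measurable_mulVec hs, halfNormal_eq_withDensity,
    withDensity_apply _ (measurable_mulVec hs), normalMeasure, withDensity_apply _ hs]
  simp_rw [hdT]
  change ∫⁻ a in s, d a = _
  rw [lintegral_const_mul' _ _ ENNReal.ofReal_ne_top,
    ← setLIntegral_map hs hdm measurable_mulVec, hvol, Measure.restrict_smul,
    lintegral_smul_measure, smul_eq_mul, ← mul_assoc, ← ENNReal.ofReal_mul (abs_nonneg _),
    ← abs_mul, mul_inv_cancel₀ hT]
  simp

lemma isProbabilityMeasure_normalMeasure (hA : A.PosDef) (h : Tᵀ * A * T = 1) :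
    IsProbabilityMeasure (normalMeasure A) := by
  rw [normalMeasure_eq_map hA h]
  exact Measure.isProbabilityMeasure_map measurable_mulVec.aemeasurable

end StandardNormal

/-! ### Exponential moments and tails of Gaussian squares. -/

section GaussianMoments

lemma integral_gaussianReal_half (f : ℝ → ℝ) :
    ∫ y, f y ∂gaussianReal 0 (1 / 2) = (√Real.pi)⁻¹ * ∫ y, Real.exp (-y ^ 2) * f y := by
  rw [integral_gaussianReal_eq_integral_smul (by norm_num), ← integral_const_mul]
  simp_rw [gaussianPDFReal_half, smul_eq_mul, mul_assoc]

lemma integrable_exp_mul_sq_gaussianReal {x : ℝ} (hx : x < 1) :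
    Integrable (fun y : ℝ => Real.exp (x * y ^ 2)) (gaussianReal 0 (1 / 2)) := by
  rw [gaussianReal_of_var_ne_zero _ (by norm_num : (1 / 2 : NNReal) ≠ 0),
    integrable_withDensity_iff_integrable_smul' (measurable_gaussianPDF _ _)
      (.of_forall fun _ => gaussianPDF_lt_top)]
  have : (fun y => (gaussianPDF 0 (1 / 2) y).toReal • Real.exp (x * y ^ 2)) =
      fun y => (√Real.pi)⁻¹ * Real.exp (-(1 - x) * y ^ 2) := by
    ext y
    rw [toReal_gaussianPDF, gaussianPDFReal_half, smul_eq_mul, mul_assoc, ← Real.exp_add]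
    congr 2; ring
  rw [this]
  exact (integrable_exp_neg_mul_sq (by linarith)).const_mul _

lemma integral_exp_mul_sq_gaussianReal (x : ℝ) :
    ∫ y, Real.exp (x * y ^ 2) ∂gaussianReal 0 (1 / 2) = (√(1 - x))⁻¹ := by
  rw [integral_gaussianReal_half]
  have : ∀ y : ℝ, Real.exp (-y ^ 2) * Real.exp (x * y ^ 2) = Real.exp (-(1 - x) * y ^ 2) :=
    fun y => by rw [← Real.exp_add]; congr 1; ring
  simp_rw [this]
  rw [integral_gaussian, Real.sqrt_div Real.pi_pos.le]
  have := Real.sqrt_pos.2 Real.pi_pos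
  field_simp

/-- Shift by `ρ` and use `(t + ρ)² ≥ t² + ρ²` for `t ≥ 0`; this avoids any loss in front of the
exponential. -/
lemma integral_Ioi_exp_neg_mul_sq_le {b ρ : ℝ} (hb : 0 < b) (hρ : 0 ≤ ρ) :
    ∫ y in Set.Ioi ρ, Real.exp (-b * y ^ 2) ≤ Real.exp (-b * ρ ^ 2) * (√(Real.pi / b) / 2) := by
  rw [← integral_gaussian_Ioi, ← integral_const_mul, ← integral_indicator measurableSet_Ioi,
    ← integral_indicator measurableSet_Ioi, ← integral_add_right_eq_self _ ρ]
  have hi := integrable_exp_neg_mul_sq hb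
  refine integral_mono ((hi.indicator measurableSet_Ioi).comp_add_right ρ)
    ((hi.const_mul _).indicator measurableSet_Ioi) fun t => ?_
  by_cases ht : 0 < t
  · simp only [Set.indicator, Set.mem_Ioi, ht, lt_add_iff_pos_left, if_true, ← Real.exp_add]
    apply Real.exp_le_exp.2
    nlinarith [mul_nonneg hb.le (mul_nonneg ht.le hρ)]
  · simp [Set.indicator, ht]

lemma integral_indicator_exp_mul_sq_gaussianReal_le {x ρ : ℝ} (hx : x < 1) (hρ : 0 ≤ ρ) :
    ∫ y, {y : ℝ | ρ < |y|}.indicator (fun y => Real.exp (x * y ^ 2)) y ∂gaussianReal 0 (1 / 2) ≤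
      (√(1 - x))⁻¹ * Real.exp (-(1 - x) * ρ ^ 2) := by
  rw [integral_gaussianReal_half]
  have h1 : ∀ y : ℝ, Real.exp (-y ^ 2) * {y : ℝ | ρ < |y|}.indicator
      (fun y => Real.exp (x * y ^ 2)) y =
      (Set.Ioi ρ).indicator (fun y => Real.exp (-(1 - x) * y ^ 2)) |y| := fun y => by
    by_cases hy : ρ < |y|
    · simp only [Set.indicator, Set.mem_ofPred_eq, Set.mem_Ioi, hy, if_true, sq_abs, ← Real.exp_add]
      congr 1; ring
    · simp [Set.indicator, hy]
  simp_rw [h1]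
  rw [integral_comp_abs (f := fun y => (Set.Ioi ρ).indicator
    (fun y => Real.exp (-(1 - x) * y ^ 2)) y), setIntegral_indicator measurableSet_Ioi,
    Set.Ioi_inter_Ioi, sup_eq_right.2 hρ]
  have h2 := integral_Ioi_exp_neg_mul_sq_le (b := 1 - x) (by linarith) hρ
  rw [Real.sqrt_div Real.pi_pos.le] at h2
  have hpi := Real.sqrt_pos.2 Real.pi_pos
  calc _ ≤ (√Real.pi)⁻¹ * (2 * (Real.exp (-(1 - x) * ρ ^ 2) * (√Real.pi / √(1 - x) / 2))) := by
        gcongr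
    _ = _ := by field_simp

variable {n : ℕ}

lemma exp_mul_sum_sq (x : ℝ) (y : Fin n → ℝ) :
    Real.exp (x * ∑ i, y i ^ 2) = ∏ i, Real.exp (x * y i ^ 2) := by
  rw [Finset.mul_sum, Real.exp_sum]

lemma integrable_exp_mul_sum_sq {x : ℝ} (hx : x < 1) :
    Integrable (fun y : Fin n → ℝ => Real.exp (x * ∑ i, y i ^ 2)) (halfNormal n) := by
  simp_rw [exp_mul_sum_sq]
  exact Integrable.fintype_prod fun _ => integrable_exp_mul_sq_gaussianReal hx

lemma integral_exp_mul_sum_sq (x : ℝ) :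
    ∫ y : Fin n → ℝ, Real.exp (x * ∑ i, y i ^ 2) ∂halfNormal n = (√(1 - x))⁻¹ ^ n := by
  simp_rw [exp_mul_sum_sq]
  rw [integral_fintype_prod_eq_prod fun (_ : Fin n) t => Real.exp (x * t ^ 2)]
  simp [← integral_exp_mul_sq_gaussianReal x]

lemma measurableSet_cube {ρ : ℝ} : MeasurableSet (cube n ρ) := by
  have : cube n ρ = ⋂ j, {x | |x j| ≤ ρ} := by ext; simp [cube]
  rw [this]
  exact MeasurableSet.iInter fun j => measurableSet_le (by fun_prop) measurable_const

/-- A weighted union bound: outside the cube some coordinate `j` exceeds `ρ` in modulus. The weight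
is a product, so the `j`-th term factorises into one tail and `n - 1` full moments. -/
lemma setIntegral_compl_cube_exp_mul_sum_sq_le {x ρ : ℝ} (hx : x < 1) (hρ : 0 ≤ ρ) :
    ∫ y in (cube n ρ)ᶜ, Real.exp (x * ∑ i, y i ^ 2) ∂halfNormal n ≤
      n * ((√(1 - x))⁻¹ ^ n * Real.exp (-(1 - x) * ρ ^ 2)) := by
  set e : ℝ → ℝ := fun y => Real.exp (x * y ^ 2) with he
  set S : Set ℝ := {y : ℝ | ρ < |y|} with hS
  have hSm : MeasurableSet S := measurableSet_lt measurable_const (by fun_prop)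
  set u : Fin n → Fin n → ℝ → ℝ := fun j i => if i = j then S.indicator e else e with hu
  have hi := integrable_exp_mul_sq_gaussianReal hx
  have hui : ∀ j i, Integrable (u j i) (gaussianReal 0 (1 / 2)) := fun j i => by
    simp only [hu]
    split_ifs
    · exact hi.indicator hSm
    · exact hi
  have hun : ∀ j i t, 0 ≤ u j i t := fun j i t => by
    simp only [hu]
    split_ifs
    · exact Set.indicator_nonneg (fun _ _ => (Real.exp_pos _).le) _
    · exact (Real.exp_pos _).le
  have hprod : ∀ j, Integrable (fun y : Fin n → ℝ => ∏ i, u j i (y i)) (halfNormal n) :=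
    fun j => Integrable.fintype_prod fun i => hui j i
  have hle : ∀ y, (cube n ρ)ᶜ.indicator (fun y : Fin n → ℝ => Real.exp (x * ∑ i, y i ^ 2)) y ≤
      ∑ j, ∏ i, u j i (y i) := by
    intro y
    have hnn : ∀ j, 0 ≤ ∏ i, u j i (y i) := fun j => Finset.prod_nonneg fun i _ => hun _ _ _
    by_cases hy : y ∈ cube n ρ
    · simp only [Set.indicator, Set.mem_compl_iff, hy, not_true, if_false]
      exact Finset.sum_nonneg fun j _ => hnn j
    · have hy' := hy
      simp only [cube, Set.mem_ofPred_eq, not_forall, not_le] at hy'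
      obtain ⟨j, hj⟩ := hy'
      simp only [Set.indicator, Set.mem_compl_iff, hy, not_false_eq_true, if_true]
      refine le_trans (le_of_eq ?_) (Finset.single_le_sum (fun j _ => hnn j) (Finset.mem_univ j))
      rw [exp_mul_sum_sq]
      refine Finset.prod_congr rfl fun i _ => ?_
      simp only [hu]
      split_ifs with h
      · subst h; simp [hS, hj, he]
      · rfl
  rw [← integral_indicator measurableSet_cube.compl]
  refine (integral_mono ((integrable_exp_mul_sum_sq hx).indicator measurableSet_cube.compl)
    (integrable_finsetSum _ fun j _ => hprod j) hle).trans ?_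
  rw [integral_finsetSum _ fun j _ => hprod j]
  have hj : ∀ j, ∫ y, ∏ i, u j i (y i) ∂halfNormal n ≤
      (√(1 - x))⁻¹ ^ n * Real.exp (-(1 - x) * ρ ^ 2) := by
    intro j
    rw [integral_fintype_prod_eq_prod]
    have h1 : ∀ i, ∫ t, u j i t ∂gaussianReal 0 (1 / 2) ≤
        (√(1 - x))⁻¹ * if i = j then Real.exp (-(1 - x) * ρ ^ 2) else 1 := fun i => by
      simp only [hu]
      split_ifs
      · exact integral_indicator_exp_mul_sq_gaussianReal_le hx hρ
      · rw [mul_one]; exact (integral_exp_mul_sq_gaussianReal x).le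
    refine (Finset.prod_le_prod (fun i _ => integral_nonneg (hun j i)) fun i _ => h1 i).trans ?_
    rw [Finset.prod_mul_distrib]
    simp
  refine (Finset.sum_le_sum fun j _ => hj j).trans ?_
  simp

end GaussianMoments

/-! ### Effect of conditioning on a likely event on means and second cumulants. -/

section Conditioning

variable {α : Type*} [MeasurableSpace α] {ν : Measure α} [IsProbabilityMeasure ν] {s : Set α}

lemma integral_cond {α : Type*} [MeasurableSpace α] {ν : Measure α} {s : Set α} {E : Type*} [NormedAddCommGroup E] [NormedSpace ℝ E] (G : α → E) :
    ∫ x, G x ∂ν[|s] = (ν.real s)⁻¹ • ∫ x in s, G x ∂ν := by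
  rw [ProbabilityTheory.cond, integral_smul_measure, ENNReal.toReal_inv, measureReal_def]

/-- With `p` the probability of `s`, the difference equals `p⁻¹ (1 - p) ∫_s G - ∫_{sᶜ} G`. -/
lemma norm_integral_cond_sub_le (hs : MeasurableSet s) {P : ℝ} (hp : 0 < ν.real s)
    (hP : (ν.real s)⁻¹ ≤ P) {G : α → ℂ} (hG : AEStronglyMeasurable G ν) {r : α → ℝ}
    (hr : Integrable r ν) (hGr : ∀ x, ‖G x‖ ≤ r x) :
    ‖∫ x, G x ∂ν[|s] - ∫ x, G x ∂ν‖ ≤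
      P * ((1 - ν.real s) * ∫ x, r x ∂ν) + ∫ x in sᶜ, r x ∂ν := by
  have hGi : Integrable G ν := hr.mono' hG (.of_forall hGr)
  have hr0 : ∀ x, 0 ≤ r x := fun x => (norm_nonneg _).trans (hGr x)
  have hp1 : ν.real s ≤ 1 := measureReal_le_one
  rw [integral_cond, ← integral_add_compl hs hGi]
  have : (ν.real s)⁻¹ • ∫ x in s, G x ∂ν - (∫ x in s, G x ∂ν + ∫ x in sᶜ, G x ∂ν) =
      ((ν.real s)⁻¹ * (1 - ν.real s)) • ∫ x in s, G x ∂ν - ∫ x in sᶜ, G x ∂ν := by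
    rw [mul_sub, inv_mul_cancel₀ hp.ne', sub_smul, mul_one, one_smul]; ring
  rw [this]
  refine (norm_sub_le _ _).trans (add_le_add ?_ ?_)
  · rw [norm_smul, Real.norm_of_nonneg (mul_nonneg (inv_nonneg.2 hp.le) (by linarith)), mul_assoc]
    have h1 : ‖∫ x in s, G x ∂ν‖ ≤ ∫ x, r x ∂ν :=
      (norm_integral_le_of_norm_le hr.restrict (.of_forall hGr)).trans
        (setIntegral_le_integral hr (.of_forall hr0))
    have h2 : 0 ≤ 1 - ν.real s := by linarith
    have h3 : 0 ≤ P := (inv_pos.2 hp).le.trans hP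
    gcongr
  · exact norm_integral_le_of_norm_le hr.restrict (.of_forall hGr)

lemma norm_integral_cond_le {ν : Measure α} {P : ℝ} (hp : 0 < ν.real s)
    (hP : (ν.real s)⁻¹ ≤ P) {G : α → ℂ} {r : α → ℝ}
    (hr : Integrable r ν) (hGr : ∀ x, ‖G x‖ ≤ r x) :
    ‖∫ x, G x ∂ν[|s]‖ ≤ P * ∫ x, r x ∂ν := by
  have hr0 : ∀ x, 0 ≤ r x := fun x => (norm_nonneg _).trans (hGr x)
  rw [integral_cond, norm_smul, Real.norm_of_nonneg (inv_nonneg.2 hp.le)]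
  have h1 : ‖∫ x in s, G x ∂ν‖ ≤ ∫ x, r x ∂ν :=
    (norm_integral_le_of_norm_le hr.restrict (.of_forall hGr)).trans
      (setIntegral_le_integral hr (.of_forall hr0))
  have : 0 ≤ ∫ x, r x ∂ν := integral_nonneg hr0
  have h3 : 0 ≤ P := (inv_pos.2 hp).le.trans hP
  gcongr

/-- A weight `W ≥ 1` has small mass outside `s`. -/
structure SmallOutside (ν : Measure α) (s : Set α) (W : α → ℝ) (β : ℝ) : Prop where
  measurableSet : MeasurableSet s
  pos : 0 < ν.real s
  one_le : ∀ x, 1 ≤ W x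
  integrable : Integrable W ν
  compl_le : ∫ x in sᶜ, W x ∂ν ≤ β
  mul_le : (1 - ν.real s) * ∫ x, W x ∂ν ≤ β

namespace SmallOutside

variable {W : α → ℝ} {β P : ℝ}

lemma one_sub_le (h : SmallOutside ν s W β) : 1 - ν.real s ≤ β := by
  refine le_trans ?_ h.mul_le
  have h1 : 1 ≤ ∫ x, W x ∂ν := by
    have := integral_mono (integrable_const (1 : ℝ)) h.integrable h.one_le
    simpa using this
  have h2 : 0 ≤ 1 - ν.real s := by linarith [measureReal_le_one (μ := ν) (s := s)]
  nlinarith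

lemma nonneg (h : SmallOutside ν s W β) : 0 ≤ β :=
  le_trans (by linarith [measureReal_le_one (μ := ν) (s := s)]) h.one_sub_le

lemma neg_log_le (h : SmallOutside ν s W β) (hP : (ν.real s)⁻¹ ≤ P) :
    -Real.log (ν.real s) ≤ P * β := by
  have h1 := Real.log_le_sub_one_of_pos (inv_pos.2 h.pos)
  rw [Real.log_inv] at h1
  have h2 : (ν.real s)⁻¹ - 1 = (ν.real s)⁻¹ * (1 - ν.real s) := by
    rw [mul_sub, inv_mul_cancel₀ h.pos.ne', mul_one]
  have h3 := h.one_sub_le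
  have h4 : 0 ≤ 1 - ν.real s := by linarith [measureReal_le_one (μ := ν) (s := s)]
  have h5 : (ν.real s)⁻¹ * (1 - ν.real s) ≤ P * β :=
    mul_le_mul hP h3 h4 ((inv_pos.2 h.pos).le.trans hP)
  linarith

lemma norm_integral_cond_sub_le (h : SmallOutside ν s W β) (hP : (ν.real s)⁻¹ ≤ P)
    {G : α → ℂ} (hG : AEStronglyMeasurable G ν) (hGW : ∀ x, ‖G x‖ ≤ W x) :
    ‖∫ x, G x ∂ν[|s] - ∫ x, G x ∂ν‖ ≤ (P + 1) * β := by
  refine (_root_.norm_integral_cond_sub_le h.measurableSet h.pos hP hG h.integrable hGW).trans ?_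
  have h0 : 0 ≤ P := (inv_pos.2 h.pos).le.trans hP
  have := mul_le_mul_of_nonneg_left h.mul_le h0
  linarith [h.compl_le]

lemma sqrt_le {ν : Measure α} (h : SmallOutside ν s W β) (x : α) : √(W x) ≤ W x := by
  have := h.one_le x
  rw [Real.sqrt_le_left (by linarith)]
  nlinarith

lemma integrable_sqrt {ν : Measure α} (h : SmallOutside ν s W β) : Integrable (fun x => √(W x)) ν :=
  h.integrable.mono' (Real.continuous_sqrt.comp_aestronglyMeasurable h.integrable.1)
    (.of_forall fun x => by
      rw [Real.norm_of_nonneg (Real.sqrt_nonneg _)]; exact h.sqrt_le x)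

lemma sq_integral_sqrt_le (h : SmallOutside ν s W β) :
    (∫ x, √(W x) ∂ν) ^ 2 ≤ ∫ x, W x ∂ν := by
  have hsq : ∀ x, √(W x) ^ 2 = W x := fun x => Real.sq_sqrt (by linarith [h.one_le x])
  have hm : MemLp (fun x => √(W x)) 2 ν := by
    rw [memLp_two_iff_integrable_sq h.integrable_sqrt.1]
    simpa only [hsq] using h.integrable
  have h1 := variance_nonneg (fun x => √(W x)) ν
  rw [variance_eq_sub hm] at h1
  simp only [Pi.pow_apply, hsq] at h1
  linarith

/-- The change of the mean is small even after multiplication by the first moment of `√W`. This is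
needed for the squares of the means, since the growth bound permits large means. Outside `s`, the
product `√W * e` is split by the arithmetic-geometric mean inequality; elsewhere `e² ≤ ∫ W` is used.
-/
lemma norm_integral_cond_sub_mul_le (h : SmallOutside ν s W β) (hP : (ν.real s)⁻¹ ≤ P)
    {G : α → ℂ} (hG : AEStronglyMeasurable G ν) (hGW : ∀ x, ‖G x‖ ≤ √(W x)) :
    ‖∫ x, G x ∂ν[|s] - ∫ x, G x ∂ν‖ * ∫ x, √(W x) ∂ν ≤ (P + 1) * β := by
  set e := ∫ x, √(W x) ∂ν with he
  have h0 : 0 ≤ P := (inv_pos.2 h.pos).le.trans hP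
  have hq : 0 ≤ 1 - ν.real s := by linarith [measureReal_le_one (μ := ν) (s := s)]
  have he0 : 0 ≤ e := integral_nonneg fun x => Real.sqrt_nonneg _
  have h2 := h.sq_integral_sqrt_le
  rw [← he] at h2
  have h3 : (∫ x in sᶜ, √(W x) ∂ν) * e ≤ β := by
    have h4 : ∀ x, √(W x) * e ≤ (W x + e ^ 2) / 2 := fun x => by
      have := Real.sq_sqrt (show 0 ≤ W x by linarith [h.one_le x])
      nlinarith [sq_nonneg (√(W x) - e)]
    have hcompl : ν.real sᶜ = 1 - ν.real s := probReal_compl_eq_one_sub h.measurableSet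
    calc _ = ∫ x in sᶜ, √(W x) * e ∂ν := (integral_mul_const _ _).symm
      _ ≤ ∫ x in sᶜ, (W x + e ^ 2) / 2 ∂ν :=
        integral_mono (h.integrable_sqrt.mul_const e).restrict
          ((h.integrable.add (integrable_const _)).div_const 2).restrict h4
      _ = (∫ x in sᶜ, W x ∂ν + (1 - ν.real s) * e ^ 2) / 2 := by
        rw [integral_div, integral_add h.integrable.restrict (integrable_const _)]
        simp [hcompl]
      _ ≤ β := by
        have := mul_le_mul_of_nonneg_left h2 hq
        linarith [h.compl_le, h.mul_le]
  have h5 := _root_.norm_integral_cond_sub_le h.measurableSet h.pos hP hG h.integrable_sqrt hGW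
  calc _ ≤ (P * ((1 - ν.real s) * e) + ∫ x in sᶜ, √(W x) ∂ν) * e := by gcongr
    _ = P * ((1 - ν.real s) * e ^ 2) + (∫ x in sᶜ, √(W x) ∂ν) * e := by ring
    _ ≤ P * β + β := by
      have := (mul_le_mul_of_nonneg_left h2 hq).trans h.mul_le
      gcongr
    _ = _ := by ring

lemma norm_secondCumulantSum_cond_sub_le (h : SmallOutside ν s W β) (hP : (ν.real s)⁻¹ ≤ P)
    {F : α → ℂ} (hF : AEStronglyMeasurable F ν) (hFW : ∀ x, ‖F x‖ ^ 2 ≤ W x) :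
    ‖secondCumulantSum (ν[|s]) F - secondCumulantSum ν F‖ ≤
      (3 * (P + 1) + (P + 1) ^ 2) / 2 * β := by
  have hFr : ∀ x, ‖F x‖ ≤ √(W x) := fun x => Real.le_sqrt_of_sq_le (hFW x)
  have h1 := h.norm_integral_cond_sub_le hP hF fun x => (hFr x).trans (h.sqrt_le x)
  have h2 := h.norm_integral_cond_sub_le hP (G := fun x => F x * F x) (hF.mul hF) fun x => by
    rw [norm_mul, ← pow_two]; exact hFW x
  have h3 := h.norm_integral_cond_sub_mul_le hP hF hFr
  have h4 := norm_integral_cond_le h.pos hP h.integrable_sqrt hFr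
  have h5 : ‖∫ x, F x ∂ν‖ ≤ ∫ x, √(W x) ∂ν :=
    norm_integral_le_of_norm_le h.integrable_sqrt (.of_forall hFr)
  set m' := ∫ x, F x ∂ν[|s]
  set m := ∫ x, F x ∂ν
  set e := ∫ x, √(W x) ∂ν
  have h6 : ‖m' * m' - m * m‖ ≤ (P + 1) ^ 2 * β := by
    have : m' * m' - m * m = (m' - m) * (m' + m) := by ring
    rw [this, norm_mul]
    have h7 : ‖m' + m‖ ≤ (P + 1) * e := (norm_add_le _ _).trans (by linarith)
    calc _ ≤ ‖m' - m‖ * ((P + 1) * e) := by gcongr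
      _ = (P + 1) * (‖m' - m‖ * e) := by ring
      _ ≤ (P + 1) * ((P + 1) * β) := by
        have : 0 ≤ P + 1 := by linarith [(inv_pos.2 h.pos).le.trans hP]
        gcongr
      _ = _ := by ring
  have heq : secondCumulantSum (ν[|s]) F - secondCumulantSum ν F =
      (m' - m) + ((∫ x, F x * F x ∂ν[|s] - ∫ x, F x * F x ∂ν) - (m' * m' - m * m)) / 2 := by
    simp only [secondCumulantSum, bilinearCov, m, m']; ring
  rw [heq]
  refine (norm_add_le _ _).trans ?_
  rw [norm_div, Complex.norm_ofNat]
  have h8 := norm_sub_le (∫ x, F x * F x ∂ν[|s] - ∫ x, F x * F x ∂ν) (m' * m' - m * m)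
  linarith

end SmallOutside

end Conditioning

/-! ### The normal law conditioned on a cube, and the core estimate there. -/

section TruncatedNormal

variable {n : ℕ} {ρ : ℝ}

/-- The normal law of variance `1/2` conditioned on `[-ρ, ρ]`. -/
noncomputable abbrev truncNormal (ρ : ℝ) : Measure ℝ :=
  (gaussianReal 0 (1 / 2))[|Set.Icc (-ρ) ρ]

lemma gaussianReal_Icc_ne_zero (hρ : 0 < ρ) :
    gaussianReal 0 (1 / 2) (Set.Icc (-ρ) ρ) ≠ 0 := fun h => by
  have := gaussianReal_absolutelyContinuous' 0 (v := 1 / 2) (by norm_num) h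
  rw [Real.volume_Icc, ENNReal.ofReal_eq_zero] at this
  linarith

lemma isProbabilityMeasure_truncNormal (hρ : 0 < ρ) : IsProbabilityMeasure (truncNormal ρ) :=
  cond_isProbabilityMeasure (gaussianReal_Icc_ne_zero hρ)

lemma cube_eq_pi : cube n ρ = Set.univ.pi fun _ => Set.Icc (-ρ) ρ := by
  ext x; simp only [cube, abs_le, Set.mem_ofPred_eq, Set.mem_univ_pi, Set.mem_Icc]

lemma halfNormal_cube_ne_zero (hρ : 0 < ρ) : halfNormal n (cube n ρ) ≠ 0 := by
  rw [cube_eq_pi, Measure.pi_pi]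
  exact Finset.prod_ne_zero_iff.2 fun _ _ => gaussianReal_Icc_ne_zero hρ

lemma halfNormal_real_cube_pos (hρ : 0 < ρ) : 0 < (halfNormal n).real (cube n ρ) :=
  ENNReal.toReal_pos (halfNormal_cube_ne_zero hρ) (measure_ne_top _ _)

/-- A cube is a product set, so conditioning on it keeps the coordinates independent and the product
space estimates remain applicable. -/
lemma halfNormal_cond_cube (hρ : 0 < ρ) :
    (halfNormal n)[|cube n ρ] = Measure.pi fun _ => truncNormal ρ := by
  have := isProbabilityMeasure_truncNormal hρ
  symm
  refine Measure.pi_eq fun t ht => ?_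
  rw [cond_apply measurableSet_cube, cube_eq_pi, ← Set.pi_inter_distrib, Measure.pi_pi,
    Measure.pi_pi]
  simp_rw [cond_apply measurableSet_Icc, Finset.prod_mul_distrib]
  congr 1
  simp [ENNReal.inv_pow]

lemma setIntegral_cube_eq {E : Type*} [NormedAddCommGroup E] [NormedSpace ℝ E] (hρ : 0 < ρ)
    (G : (Fin n → ℝ) → E) :
    ∫ y in cube n ρ, G y ∂halfNormal n =
      (halfNormal n).real (cube n ρ) • ∫ y, G y ∂(halfNormal n)[|cube n ρ] := by
  rw [integral_cond, smul_smul, mul_inv_cancel₀ (halfNormal_real_cube_pos hρ).ne', one_smul]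

lemma integral_cond_cube_eq {E : Type*} [NormedAddCommGroup E] [NormedSpace ℝ E] (hρ : 0 < ρ)
    (G : (Fin n → ℝ) → E) :
    ∫ y, G y ∂(halfNormal n)[|cube n ρ] =
      ∫ y, G (clampCube ρ y) ∂Measure.pi fun _ => truncNormal ρ := by
  rw [← halfNormal_cond_cube hρ]
  refine integral_congr_ae ?_
  filter_upwards [ae_cond_mem measurableSet_cube] with y hy
  rw [clampCube_of_mem hy]

lemma secondCumulantSum_cond_cube_eq (hρ : 0 < ρ) (F : (Fin n → ℝ) → ℂ) :
    secondCumulantSum ((halfNormal n)[|cube n ρ]) F =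
      secondCumulantSum (Measure.pi fun _ => truncNormal ρ) fun y => F (clampCube ρ y) := by
  simp only [secondCumulantSum, bilinearCov]
  rw [integral_cond_cube_eq hρ, integral_cond_cube_eq hρ (fun y => F y * F y)]

/-- Conditioning on the cube changes the mean and the second cumulants of `F` and of its real
part by an error such that, together with the logarithm of the probability, it is at most `θ`. -/
structure TruncationError (ρ θ : ℝ) (F : (Fin n → ℝ) → ℂ) : Prop where
  pos : 0 < ρ
  mean : -Real.log ((halfNormal n).real (cube n ρ)) +
    ‖∫ y, F y ∂(halfNormal n)[|cube n ρ] - ∫ y, F y ∂halfNormal n‖ ≤ θ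
  cumulant : -Real.log ((halfNormal n).real (cube n ρ)) +
    ‖secondCumulantSum ((halfNormal n)[|cube n ρ]) F - secondCumulantSum (halfNormal n) F‖ ≤ θ
  cumulant_re : -Real.log ((halfNormal n).real (cube n ρ)) +
    ‖secondCumulantSum ((halfNormal n)[|cube n ρ]) (fun y => ((F y).re : ℂ)) -
      secondCumulantSum (halfNormal n) fun y => ((F y).re : ℂ)‖ ≤ θ

namespace TruncationError

variable {θ : ℝ} {F : (Fin n → ℝ) → ℂ}

lemma neg_log_nonneg : 0 ≤ -Real.log ((halfNormal n).real (cube n ρ)) := by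
  have := Real.log_nonpos (measureReal_nonneg (μ := halfNormal n) (s := cube n ρ))
    measureReal_le_one
  linarith

lemma nonneg (h : TruncationError ρ θ F) : 0 ≤ θ :=
  (add_nonneg neg_log_nonneg (norm_nonneg _)).trans h.mean

/-- The core estimate under the conditioned law, followed by the return to the unconditioned
cumulants. Both errors are relative, so their exponents `n a³` and `θ` add. -/
lemma norm_setIntegral_cexp_sub_le (h : TruncationError ρ θ F) {a : ℝ} (ha0 : 0 ≤ a)
    (ha1 : a ≤ 2 / 3) (hF : SmallDifferences a fun y => F (clampCube ρ y))
    (hre : (secondCumulantSum (halfNormal n) F).re ≤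
      (secondCumulantSum (halfNormal n) fun y => ((F y).re : ℂ)).re) :
    ‖∫ y in cube n ρ, Complex.exp (F y) ∂halfNormal n -
        Complex.exp (secondCumulantSum (halfNormal n) F)‖ ≤
      Real.exp (secondCumulantSum (halfNormal n) fun y => ((F y).re : ℂ)).re *
        (Real.exp (n * a ^ 3 + θ) - 1) := by
  have hρ := h.pos
  have := isProbabilityMeasure_truncNormal hρ
  have key := hF.norm_integral_cexp_sub_le (μ := truncNormal ρ) ha0 ha1
  rw [← secondCumulantSum_cond_cube_eq hρ, ← integral_cond_cube_eq hρ fun y => Complex.exp (F y),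
    ← secondCumulantSum_cond_cube_eq hρ fun y => ((F y).re : ℂ)] at key
  rw [setIntegral_cube_eq hρ]
  have h1 := h.cumulant
  have h2 := h.cumulant_re
  have hp := halfNormal_real_cube_pos (n := n) hρ
  have hlog := neg_log_nonneg (n := n) (ρ := ρ)
  set p := (halfNormal n).real (cube n ρ) with hpdef
  set U := secondCumulantSum (halfNormal n) F
  set U' := secondCumulantSum ((halfNormal n)[|cube n ρ]) F
  set R := secondCumulantSum (halfNormal n) fun y => ((F y).re : ℂ)
  set R' := secondCumulantSum ((halfNormal n)[|cube n ρ]) fun y => ((F y).re : ℂ)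
  set I := ∫ y, Complex.exp (F y) ∂(halfNormal n)[|cube n ρ]
  have hp1 : p ≤ 1 := measureReal_le_one
  have hR : R'.re ≤ R.re + θ := by
    have := (Complex.re_le_norm (R' - R))
    rw [Complex.sub_re] at this
    linarith
  have hS : 0 ≤ Real.exp (n * a ^ 3) - 1 := by
    linarith [Real.one_le_exp (mul_nonneg (Nat.cast_nonneg n) (pow_nonneg ha0 3))]
  have e1 : ‖p • I - p • Complex.exp U'‖ ≤
      Real.exp (R.re + θ) * (Real.exp (n * a ^ 3) - 1) := by
    rw [← smul_sub, norm_smul, Real.norm_of_nonneg hp.le]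
    calc _ ≤ 1 * (Real.exp R'.re * (Real.exp (n * a ^ 3) - 1)) := by gcongr
      _ ≤ _ := by rw [one_mul]; gcongr
  have e2 : ‖p • Complex.exp U' - Complex.exp U‖ ≤ Real.exp R.re * (Real.exp θ - 1) := by
    -- The probability `p` of the cube is absorbed into the exponent as `log p`; this is why the
    -- truncation error includes `-log p`.
    have : p • Complex.exp U' - Complex.exp U =
        Complex.exp U * (Complex.exp (Real.log p + (U' - U)) - 1) := by
      rw [Complex.real_smul, mul_sub, ← Complex.exp_add, mul_one]
      congr 1
      rw [show U + ((Real.log p : ℝ) + (U' - U)) = (Real.log p : ℝ) + U' by ring, Complex.exp_add,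
        ← Complex.ofReal_exp, Real.exp_log hp]
    rw [this, norm_mul, Complex.norm_exp]
    have h3 : ‖(Real.log p : ℂ) + (U' - U)‖ ≤ θ := by
      refine (norm_add_le _ _).trans ?_
      rw [Complex.norm_real, Real.norm_eq_abs, abs_of_nonpos (by linarith)]
      exact h1
    have h4 : ‖Complex.exp (Real.log p + (U' - U)) - 1‖ ≤ Real.exp θ - 1 := by
      have h5 := Complex.norm_exp_sub_sum_le_exp_norm_sub_sum (Real.log p + (U' - U)) 1
      simp only [Finset.range_one, Finset.sum_singleton, pow_zero, Nat.factorial_zero,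
        Nat.cast_one, div_one] at h5
      exact h5.trans (sub_le_sub_right (Real.exp_le_exp.2 h3) 1)
    gcongr
  calc _ ≤ _ := norm_sub_le_norm_sub_add_norm_sub _ (p • Complex.exp U') _
    _ ≤ Real.exp (R.re + θ) * (Real.exp (n * a ^ 3) - 1) + Real.exp R.re * (Real.exp θ - 1) :=
      add_le_add e1 e2
    _ = _ := by rw [Real.exp_add, Real.exp_add]; ring

end TruncationError

end TruncatedNormal

/-! ### Integrals of the dominating real exponential over the two cubes. -/

section RealExponentials

variable {n : ℕ} {ρ θ : ℝ} {g : (Fin n → ℝ) → ℝ}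

lemma setIntegral_cube_eq_clampCube (hρ : 0 < ρ) (G : (Fin n → ℝ) → ℝ) :
    ∫ y in cube n ρ, G y ∂halfNormal n = (halfNormal n).real (cube n ρ) *
      ∫ y, G (clampCube ρ y) ∂Measure.pi fun _ => truncNormal ρ := by
  rw [setIntegral_cube_eq hρ, integral_cond_cube_eq hρ, smul_eq_mul]

/-- Jensen's inequality, by integrating the tangent to the exponential at the mean. -/
lemma BddMeasurable.exp_integral_le {α : Type*} [MeasurableSpace α] {μ : Measure α}
    [IsProbabilityMeasure μ] {G : α → ℝ} (hG : BddMeasurable G) :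
    Real.exp (∫ y, G y ∂μ) ≤ ∫ y, Real.exp (G y) ∂μ := by
  have i1 := hG.integrable (μ := μ)
  set m := ∫ y, G y ∂μ with hm
  have h1 : ∫ y, Real.exp m * (1 + (G y - m)) ∂μ = Real.exp m := by
    rw [integral_const_mul, integral_add (by fun_prop) (by fun_prop),
      integral_sub (by fun_prop) (by fun_prop)]
    simp [hm]
  rw [← h1]
  refine integral_mono (by fun_prop) hG.exp_real.integrable fun y => ?_
  have h2 := Real.add_one_le_exp (G y - m)
  calc _ ≤ Real.exp m * Real.exp (G y - m) := by gcongr; linarith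
    _ = _ := by rw [← Real.exp_add]; simp

namespace TruncationError

lemma abs_mean_sub_le (h : TruncationError ρ θ fun y => (g y : ℂ)) :
    -Real.log ((halfNormal n).real (cube n ρ)) +
      |∫ y, g (clampCube ρ y) ∂Measure.pi (fun _ => truncNormal ρ) - ∫ y, g y ∂halfNormal n|
        ≤ θ := by
  have h1 := h.mean
  rwa [integral_complex_ofReal, integral_complex_ofReal, ← Complex.ofReal_sub, Complex.norm_real,
    Real.norm_eq_abs, integral_cond_cube_eq h.pos] at h1

lemma setIntegral_exp_le (h : TruncationError ρ θ fun y => (g y : ℂ)) {a : ℝ}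
    (hb : BddMeasurable fun y => g (clampCube ρ y))
    (ho : OscillationLE (fun y => g (clampCube ρ y)) fun _ => a) :
    ∫ y in cube n ρ, Real.exp (g y) ∂halfNormal n ≤
      Real.exp (∫ y, g y ∂halfNormal n + (n * a ^ 2 / 8 + θ)) := by
  have := isProbabilityMeasure_truncNormal h.pos
  have h1 := integral_exp_pi_le (μ := truncNormal ρ) hb ho
  have h2 := h.abs_mean_sub_le
  have h3 := neg_log_nonneg (n := n) (ρ := ρ)
  have h4 := le_abs_self (∫ y, g (clampCube ρ y) ∂Measure.pi (fun _ => truncNormal ρ) -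
    ∫ y, g y ∂halfNormal n)
  rw [setIntegral_cube_eq_clampCube h.pos fun y => Real.exp (g y)]
  calc _ ≤ 1 * Real.exp (∫ y, g (clampCube ρ y) ∂Measure.pi (fun _ => truncNormal ρ) +
        (∑ _j : Fin n, a ^ 2) / 8) :=
        mul_le_mul measureReal_le_one h1 (integral_nonneg fun _ => (Real.exp_pos _).le) zero_le_one
    _ ≤ _ := by
      rw [one_mul]
      apply Real.exp_le_exp.2
      simp
      linarith

lemma exp_mean_sub_le_setIntegral_exp (h : TruncationError ρ θ fun y => (g y : ℂ))
    (hb : BddMeasurable fun y => g (clampCube ρ y)) :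
    Real.exp (∫ y, g y ∂halfNormal n - θ) ≤ ∫ y in cube n ρ, Real.exp (g y) ∂halfNormal n := by
  have := isProbabilityMeasure_truncNormal h.pos
  have h2 := h.abs_mean_sub_le
  have hp := halfNormal_real_cube_pos (n := n) h.pos
  rw [setIntegral_cube_eq_clampCube h.pos fun y => Real.exp (g y)]
  set m := ∫ y, g (clampCube ρ y) ∂Measure.pi (fun _ => truncNormal ρ) with hm
  have h4 := neg_abs_le (m - ∫ y, g y ∂halfNormal n)
  have h5 : Real.exp m ≤
      ∫ y, Real.exp (g (clampCube ρ y)) ∂Measure.pi (fun _ => truncNormal ρ) :=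
    hb.exp_integral_le
  calc _ ≤ Real.exp (Real.log ((halfNormal n).real (cube n ρ)) + m) :=
        Real.exp_le_exp.2 (by linarith)
    _ = (halfNormal n).real (cube n ρ) * Real.exp m := by rw [Real.exp_add, Real.exp_log hp]
    _ ≤ _ := by gcongr

lemma abs_setIntegral_exp_sub_le (h : TruncationError ρ θ fun y => (g y : ℂ)) {a : ℝ}
    (ha0 : 0 ≤ a) (ha1 : a ≤ 2 / 3) (hF : SmallDifferences a fun y => (g (clampCube ρ y) : ℂ))
    (hg : MemLp g 2 (halfNormal n)) :
    |∫ y in cube n ρ, Real.exp (g y) ∂halfNormal n -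
        Real.exp (∫ y, g y ∂halfNormal n + variance g (halfNormal n) / 2)| ≤
      Real.exp (∫ y, g y ∂halfNormal n + variance g (halfNormal n) / 2) *
        (Real.exp (n * a ^ 3 + θ) - 1) := by
  have h1 := h.norm_setIntegral_cexp_sub_le ha0 ha1 hF (by simp only [Complex.ofReal_re]; exact le_rfl)
  have h2 := secondCumulantSum_ofReal_re (halfNormal n) fun y => (g y : ℂ)
  simp only [Complex.ofReal_re] at h1 h2
  rw [← h2, re_secondCumulantSum_ofReal _ hg] at h1
  simp only [← Complex.ofReal_exp, Complex.ofReal_re] at h1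
  rwa [integral_complex_ofReal, ← Complex.ofReal_sub, Complex.norm_real, Real.norm_eq_abs] at h1

end TruncationError

/-- Either the oscillations of `g` on the larger cube are so small that the first order estimate
has exponent at most `S`, or the first and second differences on both cubes are so small that the
second order estimate has. -/
def ExpControl (ρ₁ ρ₂ S : ℝ) (g : (Fin n → ℝ) → ℝ) : Prop :=
  ∃ a : ℝ, 0 ≤ a ∧ OscillationLE (fun y => g (clampCube ρ₂ y)) (fun _ => a) ∧
    (n * a ^ 2 / 8 ≤ S ∨ a ≤ 2 / 3 ∧ n * a ^ 3 ≤ S ∧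
      SmallDifferences a (fun y => (g (clampCube ρ₁ y) : ℂ)) ∧
      SmallDifferences a fun y => (g (clampCube ρ₂ y) : ℂ))

lemma setIntegral_exp_le_of_expControl {ρ₁ ρ₂ S : ℝ} (hc : ExpControl ρ₁ ρ₂ S g)
    (h₂ : TruncationError ρ₂ θ fun y => (g y : ℂ))
    (hb₂ : BddMeasurable fun y => g (clampCube ρ₂ y)) (hg : MemLp g 2 (halfNormal n)) :
    ∫ y in cube n ρ₂, Real.exp (g y) ∂halfNormal n ≤
      Real.exp (∫ y, g y ∂halfNormal n + variance g (halfNormal n) / 2) * Real.exp (S + θ) := by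
  have hv := variance_nonneg g (halfNormal n)
  obtain ⟨a, ha0, ho, hS | ⟨ha1, hS, -, hd₂⟩⟩ := hc
  · refine (h₂.setIntegral_exp_le hb₂ ho).trans ?_
    rw [← Real.exp_add]
    apply Real.exp_le_exp.2
    linarith
  · have h1 := (abs_le.1 (h₂.abs_setIntegral_exp_sub_le ha0 ha1 hd₂ hg)).2
    have h2 : Real.exp (n * a ^ 3 + θ) ≤ Real.exp (S + θ) := Real.exp_le_exp.2 (by linarith)
    have h3 := Real.exp_pos (∫ y, g y ∂halfNormal n + variance g (halfNormal n) / 2)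
    nlinarith

/-- In the second order case both integrals are within a relative error `e^{S+θ} - 1` of the same
number, hence the factor `2`. In the first order case Hoeffding's upper bound on the larger cube is
compared with Jensen's lower bound on the smaller one, and nonnegativity of the variance enlarges
`e^{E g}` to the stated factor. -/
lemma setIntegral_exp_sub_le_of_expControl {ρ₁ ρ₂ S : ℝ} (hc : ExpControl ρ₁ ρ₂ S g)
    (h₁ : TruncationError ρ₁ θ fun y => (g y : ℂ)) (h₂ : TruncationError ρ₂ θ fun y => (g y : ℂ))
    (hb₁ : BddMeasurable fun y => g (clampCube ρ₁ y))
    (hb₂ : BddMeasurable fun y => g (clampCube ρ₂ y)) (hg : MemLp g 2 (halfNormal n)) :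
    ∫ y in cube n ρ₂, Real.exp (g y) ∂halfNormal n -
        ∫ y in cube n ρ₁, Real.exp (g y) ∂halfNormal n ≤
      Real.exp (∫ y, g y ∂halfNormal n + variance g (halfNormal n) / 2) *
        (2 * Real.exp (S + θ) - 2) := by
  have hv := variance_nonneg g (halfNormal n)
  have hθ := h₁.nonneg
  obtain ⟨a, ha0, ho, hS | ⟨ha1, hS, hd₁, hd₂⟩⟩ := hc
  · have h1 := h₂.setIntegral_exp_le hb₂ ho
    have h2 := h₁.exp_mean_sub_le_setIntegral_exp hb₁
    have hS0 : 0 ≤ S := le_trans (by positivity) hS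
    set m := ∫ y, g y ∂halfNormal n
    have h3 : Real.exp (m + (n * a ^ 2 / 8 + θ)) ≤ Real.exp m * Real.exp (S + θ) := by
      rw [← Real.exp_add]; apply Real.exp_le_exp.2; linarith
    have h4 : Real.exp (m - θ) = Real.exp m * Real.exp (-θ) := by
      rw [← Real.exp_add]; rfl
    -- Both sides are compared with `1 - θ`. This brings the first order difference `e^{S+θ} -
    -- e^{-θ}` under `2e^{S+θ} - 2`.
    have h5 : 2 - Real.exp (S + θ) ≤ Real.exp (-θ) := by
      have h6 := Real.add_one_le_exp (-θ)
      have h7 := Real.add_one_le_exp (S + θ)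
      linarith
    have h6 : Real.exp m ≤ Real.exp (m + variance g (halfNormal n) / 2) :=
      Real.exp_le_exp.2 (by linarith)
    have h7 : 0 ≤ 2 * Real.exp (S + θ) - 2 := by
      linarith [Real.one_le_exp (show 0 ≤ S + θ by linarith)]
    have h8 := Real.exp_pos m
    calc _ ≤ Real.exp m * Real.exp (S + θ) - Real.exp m * Real.exp (-θ) := by linarith
      _ ≤ Real.exp m * (2 * Real.exp (S + θ) - 2) := by nlinarith
      _ ≤ _ := by gcongr
  · have h1 := (abs_le.1 (h₂.abs_setIntegral_exp_sub_le ha0 ha1 hd₂ hg)).2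
    have h2 := (abs_le.1 (h₁.abs_setIntegral_exp_sub_le ha0 ha1 hd₁ hg)).1
    have h3 : Real.exp (n * a ^ 3 + θ) ≤ Real.exp (S + θ) := Real.exp_le_exp.2 (by linarith)
    have h4 := Real.exp_pos (∫ y, g y ∂halfNormal n + variance g (halfNormal n) / 2)
    nlinarith

end RealExponentials

/-! ### The growth bound and the size of the truncation error. -/

section Growth

variable {n : ℕ} {c₂ c₃ ρ : ℝ}

/-- The square of the growth bound, as a function of the standardised variable. -/
noncomputable def growthWeight (n : ℕ) (c₂ c₃ : ℝ) (y : Fin n → ℝ) : ℝ :=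
  (n : ℝ) ^ (2 * c₃) * Real.exp (2 * c₂ / n * ∑ i, y i ^ 2)

/-- `F` grows no faster than the bound of the theorem. -/
def GrowthLE {n : ℕ} {E : Type*} [NormedAddCommGroup E] (c₂ c₃ : ℝ) (F : (Fin n → ℝ) → E) : Prop :=
  ∀ y, ‖F y‖ ≤ (n : ℝ) ^ c₃ * Real.exp (c₂ * (∑ i, y i ^ 2) / n)

lemma GrowthLE.sq_le {E : Type*} [NormedAddCommGroup E] {F : (Fin n → ℝ) → E}
    (h : GrowthLE c₂ c₃ F) (y : Fin n → ℝ) : ‖F y‖ ^ 2 ≤ growthWeight n c₂ c₃ y := by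
  refine (pow_le_pow_left₀ (norm_nonneg _) (h y) 2).trans (le_of_eq ?_)
  rw [mul_pow, growthWeight, ← Real.rpow_natCast, ← Real.rpow_mul (Nat.cast_nonneg n),
    ← Real.exp_nat_mul]
  congr 2
  · push_cast; ring
  · push_cast; ring

lemma one_le_growthWeight (hn : 1 ≤ n) (hc₂ : 0 ≤ c₂) (hc₃ : 0 ≤ c₃) (y : Fin n → ℝ) :
    1 ≤ growthWeight n c₂ c₃ y := by
  have hn' : (1 : ℝ) ≤ n := by exact_mod_cast hn
  have h1 := Real.one_le_rpow hn' (show 0 ≤ 2 * c₃ by linarith)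
  have h2 : 1 ≤ Real.exp (2 * c₂ / n * ∑ i, y i ^ 2) := Real.one_le_exp (by positivity)
  rw [growthWeight]
  nlinarith

/-- The bound for the mass of the weight outside the cube. -/
noncomputable def growthTail (n : ℕ) (c₂ c₃ ρ : ℝ) : ℝ :=
  (n : ℝ) ^ (2 * c₃) *
    (n * ((√(1 - 2 * c₂ / n))⁻¹ ^ n * Real.exp (-(1 - 2 * c₂ / n) * ρ ^ 2)))

lemma integrable_growthWeight (hx : 2 * c₂ / n < 1) :
    Integrable (growthWeight n c₂ c₃) (halfNormal n) :=
  (integrable_exp_mul_sum_sq hx).const_mul _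

lemma integral_growthWeight :
    ∫ y, growthWeight n c₂ c₃ y ∂halfNormal n =
      (n : ℝ) ^ (2 * c₃) * (√(1 - 2 * c₂ / n))⁻¹ ^ n := by
  simp only [growthWeight]
  rw [integral_const_mul, integral_exp_mul_sum_sq]

lemma smallOutside_cube (hn : 1 ≤ n) (hc₂ : 0 ≤ c₂) (hc₃ : 0 ≤ c₃) (hx : 2 * c₂ / n < 1)
    (hρ : 0 < ρ) :
    SmallOutside (halfNormal n) (cube n ρ) (growthWeight n c₂ c₃) (growthTail n c₂ c₃ ρ) := by
  refine ⟨measurableSet_cube, halfNormal_real_cube_pos hρ, one_le_growthWeight hn hc₂ hc₃,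
    integrable_growthWeight hx, ?_, ?_⟩
  · simp only [growthWeight]
    rw [integral_const_mul, growthTail]
    gcongr
    exact setIntegral_compl_cube_exp_mul_sum_sq_le hx hρ.le
  -- At `x = 0` the weighted tail bound is the plain probability bound `n e^{-ρ²}`.
  · have h1 := setIntegral_compl_cube_exp_mul_sum_sq_le (n := n) (x := 0) (by norm_num) hρ.le
    have h2 : (halfNormal n).real (cube n ρ)ᶜ = 1 - (halfNormal n).real (cube n ρ) :=
      probReal_compl_eq_one_sub measurableSet_cube
    simp [h2] at h1
    replace h1 : 1 - (halfNormal n).real (cube n ρ) ≤ n * Real.exp (-ρ ^ 2) := by linarith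
    rw [integral_growthWeight, growthTail]
    have hx0 : 0 ≤ 2 * c₂ / n := by positivity
    calc _ ≤ n * Real.exp (-ρ ^ 2) * ((n : ℝ) ^ (2 * c₃) * (√(1 - 2 * c₂ / n))⁻¹ ^ n) := by gcongr
      _ ≤ n * Real.exp (-(1 - 2 * c₂ / n) * ρ ^ 2) *
          ((n : ℝ) ^ (2 * c₃) * (√(1 - 2 * c₂ / n))⁻¹ ^ n) := by
        gcongr
        nlinarith [mul_nonneg hx0 (sq_nonneg ρ)]
      _ = _ := by ring

lemma TruncationError.mono {θ θ' : ℝ} {F : (Fin n → ℝ) → ℂ} (h : TruncationError ρ θ F)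
    (hθ : θ ≤ θ') : TruncationError ρ θ' F :=
  ⟨h.pos, h.mean.trans hθ, h.cumulant.trans hθ, h.cumulant_re.trans hθ⟩

lemma truncationError_of_smallOutside {W : (Fin n → ℝ) → ℝ} {β P θ : ℝ} (hρ : 0 < ρ)
    (h : SmallOutside (halfNormal n) (cube n ρ) W β) (hP1 : 1 ≤ P)
    (hP : ((halfNormal n).real (cube n ρ))⁻¹ ≤ P)
    (hθ : (P + (3 * (P + 1) + (P + 1) ^ 2) / 2) * β ≤ θ) {F : (Fin n → ℝ) → ℂ}
    (hF : Measurable F) (hFW : ∀ y, ‖F y‖ ^ 2 ≤ W y) : TruncationError ρ θ F := by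
  have h1 := h.neg_log_le hP
  have h0 := h.nonneg
  have hrW : ∀ y, ‖((F y).re : ℂ)‖ ^ 2 ≤ W y := fun y => by
    refine le_trans (pow_le_pow_left₀ (norm_nonneg _) ?_ 2) (hFW y)
    rw [Complex.norm_real]; exact Complex.abs_re_le_norm _
  have h2 := h.norm_integral_cond_sub_le hP hF.aestronglyMeasurable fun y =>
    (Real.le_sqrt_of_sq_le (hFW y)).trans (h.sqrt_le y)
  have h3 := h.norm_secondCumulantSum_cond_sub_le hP hF.aestronglyMeasurable hFW
  have h4 := h.norm_secondCumulantSum_cond_sub_le hP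
    (F := fun y => ((F y).re : ℂ)) (by fun_prop) hrW
  refine ⟨hρ, ?_, ?_, ?_⟩
  · have : (P + 1) * β ≤ (3 * (P + 1) + (P + 1) ^ 2) / 2 * β := by gcongr; nlinarith
    linarith
  · linarith
  · linarith

/-- From `-log(1-x) ≤ (1-x)⁻¹ - 1 = x + x²(1-x)⁻¹` and `(1-x)⁻¹ ≤ 4/3`. -/
lemma inv_sqrt_pow_le {x : ℝ} (hx : x ≤ 1 / 4) :
    (√(1 - x))⁻¹ ^ n ≤ Real.exp (n / 2 * (x + 4 / 3 * x ^ 2)) := by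
  have h1 : 0 < 1 - x := by linarith
  have h2 : (√(1 - x))⁻¹ = Real.exp (-Real.log (1 - x) / 2) := by
    rw [← Real.exp_log (inv_pos.2 (Real.sqrt_pos.2 h1)), Real.log_inv, Real.log_sqrt h1.le]
    congr 1; ring
  have h3 : -Real.log (1 - x) ≤ x + 4 / 3 * x ^ 2 := by
    have h4 := Real.log_le_sub_one_of_pos (inv_pos.2 h1)
    rw [Real.log_inv] at h4
    refine h4.trans ?_
    have h5 : (1 - x)⁻¹ * (1 - x) = 1 := inv_mul_cancel₀ h1.ne'
    have h6 : (1 - x)⁻¹ ≤ 4 / 3 := by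
      rw [inv_le_comm₀ h1 (by norm_num)]; linarith
    have h7 : (1 - x)⁻¹ = 1 + x + x ^ 2 * (1 - x)⁻¹ := by field_simp; ring
    nlinarith [sq_nonneg x]
  rw [h2, ← Real.exp_nat_mul]
  apply Real.exp_le_exp.2
  have : (0 : ℝ) ≤ n := Nat.cast_nonneg n
  nlinarith

/-- With `L = log n` and `x = 2c₂/n` one needs `log 8 + (1 + 2c₃)L + c₂ + 2/3 ≤ (1/2 - x)ρ²`. Since
`x ≤ 1/4`, the terms `15 + 4c₂ + 8c₃L` of the lower bound on `ρ²` give at least `15/4 + c₂ + 2c₃L`,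
and `3L` gives `L` up to a loss of at most `3/5`. The numerical slack covers `log 8 + 2/3`. -/
lemma eight_mul_growthTail_le (hn : 1 ≤ n) (hc₂ : 0 ≤ c₂) (hc₃ : 0 ≤ c₃)
    (hnc : (1 + 2 * c₂) ^ 2 ≤ n)
    (hρ : 15 + 4 * c₂ + (3 + 8 * c₃) * Real.log n ≤ ρ ^ 2) :
    2 * c₂ / n ≤ 1 / 4 ∧ 8 * growthTail n c₂ c₃ ρ ≤ Real.exp (-ρ ^ 2 / 2) := by
  have hn' : (1 : ℝ) ≤ n := by exact_mod_cast hn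
  set s := √(n : ℝ) with hs
  have hss : s ^ 2 = n := Real.sq_sqrt (by linarith)
  have hs1 : 1 + 2 * c₂ ≤ s := Real.le_sqrt_of_sq_le hnc
  have hs0 : 1 ≤ s := by linarith
  have hsp : 0 < s := by linarith
  set L := Real.log n with hL
  have hL0 : 0 ≤ L := Real.log_nonneg hn'
  have hLs : L = 2 * Real.log s := by rw [hL, ← hss, Real.log_pow]; norm_num
  set x := 2 * c₂ / n with hx
  have hx0 : 0 ≤ x := by positivity
  have hxn : n * x = 2 * c₂ := by rw [hx]; field_simp
  have hxs : x ≤ (s - 1) / s ^ 2 := by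
    rw [hx, hss]; gcongr; linarith
  have hx4 : x ≤ 1 / 4 := hxs.trans (by
    rw [div_le_iff₀ (by positivity)]; nlinarith [sq_nonneg (s - 2)])
  refine ⟨hx4, ?_⟩
  have hnx2 : n * x ^ 2 ≤ 1 := by
    have h1 : (n * x) ^ 2 ≤ n := by rw [hxn]; nlinarith
    have h2 : (n * x) ^ 2 = n * (n * x ^ 2) := by ring
    rw [h2] at h1
    exact le_of_mul_le_mul_left (by linarith) (show (0 : ℝ) < n by linarith)
  have hpow : (√(1 - x))⁻¹ ^ n ≤ Real.exp (c₂ + 2 / 3) :=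
    (inv_sqrt_pow_le hx4).trans (Real.exp_le_exp.2 (by nlinarith))
  have hlogs : Real.log s ≤ s / 2 := by
    have h1 := Real.log_le_sub_one_of_pos (show 0 < s / 2 by linarith)
    rw [Real.log_div hsp.ne' (by norm_num)] at h1
    have := Real.log_two_lt_d9
    linarith
  have hlogs0 : 0 ≤ Real.log s := Real.log_nonneg hs0
  -- Only `x > 1/6` matters. Then `L = 2 log s ≤ s` and `x ≤ (s-1)/s²` reduce the claim to `3 - 3/s
  -- - s/2 ≤ 3/5`. The left side is largest at `s = √6`, which `12/5` approximates.
  have hcorr : -(3 / 5) ≤ (1 / 2 - 3 * x) * L := by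
    rcases le_or_gt 0 (1 / 2 - 3 * x) with h | h
    · have := mul_nonneg h hL0; linarith
    · have h1 : (3 * x - 1 / 2) * L ≤ (3 * x - 1 / 2) * s := by
        apply mul_le_mul_of_nonneg_left _ (by linarith); linarith
      have h2 : (3 * x - 1 / 2) * s ≤ (3 * ((s - 1) / s ^ 2) - 1 / 2) * s := by gcongr
      have h3 : (3 * ((s - 1) / s ^ 2) - 1 / 2) * s ≤ 3 / 5 := by
        have : (3 * ((s - 1) / s ^ 2) - 1 / 2) * s = (3 * (s - 1) - s ^ 2 / 2) / s := by field_simp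
        rw [this, div_le_iff₀ hsp]
        nlinarith [sq_nonneg (s - 12 / 5)]
      linarith
  have hlog8 : Real.log 8 ≤ 21 / 10 := by
    have h1 : (8 : ℝ) = 2 ^ 3 := by norm_num
    rw [h1, Real.log_pow]
    have := Real.log_two_lt_d9
    push_cast; linarith
  have hmain : Real.log 8 + 2 * c₃ * L + L + (c₂ + 2 / 3) + -(1 - x) * ρ ^ 2 ≤ -ρ ^ 2 / 2 := by
    have h1 : (1 / 2 - x) * (15 + 4 * c₂ + (3 + 8 * c₃) * L) ≤ (1 / 2 - x) * ρ ^ 2 := by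
      apply mul_le_mul_of_nonneg_left hρ; linarith
    have h2 : 0 ≤ c₃ * L := mul_nonneg hc₃ hL0
    have h3 : 1 / 4 * (15 + 4 * c₂ + 8 * (c₃ * L)) ≤ (1 / 2 - x) * (15 + 4 * c₂ + 8 * (c₃ * L)) := by
      apply mul_le_mul_of_nonneg_right _ (by positivity); linarith
    nlinarith
  have hn0 : (0 : ℝ) < n := by linarith
  calc 8 * growthTail n c₂ c₃ ρ
      ≤ Real.exp (Real.log 8) * (Real.exp (2 * c₃ * L) * (Real.exp L *
        (Real.exp (c₂ + 2 / 3) * Real.exp (-(1 - x) * ρ ^ 2)))) := by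
        rw [Real.exp_log (by norm_num), hL, Real.exp_log hn0, growthTail,
          Real.rpow_def_of_pos hn0, mul_comm (Real.log n) (2 * c₃), ← hx]
        gcongr
    _ ≤ _ := by
      rw [← Real.exp_add, ← Real.exp_add, ← Real.exp_add, ← Real.exp_add]
      apply Real.exp_le_exp.2
      linarith

lemma truncationError_of_le_sq (hn : 1 ≤ n) (hc₂ : 0 ≤ c₂) (hc₃ : 0 ≤ c₃)
    (hnc : (1 + 2 * c₂) ^ 2 ≤ n) (hρ0 : 0 ≤ ρ)
    (hρ : 15 + 4 * c₂ + (3 + 8 * c₃) * Real.log n ≤ ρ ^ 2) {F : (Fin n → ℝ) → ℂ}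
    (hF : Measurable F) (hFg : GrowthLE c₂ c₃ F) :
    TruncationError ρ (Real.exp (-ρ ^ 2 / 2)) F := by
  have hn' : (1 : ℝ) ≤ n := by exact_mod_cast hn
  have hL0 : 0 ≤ (3 + 8 * c₃) * Real.log n := mul_nonneg (by linarith) (Real.log_nonneg hn')
  have h15 : 15 ≤ ρ ^ 2 := by linarith
  have hρp : 0 < ρ := hρ0.lt_of_ne (by rintro rfl; norm_num at h15)
  obtain ⟨hx4, h8⟩ := eight_mul_growthTail_le hn hc₂ hc₃ hnc hρ
  have hs := smallOutside_cube hn hc₂ hc₃ (by linarith) hρp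
  have h1 := hs.one_sub_le
  have h2 : Real.exp (-ρ ^ 2 / 2) ≤ 2 / 15 := by
    have h3 := Real.add_one_le_exp (ρ ^ 2 / 2)
    rw [neg_div, Real.exp_neg, inv_le_comm₀ (Real.exp_pos _) (by norm_num)]
    linarith
  -- The outside mass is at most `1/60`, so `11/10` bounds the inverse probability. With this value
  -- the total coefficient is about `6.5`, which explains the factor `8` in the tail bound.
  refine truncationError_of_smallOutside (P := 11 / 10) hρp hs (by norm_num) ?_ ?_ hF hFg.sq_le
  · rw [inv_le_comm₀ hs.pos (by norm_num)]
    linarith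
  · have := hs.nonneg
    linarith

lemma inv_sqrt_pow_le_two_pow {x : ℝ} (hx : x ≤ 1 / 2) : (√(1 - x))⁻¹ ^ n ≤ 2 ^ n := by
  have : (√(1 - x))⁻¹ ≤ 2 := by
    rw [inv_le_comm₀ (Real.sqrt_pos.2 (by linarith)) (by norm_num)]
    exact Real.le_sqrt_of_sq_le (by linarith)
  exact pow_le_pow_left₀ (inv_nonneg.2 (Real.sqrt_nonneg _)) this n

lemma two_mul_div_le_half (hn : 1 ≤ n) (hnc : 4 * c₂ ≤ n) : 2 * c₂ / n ≤ 1 / 2 := by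
  have hn' : (1 : ℝ) ≤ n := by exact_mod_cast hn
  rw [div_le_iff₀ (by linarith)]; linarith

lemma inv_real_cube_le (hρ : 1 ≤ ρ) :
    ((halfNormal n).real (cube n ρ))⁻¹ ≤ ((halfNormal n).real (cube n 1))⁻¹ := by
  refine inv_anti₀ (halfNormal_real_cube_pos one_pos) (measureReal_mono fun y hy j => ?_)
  exact (hy j).trans hρ

/-- For fixed `n` constants are free. The condition `4c₂ ≤ n` makes the tail exponent `1 - 2c₂/n` at
least `1/2`, so the rate `e^{-ρ²/2}` survives. The inverse probability of the unit cube bounds that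
of every larger cube. -/
lemma exists_truncationError (hn : 1 ≤ n) (hc₂ : 0 ≤ c₂) (hc₃ : 0 ≤ c₃) (hnc : 4 * c₂ ≤ n) :
    ∃ D : ℝ, 0 ≤ D ∧ ∀ ρ : ℝ, 1 ≤ ρ → ∀ F : (Fin n → ℝ) → ℂ, Measurable F → GrowthLE c₂ c₃ F →
      TruncationError ρ (D * Real.exp (-ρ ^ 2 / 2)) F := by
  have hx := two_mul_div_le_half hn hnc
  set P := ((halfNormal n).real (cube n 1))⁻¹ with hP
  have hP1 : 1 ≤ P := (one_le_inv₀ (halfNormal_real_cube_pos one_pos)).2 measureReal_le_one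
  refine ⟨(P + (3 * (P + 1) + (P + 1) ^ 2) / 2) * ((n : ℝ) ^ (2 * c₃) * (n * 2 ^ n)),
    by positivity, fun ρ hρ F hF hFg => ?_⟩
  have hρp : 0 < ρ := by linarith
  refine truncationError_of_smallOutside hρp
    (smallOutside_cube hn hc₂ hc₃ (by linarith) hρp) hP1 (inv_real_cube_le hρ) ?_ hF hFg.sq_le
  rw [mul_assoc]
  refine mul_le_mul_of_nonneg_left ?_ (by positivity)
  rw [growthTail, mul_assoc, mul_assoc]
  have := inv_sqrt_pow_le_two_pow (n := n) hx
  gcongr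
  nlinarith [sq_nonneg ρ]

/-- A bound uniform in all `ρ > 0`, including small cubes whose inverse probability is unbounded.
There the weight itself is bounded on the cube; for `ρ ≥ 1` its conditional mean is at most the full
mean over the probability of the unit cube. -/
lemma exists_secondCumulant_cond_le (hn : 1 ≤ n) (hc₂ : 0 ≤ c₂) (hc₃ : 0 ≤ c₃)
    (hnc : 4 * c₂ ≤ n) :
    ∃ D : ℝ, 0 ≤ D ∧ ∀ ρ : ℝ, 0 < ρ → ∀ g : (Fin n → ℝ) → ℝ, Measurable g → GrowthLE c₂ c₃ g →
      ∫ y, g y ∂(halfNormal n)[|cube n ρ] + variance g ((halfNormal n)[|cube n ρ]) / 2 ≤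
        ∫ y, g y ∂halfNormal n + variance g (halfNormal n) / 2 + D := by
  have hx := two_mul_div_le_half hn hnc
  have hn0 : (0 : ℝ) < n := by exact_mod_cast hn
  have hWi := integrable_growthWeight (c₃ := c₃) (show 2 * c₂ / n < 1 by linarith)
  have hW1 := one_le_growthWeight hn hc₂ hc₃
  set e := ∫ y, growthWeight n c₂ c₃ y ∂halfNormal n with he
  have he0 : 0 ≤ e := integral_nonneg fun y => zero_le_one.trans (hW1 y)
  set P := ((halfNormal n).real (cube n 1))⁻¹ with hP
  have hP0 : 0 ≤ P := inv_nonneg.2 measureReal_nonneg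
  set D₀ := (n : ℝ) ^ (2 * c₃) * Real.exp (2 * c₂) + P * e with hD₀
  have hD₀0 : 0 ≤ D₀ := by positivity
  refine ⟨3 / 2 * D₀ + e, by positivity, fun ρ hρ g hg hgg => ?_⟩
  have hprob : IsProbabilityMeasure ((halfNormal n)[|cube n ρ]) :=
    cond_isProbabilityMeasure (halfNormal_cube_ne_zero hρ)
  set ν := (halfNormal n)[|cube n ρ] with hν
  have hgW : ∀ y, ‖g y‖ ≤ growthWeight n c₂ c₃ y := fun y => by
    have h1 := hgg.sq_le y
    have h2 := hW1 y
    nlinarith [norm_nonneg (g y), sq_nonneg (‖g y‖ - 1)]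
  have hνW : Integrable (growthWeight n c₂ c₃) ν :=
    Integrable.smul_measure hWi.restrict
      (ENNReal.inv_ne_top.2 (halfNormal_cube_ne_zero hρ))
  have hνW' : ∫ y, growthWeight n c₂ c₃ y ∂ν ≤ D₀ := by
    rcases le_or_gt 1 ρ with h | h
    · rw [hν, integral_cond, smul_eq_mul]
      have h1 : ∫ y in cube n ρ, growthWeight n c₂ c₃ y ∂halfNormal n ≤ e :=
        setIntegral_le_integral hWi (.of_forall fun y => zero_le_one.trans (hW1 y))
      have h2 := inv_real_cube_le (n := n) h
      have h3 : 0 ≤ (n : ℝ) ^ (2 * c₃) * Real.exp (2 * c₂) := by positivity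
      have h4 : ((halfNormal n).real (cube n ρ))⁻¹ *
          ∫ y in cube n ρ, growthWeight n c₂ c₃ y ∂halfNormal n ≤ P * e :=
        mul_le_mul h2 h1 (integral_nonneg fun y => zero_le_one.trans (hW1 y)) hP0
      linarith
    · have h1 : ∀ᵐ y ∂ν, growthWeight n c₂ c₃ y ≤ (n : ℝ) ^ (2 * c₃) * Real.exp (2 * c₂) := by
        filter_upwards [ae_cond_mem measurableSet_cube] with y hy
        rw [growthWeight]
        refine mul_le_mul_of_nonneg_left (Real.exp_le_exp.2 ?_) (by positivity)
        have h2 : ∑ i, y i ^ 2 ≤ n := by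
          calc _ ≤ ∑ _i : Fin n, (1 : ℝ) := Finset.sum_le_sum fun i _ => by
                have h3 := hy i
                rw [← sq_abs]
                nlinarith [abs_nonneg (y i)]
            _ = n := by simp
        calc 2 * c₂ / n * ∑ i, y i ^ 2 ≤ 2 * c₂ / n * n := by gcongr
          _ = 2 * c₂ := by field_simp
      have h2 := integral_mono_ae hνW (integrable_const _) h1
      simp only [integral_const, probReal_univ, one_smul] at h2
      have h3 : 0 ≤ P * e := by positivity
      linarith
  have h1 : ∫ y, g y ∂ν ≤ D₀ :=
    ((le_abs_self _).trans (norm_integral_le_of_norm_le hνW (.of_forall hgW))).trans hνW'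
  have h2 : variance g ν ≤ D₀ := by
    refine (variance_le_expectation_sq hg.aestronglyMeasurable).trans (le_trans ?_ hνW')
    refine integral_mono_of_nonneg (.of_forall fun y => sq_nonneg _) hνW (.of_forall fun y => ?_)
    simpa using hgg.sq_le y
  have h3 : -e ≤ ∫ y, g y ∂halfNormal n :=
    (abs_le.1 (norm_integral_le_of_norm_le hWi (.of_forall hgW))).1
  have h4 := variance_nonneg g (halfNormal n)
  linarith

end Growth

/-! ### Combining the smaller cube, the rest of the domain and the perturbation. -/

section Assembly

variable {n : ℕ} {c₂ c₃ ρ ρ₁ ρ₂ θ : ℝ}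

lemma GrowthLE.bounded_on_cube {E : Type*} [NormedAddCommGroup E] {F : (Fin n → ℝ) → E}
    (h : GrowthLE c₂ c₃ F) (hc₂ : 0 ≤ c₂) (ρ : ℝ) : ∃ B, ∀ y ∈ cube n ρ, ‖F y‖ ≤ B := by
  refine ⟨(n : ℝ) ^ c₃ * Real.exp (c₂ * (∑ _i : Fin n, ρ ^ 2) / n), fun y hy => (h y).trans ?_⟩
  have h1 : ∑ i, y i ^ 2 ≤ ∑ _i : Fin n, ρ ^ 2 := Finset.sum_le_sum fun i _ => by
    rw [← sq_abs]
    exact pow_le_pow_left₀ (abs_nonneg _) (hy i) 2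
  gcongr

lemma GrowthLE.bddMeasurable_clampCube {E : Type*} [NormedAddCommGroup E] [MeasurableSpace E]
    {F : (Fin n → ℝ) → E} (h : GrowthLE c₂ c₃ F) (hc₂ : 0 ≤ c₂) (hF : Measurable F)
    (hρ : 0 ≤ ρ) : BddMeasurable fun y => F (clampCube ρ y) := by
  obtain ⟨B, hB⟩ := h.bounded_on_cube hc₂ ρ
  exact ⟨hF.comp measurable_clampCube, B, fun y => hB _ (clampCube_mem hρ y)⟩

lemma integrableOn_of_measurable_of_bounded {α E : Type*} [MeasurableSpace α]
    [NormedAddCommGroup E] [MeasurableSpace E] [BorelSpace E] [SecondCountableTopology E]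
    {ν : Measure α} [IsFiniteMeasure ν] {F : α → E} {s : Set α} (hs : MeasurableSet s)
    (hF : Measurable F) (hb : ∃ B, ∀ x ∈ s, ‖F x‖ ≤ B) : IntegrableOn F s ν := by
  obtain ⟨B, hB⟩ := hb
  refine Integrable.of_bound hF.aestronglyMeasurable B ?_
  filter_upwards [ae_restrict_mem hs] with x hx using hB x hx

lemma integrableOn_cexp {α : Type*} [MeasurableSpace α]
    {ν : Measure α} [IsFiniteMeasure ν] {F : α → ℂ} {s : Set α} (hs : MeasurableSet s)
    (hF : Measurable F) (hb : ∃ B, ∀ x ∈ s, ‖F x‖ ≤ B) :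
    IntegrableOn (fun x => Complex.exp (F x)) s ν := by
  obtain ⟨B, hB⟩ := hb
  refine integrableOn_of_measurable_of_bounded hs hF.cexp ⟨Real.exp B, fun x hx => ?_⟩
  rw [Complex.norm_exp]
  exact Real.exp_le_exp.2 ((Complex.re_le_norm _).trans (hB x hx))

lemma integrableOn_exp {α : Type*} [MeasurableSpace α]
    {ν : Measure α} [IsFiniteMeasure ν] {F : α → ℝ} {s : Set α} (hs : MeasurableSet s)
    (hF : Measurable F) (hb : ∃ B, ∀ x ∈ s, ‖F x‖ ≤ B) :
    IntegrableOn (fun x => Real.exp (F x)) s ν := by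
  obtain ⟨B, hB⟩ := hb
  refine integrableOn_of_measurable_of_bounded hs hF.exp ⟨Real.exp B, fun x hx => ?_⟩
  rw [Real.norm_eq_abs, Real.abs_exp]
  exact Real.exp_le_exp.2 ((le_abs_self _).trans (hB x hx))

variable {Ω : Set (Fin n → ℝ)} {F H : (Fin n → ℝ) → ℂ} {G : (Fin n → ℝ) → ℝ}

lemma norm_setIntegral_cexp_mul_sub_one_le {s : ℝ} (hc₂ : 0 ≤ c₂) (hΩ : MeasurableSet Ω)
    (hΩ₂ : Ω ⊆ cube n ρ₂) (hGm : Measurable G) (hGg : GrowthLE c₂ c₃ G)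
    (hFG : ∀ y ∈ Ω, (F y).re ≤ G y) (hs0 : 0 ≤ s)
    (hs : ∀ y ∈ Ω, ‖Complex.exp (H y) - 1‖ ≤ s) :
    ‖∫ y in Ω, Complex.exp (F y) * (Complex.exp (H y) - 1) ∂halfNormal n‖ ≤
      s * ∫ y in cube n ρ₂, Real.exp (G y) ∂halfNormal n := by
  have hG₂ := integrableOn_exp (ν := halfNormal n) measurableSet_cube hGm
    (hGg.bounded_on_cube hc₂ ρ₂)
  have h1 : ‖∫ y in Ω, Complex.exp (F y) * (Complex.exp (H y) - 1) ∂halfNormal n‖ ≤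
      ∫ y in Ω, Real.exp (G y) * s ∂halfNormal n := by
    refine norm_integral_le_of_norm_le ((hG₂.mono_set hΩ₂).mul_const s) ?_
    filter_upwards [ae_restrict_mem hΩ] with y hy
    rw [norm_mul, Complex.norm_exp]
    exact mul_le_mul (Real.exp_le_exp.2 (hFG y hy)) (hs y hy) (norm_nonneg _) (Real.exp_pos _).le
  rw [integral_mul_const, mul_comm] at h1
  refine h1.trans (mul_le_mul_of_nonneg_left ?_ hs0)
  exact setIntegral_mono_set hG₂ (.of_forall fun _ => (Real.exp_pos _).le) hΩ₂.eventuallyLE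

lemma setIntegral_cexp_add_eq (hc₂ : 0 ≤ c₂) (hΩ : MeasurableSet Ω)
    (hΩ₂ : Ω ⊆ cube n ρ₂) (hFm : Measurable F) (hFg : GrowthLE c₂ c₃ F)
    (hHm : Measurable H) (hHb : ∃ M, ∀ y ∈ Ω, ‖H y‖ ≤ M) :
    ∫ y in Ω, Complex.exp (F y + H y) ∂halfNormal n =
      ∫ y in Ω, Complex.exp (F y) ∂halfNormal n +
        ∫ y in Ω, Complex.exp (F y) * (Complex.exp (H y) - 1) ∂halfNormal n := by
  obtain ⟨B, hB⟩ := hFg.bounded_on_cube hc₂ ρ₂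
  obtain ⟨M, hM⟩ := hHb
  have h1 : IntegrableOn (fun y => Complex.exp (F y)) Ω (halfNormal n) :=
    integrableOn_cexp hΩ hFm ⟨B, fun y hy => hB y (hΩ₂ hy)⟩
  have h2 : IntegrableOn (fun y => Complex.exp (F y + H y)) Ω (halfNormal n) :=
    integrableOn_cexp hΩ (hFm.add hHm) ⟨B + M, fun y hy =>
      (norm_add_le _ _).trans (add_le_add (hB y (hΩ₂ hy)) (hM y hy))⟩
  have h3 : ∀ y, Complex.exp (F y) * (Complex.exp (H y) - 1) =
      Complex.exp (F y + H y) - Complex.exp (F y) := fun y => by rw [Complex.exp_add]; ring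
  simp_rw [h3]
  rw [integral_sub h2 h1]
  ring

/-- Three contributions: the smaller cube gives the main term by the core estimate, the rest of `Ω`
is dominated by the integral of `e^G` over the shell between the cubes, and the perturbation costs
`s` times the integral of `e^G` over the larger cube. -/
theorem norm_setIntegral_cexp_add_sub_le {s a S₁ S₂ : ℝ} (hc₂ : 0 ≤ c₂) (hΩ : MeasurableSet Ω)
    (hΩ₁ : cube n ρ₁ ⊆ Ω) (hΩ₂ : Ω ⊆ cube n ρ₂) (hFm : Measurable F) (hFg : GrowthLE c₂ c₃ F)
    (hGm : Measurable G) (hGg : GrowthLE c₂ c₃ G)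
    (hHm : Measurable H) (hHb : ∃ M, ∀ y ∈ Ω, ‖H y‖ ≤ M)
    (hFG : ∀ y ∈ Ω, (F y).re ≤ G y) (hs0 : 0 ≤ s)
    (hs : ∀ y ∈ Ω, ‖Complex.exp (H y) - 1‖ ≤ s)
    (hF2 : MemLp F 2 (halfNormal n)) (hG2 : MemLp G 2 (halfNormal n))
    (ha0 : 0 ≤ a) (ha1 : a ≤ 2 / 3) (haS : n * a ^ 3 ≤ S₁)
    (hFd : SmallDifferences a fun y => F (clampCube ρ₁ y)) (hGc : ExpControl ρ₁ ρ₂ S₂ G)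
    (hF₁ : TruncationError ρ₁ θ F) (hG₁ : TruncationError ρ₁ θ fun y => (G y : ℂ))
    (hG₂ : TruncationError ρ₂ θ fun y => (G y : ℂ)) :
    ‖∫ y in Ω, Complex.exp (F y + H y) ∂halfNormal n -
        Complex.exp (secondCumulantSum (halfNormal n) F)‖ ≤
      Real.exp (∫ y, (F y).re ∂halfNormal n + variance (fun y => (F y).re) (halfNormal n) / 2) *
        (Real.exp (S₁ + θ) - 1) +
      Real.exp (∫ y, G y ∂halfNormal n + variance G (halfNormal n) / 2) *
        (2 * Real.exp (S₂ + θ) - 2 + Real.exp (S₂ + θ) * s) := by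
  have hGi := integrableOn_exp (ν := halfNormal n) measurableSet_cube hGm
    (hGg.bounded_on_cube hc₂ ρ₂)
  obtain ⟨B, hB⟩ := hFg.bounded_on_cube hc₂ ρ₂
  have hFi : IntegrableOn (fun y => Complex.exp (F y)) Ω (halfNormal n) :=
    integrableOn_cexp hΩ hFm ⟨B, fun y hy => hB y (hΩ₂ hy)⟩
  have h1 := hF₁.norm_setIntegral_cexp_sub_le ha0 ha1 hFd (re_secondCumulantSum_le _ hF2)
  rw [re_secondCumulantSum_ofReal (f := fun y => (F y).re) _ hF2.re] at h1
  have h1' : Real.exp (n * a ^ 3 + θ) ≤ Real.exp (S₁ + θ) := Real.exp_le_exp.2 (by linarith)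
  have h2 : ‖∫ y in Ω \ cube n ρ₁, Complex.exp (F y) ∂halfNormal n‖ ≤
      ∫ y in cube n ρ₂, Real.exp (G y) ∂halfNormal n -
        ∫ y in cube n ρ₁, Real.exp (G y) ∂halfNormal n := by
    rw [← setIntegral_sdiff measurableSet_cube hGi (hΩ₁.trans hΩ₂)]
    calc _ ≤ ∫ y in Ω \ cube n ρ₁, Real.exp (G y) ∂halfNormal n := by
          refine norm_integral_le_of_norm_le (hGi.mono_set (Set.sdiff_subset.trans hΩ₂)) ?_
          filter_upwards [ae_restrict_mem (hΩ.diff measurableSet_cube)] with y hy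
          rw [Complex.norm_exp]
          exact Real.exp_le_exp.2 (hFG y hy.1)
      _ ≤ _ := setIntegral_mono_set (hGi.mono_set Set.sdiff_subset)
          (.of_forall fun _ => (Real.exp_pos _).le) (Set.sdiff_subset_sdiff_left hΩ₂).eventuallyLE
  have h3 := norm_setIntegral_cexp_mul_sub_one_le hc₂ hΩ hΩ₂ hGm hGg hFG hs0 hs
  have hb₁ := hGg.bddMeasurable_clampCube hc₂ hGm hG₁.pos.le
  have hb₂ := hGg.bddMeasurable_clampCube hc₂ hGm hG₂.pos.le
  have h4 := setIntegral_exp_le_of_expControl hGc hG₂ hb₂ hG2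
  have h5 := setIntegral_exp_sub_le_of_expControl hGc hG₁ hG₂ hb₁ hb₂ hG2
  rw [setIntegral_cexp_add_eq hc₂ hΩ hΩ₂ hFm hFg hHm hHb]
  have h6 : ∫ y in Ω, Complex.exp (F y) ∂halfNormal n =
      ∫ y in cube n ρ₁, Complex.exp (F y) ∂halfNormal n +
        ∫ y in Ω \ cube n ρ₁, Complex.exp (F y) ∂halfNormal n := by
    rw [setIntegral_sdiff measurableSet_cube hFi hΩ₁]; ring
  rw [h6]
  set I₁ := ∫ y in cube n ρ₁, Complex.exp (F y) ∂halfNormal n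
  set I₂ := ∫ y in Ω \ cube n ρ₁, Complex.exp (F y) ∂halfNormal n
  set I₃ := ∫ y in Ω, Complex.exp (F y) * (Complex.exp (H y) - 1) ∂halfNormal n
  have h7 : I₁ + I₂ + I₃ - Complex.exp (secondCumulantSum (halfNormal n) F) =
      (I₁ - Complex.exp (secondCumulantSum (halfNormal n) F)) + I₂ + I₃ := by ring
  rw [h7]
  refine norm_add₃_le.trans ?_
  set R := Real.exp (∫ y, (F y).re ∂halfNormal n + variance (fun y => (F y).re) (halfNormal n) / 2)
  have hR : 0 ≤ R := (Real.exp_pos _).le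
  have h8 : R * (Real.exp (n * a ^ 3 + θ) - 1) ≤ R * (Real.exp (S₁ + θ) - 1) := by gcongr
  have h9 := mul_le_mul_of_nonneg_left h4 hs0
  have h10 := h1.trans h8
  linarith

/-- The exponent keeps the conditional moments, so no truncation error is involved and every
positive `ρ₂` is allowed. -/
lemma setIntegral_exp_le_cond {S : ℝ} (hρ₂ : 0 < ρ₂) (hc : ExpControl ρ₁ ρ₂ S G)
    (hb : BddMeasurable fun y => G (clampCube ρ₂ y)) (hG : MemLp G 2 (halfNormal n)) :
    ∫ y in cube n ρ₂, Real.exp (G y) ∂halfNormal n ≤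
      Real.exp (∫ y, G y ∂(halfNormal n)[|cube n ρ₂] +
        variance G ((halfNormal n)[|cube n ρ₂]) / 2 + S) := by
  have := isProbabilityMeasure_truncNormal hρ₂
  have hprob : IsProbabilityMeasure ((halfNormal n)[|cube n ρ₂]) :=
    cond_isProbabilityMeasure (halfNormal_cube_ne_zero hρ₂)
  have hGν : MemLp G 2 ((halfNormal n)[|cube n ρ₂]) :=
    hG.restrict _ |>.smul_measure (ENNReal.inv_ne_top.2 (halfNormal_cube_ne_zero hρ₂))
  have hv := variance_nonneg G ((halfNormal n)[|cube n ρ₂])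
  rw [setIntegral_cube_eq_clampCube hρ₂ fun y => Real.exp (G y)]
  have h0 : 0 ≤ ∫ y, Real.exp (G (clampCube ρ₂ y)) ∂Measure.pi (fun _ => truncNormal ρ₂) :=
    integral_nonneg fun _ => (Real.exp_pos _).le
  refine (mul_le_of_le_one_left h0 measureReal_le_one).trans ?_
  obtain ⟨a, ha0, ho, hS | ⟨ha1, hS, -, hd⟩⟩ := hc
  · refine (integral_exp_pi_le hb ho).trans ?_
    rw [← integral_cond_cube_eq hρ₂]
    apply Real.exp_le_exp.2
    simp
    linarith
  · have h1 := hd.norm_integral_cexp_sub_le (μ := truncNormal ρ₂) ha0 ha1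
    simp only [Complex.ofReal_re] at h1
    rw [← secondCumulantSum_cond_cube_eq hρ₂ fun y => (G y : ℂ)] at h1
    have h2 := secondCumulantSum_ofReal_re ((halfNormal n)[|cube n ρ₂]) fun y => (G y : ℂ)
    simp only [Complex.ofReal_re] at h2
    rw [← h2, re_secondCumulantSum_ofReal _ hGν] at h1
    simp only [← Complex.ofReal_exp, Complex.ofReal_re] at h1
    rw [integral_complex_ofReal, ← Complex.ofReal_sub, Complex.norm_real, Real.norm_eq_abs] at h1
    have h3 := (abs_le.1 h1).2
    rw [Real.exp_add]
    have h4 : Real.exp (n * a ^ 3) ≤ Real.exp S := Real.exp_le_exp.2 hS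
    have h5 := Real.exp_pos (∫ y, G y ∂(halfNormal n)[|cube n ρ₂] +
        variance G ((halfNormal n)[|cube n ρ₂]) / 2)
    nlinarith

lemma halfNormal_cube_zero (hn : 1 ≤ n) : halfNormal n (cube n 0) = 0 := by
  have : NullSingletonClass (gaussianReal 0 (1 / 2)) :=
    nullSingletonClass_gaussianReal (by norm_num)
  rw [cube_eq_pi, Measure.pi_pi]
  refine Finset.prod_eq_zero (Finset.mem_univ ⟨0, hn⟩) ?_
  rw [neg_zero, Set.Icc_self]
  exact measure_singleton 0

/-- The crude bound used when the cube is small. -/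
lemma norm_setIntegral_cexp_add_le {s D S : ℝ} (hn : 1 ≤ n) (hc₂ : 0 ≤ c₂)
    (hΩ : MeasurableSet Ω) (hρ₂ : 0 ≤ ρ₂)
    (hΩ₂ : Ω ⊆ cube n ρ₂) (hFm : Measurable F) (hFg : GrowthLE c₂ c₃ F)
    (hGm : Measurable G) (hGg : GrowthLE c₂ c₃ G)
    (hHm : Measurable H) (hHb : ∃ M, ∀ y ∈ Ω, ‖H y‖ ≤ M)
    (hFG : ∀ y ∈ Ω, (F y).re ≤ G y) (hs0 : 0 ≤ s)
    (hs : ∀ y ∈ Ω, ‖Complex.exp (H y) - 1‖ ≤ s)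
    (hG2 : MemLp G 2 (halfNormal n)) (hGc : ExpControl ρ₁ ρ₂ S G)
    (hD : 0 < ρ₂ → ∫ y, G y ∂(halfNormal n)[|cube n ρ₂] +
      variance G ((halfNormal n)[|cube n ρ₂]) / 2 ≤
        ∫ y, G y ∂halfNormal n + variance G (halfNormal n) / 2 + D) :
    ‖∫ y in Ω, Complex.exp (F y + H y) ∂halfNormal n‖ ≤
      (1 + s) * Real.exp (∫ y, G y ∂halfNormal n + variance G (halfNormal n) / 2 + D + S) := by
  -- If `ρ₂ = 0`, then `Ω` is contained in a single point and is null because `n ≥ 1`; conditioning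
  -- on that cube would be meaningless.
  rcases hρ₂.eq_or_lt with h0 | h0
  · have : (halfNormal n).restrict Ω = 0 := by
      rw [Measure.restrict_eq_zero]
      exact measure_mono_null hΩ₂ (h0 ▸ halfNormal_cube_zero hn)
    rw [this]
    simp
    positivity
  have hGi := integrableOn_exp (ν := halfNormal n) measurableSet_cube hGm
    (hGg.bounded_on_cube hc₂ ρ₂)
  have h3 := norm_setIntegral_cexp_mul_sub_one_le hc₂ hΩ hΩ₂ hGm hGg hFG hs0 hs
  have h4 : ‖∫ y in Ω, Complex.exp (F y) ∂halfNormal n‖ ≤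
      ∫ y in cube n ρ₂, Real.exp (G y) ∂halfNormal n := by
    calc _ ≤ ∫ y in Ω, Real.exp (G y) ∂halfNormal n := by
          refine norm_integral_le_of_norm_le (hGi.mono_set hΩ₂) ?_
          filter_upwards [ae_restrict_mem hΩ] with y hy
          rw [Complex.norm_exp]
          exact Real.exp_le_exp.2 (hFG y hy)
      _ ≤ _ := setIntegral_mono_set hGi
          (.of_forall fun _ => (Real.exp_pos _).le) hΩ₂.eventuallyLE
  rw [setIntegral_cexp_add_eq hc₂ hΩ hΩ₂ hFm hFg hHm hHb]
  calc _ ≤ _ := norm_add_le _ _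
    _ ≤ (1 + s) * ∫ y in cube n ρ₂, Real.exp (G y) ∂halfNormal n := by linarith
    _ ≤ _ := by
      refine mul_le_mul_of_nonneg_left ?_ (by linarith)
      refine (setIntegral_exp_le_cond h0 hGc
        (hGg.bddMeasurable_clampCube hc₂ hGm hρ₂) hG2).trans (Real.exp_le_exp.2 ?_)
      linarith [hD h0]

end Assembly

/-! ### The theorem for independent coordinates, and uniformity of the constant. -/

section StandardisedTheorem

/-- The hypotheses of the theorem in the standardised variable. -/
structure StandardSetting {n : ℕ} (c₂ c₃ ρ₁ ρ₂ S₁ S₂ s : ℝ) (Ω : Set (Fin n → ℝ))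
    (F : (Fin n → ℝ) → ℂ) (G : (Fin n → ℝ) → ℝ) (H : (Fin n → ℝ) → ℂ) : Prop where
  one_le : 1 ≤ n
  c₂_nonneg : 0 ≤ c₂
  c₃_nonneg : 0 ≤ c₃
  four_mul_le : 4 * c₂ ≤ n
  ρ₁_nonneg : 0 ≤ ρ₁
  ρ₁_le : ρ₁ ≤ ρ₂
  S₁_nonneg : 0 ≤ S₁
  S₂_nonneg : 0 ≤ S₂
  measurableSet : MeasurableSet Ω
  cube_subset : cube n ρ₁ ⊆ Ω
  subset_cube : Ω ⊆ cube n ρ₂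
  measurable_F : Measurable F
  growth_F : GrowthLE c₂ c₃ F
  measurable_G : Measurable G
  growth_G : GrowthLE c₂ c₃ G
  measurable_H : Measurable H
  bounded_H : ∃ M, ∀ y ∈ Ω, ‖H y‖ ≤ M
  re_le : ∀ y ∈ Ω, (F y).re ≤ G y
  s_nonneg : 0 ≤ s
  le_s : ∀ y ∈ Ω, ‖Complex.exp (H y) - 1‖ ≤ s
  memLp_F : MemLp F 2 (halfNormal n)
  memLp_G : MemLp G 2 (halfNormal n)
  differences_F : ∃ a, 0 ≤ a ∧ a ≤ 2 / 3 ∧ n * a ^ 3 ≤ S₁ ∧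
    SmallDifferences a fun y => F (clampCube ρ₁ y)
  control_G : ExpControl ρ₁ ρ₂ S₂ G

/-- The error bound as a function of the real parameters. -/
noncomputable def relError (S₁ S₂ s v m δ : ℝ) : ℝ :=
  Real.exp (1 / 2 * v) * ((Real.exp (S₁ + δ) - 1) +
    (2 * Real.exp (S₂ + δ) - 2 + Real.exp (S₂ + δ) * s) * Real.exp m)

/-- Allows a truncation error `Dδ` with `δ ≤ 1` to be replaced by `δ` at the cost of a constant
outside the error bound. -/
lemma exp_add_mul_sub_one_le {u D δ : ℝ} (hu : 0 ≤ u) (hD : 0 ≤ D) (hδ0 : 0 ≤ δ) (hδ1 : δ ≤ 1) :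
    Real.exp (u + D * δ) - 1 ≤ (D + 1) * Real.exp D * (Real.exp (u + δ) - 1) := by
  have h1 : Real.exp (D * δ) - 1 ≤ D * Real.exp D * (Real.exp δ - 1) := by
    have h2 := Real.add_one_le_exp (-(D * δ))
    have h3 : Real.exp (D * δ) * Real.exp (-(D * δ)) = 1 := by rw [← Real.exp_add]; simp
    have h4 : Real.exp (D * δ) - 1 ≤ Real.exp (D * δ) * (D * δ) := by
      nlinarith [Real.exp_pos (D * δ)]
    have h5 : Real.exp (D * δ) ≤ Real.exp D := Real.exp_le_exp.2 (by nlinarith)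
    have h6 := Real.add_one_le_exp δ
    calc _ ≤ _ := h4
      _ ≤ Real.exp D * (D * (Real.exp δ - 1)) := by gcongr; linarith
      _ = _ := by ring
  have hu1 := Real.one_le_exp hu
  have hd1 := Real.one_le_exp hδ0
  have hD1 := Real.one_le_exp hD
  rw [Real.exp_add, Real.exp_add]
  set E := Real.exp u
  set d := Real.exp δ
  set x := Real.exp D
  have h7 : 0 ≤ E * (d - 1) := mul_nonneg (by linarith) (by linarith)
  calc E * Real.exp (D * δ) - 1 = E * (Real.exp (D * δ) - 1) + (E - 1) := by ring
    _ ≤ E * (D * x * (d - 1)) + (E - 1) := by gcongr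
    _ = D * x * (E * (d - 1)) + (E - 1) := by ring
    _ ≤ (D + 1) * x * (E * (d - 1)) + (D + 1) * x * (E - 1) := by
      have h8 : 1 ≤ (D + 1) * x := by nlinarith
      have h9 : D * x ≤ (D + 1) * x := by nlinarith
      have h10 : 0 ≤ E - 1 := by linarith
      nlinarith [mul_le_mul_of_nonneg_right h9 h7, mul_le_mul_of_nonneg_right h8 h10]
    _ = _ := by ring

lemma exp_add_mul_le {u D δ : ℝ} (hD : 0 ≤ D) (hδ0 : 0 ≤ δ) (hδ1 : δ ≤ 1) :
    Real.exp (u + D * δ) ≤ (D + 1) * Real.exp D * Real.exp (u + δ) := by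
  have h1 : Real.exp (u + D * δ) ≤ Real.exp (D + (u + δ)) := Real.exp_le_exp.2 (by nlinarith)
  rw [Real.exp_add D] at h1
  refine h1.trans ?_
  have h2 : 0 ≤ Real.exp D * Real.exp (u + δ) := by positivity
  nlinarith

lemma relError_nonneg {S₁ S₂ s v m δ : ℝ} (hS₁ : 0 ≤ S₁) (hS₂ : 0 ≤ S₂) (hs : 0 ≤ s)
    (hδ : 0 ≤ δ) : 0 ≤ relError S₁ S₂ s v m δ := by
  have h1 := Real.one_le_exp (add_nonneg hS₁ hδ)
  have h2 := Real.one_le_exp (add_nonneg hS₂ hδ)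
  have h3 := mul_nonneg (Real.exp_pos (S₂ + δ)).le hs
  exact mul_nonneg (Real.exp_pos _).le
    (add_nonneg (by linarith) (mul_nonneg (by linarith) (Real.exp_pos _).le))

lemma relError_mul_le {S₁ S₂ s v m D δ : ℝ} (hS₁ : 0 ≤ S₁) (hS₂ : 0 ≤ S₂) (hs : 0 ≤ s)
    (hD : 0 ≤ D) (hδ0 : 0 ≤ δ) (hδ1 : δ ≤ 1) :
    relError S₁ S₂ s v m (D * δ) ≤ (D + 1) * Real.exp D * relError S₁ S₂ s v m δ := by
  have h1 := exp_add_mul_sub_one_le hS₁ hD hδ0 hδ1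
  have h2 := exp_add_mul_sub_one_le hS₂ hD hδ0 hδ1
  have h3 := mul_le_mul_of_nonneg_right (exp_add_mul_le (u := S₂) hD hδ0 hδ1) hs
  set C := (D + 1) * Real.exp D
  rw [relError, relError]
  calc _ ≤ Real.exp (1 / 2 * v) * (C * (Real.exp (S₁ + δ) - 1) +
        (C * (2 * Real.exp (S₂ + δ) - 2 + Real.exp (S₂ + δ) * s)) * Real.exp m) := by
        gcongr
        linarith
    _ = _ := by ring

variable {n : ℕ} {c₂ c₃ ρ₁ ρ₂ S₁ S₂ s : ℝ} {Ω : Set (Fin n → ℝ)} {F : (Fin n → ℝ) → ℂ}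
  {G : (Fin n → ℝ) → ℝ} {H : (Fin n → ℝ) → ℂ}

/-- The exponent which compares `G` with the real part of `F`. -/
noncomputable def comparisonExponent (F : (Fin n → ℝ) → ℂ) (G : (Fin n → ℝ) → ℝ) : ℝ :=
  ∫ y, (G y - (F y).re) ∂halfNormal n +
    1 / 2 * (variance G (halfNormal n) - variance (fun y => (F y).re) (halfNormal n))

/-- The relative error of the approximation. -/
noncomputable def relativeDeviation (Ω : Set (Fin n → ℝ)) (F H : (Fin n → ℝ) → ℂ) : ℂ :=
  (∫ y in Ω, Complex.exp (F y + H y) ∂halfNormal n) /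
    Complex.exp (secondCumulantSum (halfNormal n) F) - 1

namespace StandardSetting

lemma exp_mean_F_eq (h : StandardSetting c₂ c₃ ρ₁ ρ₂ S₁ S₂ s Ω F G H) :
    Real.exp (∫ y, (F y).re ∂halfNormal n + variance (fun y => (F y).re) (halfNormal n) / 2) =
      Real.exp (1 / 2 * variance (fun y => (F y).im) (halfNormal n)) *
        ‖Complex.exp (secondCumulantSum (halfNormal n) F)‖ := by
  rw [Complex.norm_exp, re_secondCumulantSum _ h.memLp_F, ← Real.exp_add]
  congr 1; ring

lemma exp_mean_G_eq (h : StandardSetting c₂ c₃ ρ₁ ρ₂ S₁ S₂ s Ω F G H) :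
    Real.exp (∫ y, G y ∂halfNormal n + variance G (halfNormal n) / 2) =
      Real.exp (1 / 2 * variance (fun y => (F y).im) (halfNormal n)) *
        Real.exp (comparisonExponent F G) *
        ‖Complex.exp (secondCumulantSum (halfNormal n) F)‖ := by
  rw [Complex.norm_exp, re_secondCumulantSum _ h.memLp_F, ← Real.exp_add, ← Real.exp_add,
    comparisonExponent]
  have hi : Integrable (fun y => (F y).re) (halfNormal n) :=
    (h.memLp_F.integrable (by norm_num)).re
  rw [integral_sub (h.memLp_G.integrable (by norm_num)) hi]
  congr 1
  ring

lemma norm_relativeDeviation_le_relError (h : StandardSetting c₂ c₃ ρ₁ ρ₂ S₁ S₂ s Ω F G H) {θ : ℝ}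
    (hF₁ : TruncationError ρ₁ θ F) (hG₁ : TruncationError ρ₁ θ fun y => (G y : ℂ))
    (hG₂ : TruncationError ρ₂ θ fun y => (G y : ℂ)) :
    ‖relativeDeviation Ω F H‖ ≤ relError S₁ S₂ s (variance (fun y => (F y).im) (halfNormal n))
      (comparisonExponent F G) θ := by
  obtain ⟨a, ha0, ha1, haS, hd⟩ := h.differences_F
  have key := norm_setIntegral_cexp_add_sub_le h.c₂_nonneg h.measurableSet h.cube_subset
    h.subset_cube h.measurable_F h.growth_F h.measurable_G h.growth_G h.measurable_H h.bounded_H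
    h.re_le h.s_nonneg h.le_s h.memLp_F h.memLp_G ha0 ha1 haS hd h.control_G hF₁ hG₁ hG₂
  rw [h.exp_mean_F_eq, h.exp_mean_G_eq] at key
  have hU := norm_pos_iff.2 (Complex.exp_ne_zero (secondCumulantSum (halfNormal n) F))
  rw [relativeDeviation, div_sub_one (Complex.exp_ne_zero _), norm_div, div_le_iff₀ hU]
  refine key.trans (le_of_eq ?_)
  rw [relError]
  ring

/-- For `ρ₁ < 1` one has `e^{-ρ₁²/2} ≥ 1/2`, so both parts of the claimed error are bounded below.
Bounding the deviation by the modulus of the quotient plus `1` then loses only a constant. -/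
lemma norm_relativeDeviation_le_of_lt_one (h : StandardSetting c₂ c₃ ρ₁ ρ₂ S₁ S₂ s Ω F G H) {D : ℝ}
    (hD0 : 0 ≤ D) (hD : 0 < ρ₂ → ∫ y, G y ∂(halfNormal n)[|cube n ρ₂] +
      variance G ((halfNormal n)[|cube n ρ₂]) / 2 ≤
        ∫ y, G y ∂halfNormal n + variance G (halfNormal n) / 2 + D) (hρ₁ : ρ₁ < 1) :
    ‖relativeDeviation Ω F H‖ ≤ 2 * Real.exp D *
      relError S₁ S₂ s (variance (fun y => (F y).im) (halfNormal n))
        (comparisonExponent F G) (Real.exp (-ρ₁ ^ 2 / 2)) := by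
  have key := norm_setIntegral_cexp_add_le h.one_le h.c₂_nonneg h.measurableSet
    (h.ρ₁_nonneg.trans h.ρ₁_le) h.subset_cube h.measurable_F h.growth_F h.measurable_G h.growth_G
    h.measurable_H h.bounded_H h.re_le h.s_nonneg h.le_s h.memLp_G h.control_G hD
  rw [Real.exp_add, Real.exp_add, h.exp_mean_G_eq] at key
  have hU := norm_pos_iff.2 (Complex.exp_ne_zero (secondCumulantSum (halfNormal n) F))
  have h1 : ‖relativeDeviation Ω F H‖ ≤ (1 + s) *
      (Real.exp (1 / 2 * variance (fun y => (F y).im) (halfNormal n)) *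
        Real.exp (comparisonExponent F G) * Real.exp D * Real.exp S₂) + 1 := by
    rw [relativeDeviation]
    refine (norm_sub_le _ _).trans ?_
    rw [norm_one, norm_div]
    gcongr
    rw [div_le_iff₀ hU]
    refine key.trans (le_of_eq ?_)
    ring
  refine h1.trans ?_
  have hv : 1 ≤ Real.exp (1 / 2 * variance (fun y => (F y).im) (halfNormal n)) :=
    Real.one_le_exp (mul_nonneg (by norm_num) (variance_nonneg _ _))
  set v := variance (fun y => (F y).im) (halfNormal n)
  set m := comparisonExponent F G
  set δ := Real.exp (-ρ₁ ^ 2 / 2) with hδ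
  have hδ1 : 1 / 2 ≤ δ := by
    have h2 := Real.add_one_le_exp (-ρ₁ ^ 2 / 2)
    have h3 := h.ρ₁_nonneg
    nlinarith
  have hd := Real.add_one_le_exp δ
  have hS₁ := Real.one_le_exp h.S₁_nonneg
  have hS₂ := Real.one_le_exp h.S₂_nonneg
  have hs := h.s_nonneg
  have hDe := Real.one_le_exp hD0
  have hme := Real.exp_pos m
  rw [relError, Real.exp_add, Real.exp_add]
  set V := Real.exp (1 / 2 * v)
  set E₁ := Real.exp S₁
  set E₂ := Real.exp S₂
  set d := Real.exp δ
  set M := Real.exp m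
  set X := Real.exp D
  have hd32 : 3 / 2 ≤ d := by linarith
  have e1 : 1 / 2 ≤ E₁ * d - 1 := by nlinarith
  have e2 : E₂ * (1 + s) ≤ 2 * (2 * (E₂ * d) - 2 + E₂ * d * s) := by
    have h4 : E₂ * (3 / 2) ≤ E₂ * d := by gcongr
    have h5 : E₂ * s ≤ E₂ * d * s := by
      have : E₂ * s * 1 ≤ E₂ * s * d := by gcongr; linarith
      linarith
    have h6 : 0 ≤ E₂ * d * s := by positivity
    nlinarith
  calc (1 + s) * (V * M * X * E₂) + 1 = V * X * M * (E₂ * (1 + s)) + 1 := by ring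
    _ ≤ V * X * M * (2 * (2 * (E₂ * d) - 2 + E₂ * d * s)) + V * X * (2 * (E₁ * d - 1)) := by
      have h7 : 1 ≤ V * X := by nlinarith
      have h8 : 1 ≤ V * X * (2 * (E₁ * d - 1)) := by nlinarith
      gcongr
    _ = _ := by ring

end StandardSetting

/-- The threshold `ρ₁ = 1` separates cubes with probability bounded below, where truncation is
effective, from those where the crude bound is enough. -/
lemma exists_forall_norm_relativeDeviation_le (hn : 1 ≤ n) (hc₂ : 0 ≤ c₂) (hc₃ : 0 ≤ c₃)
    (hnc : 4 * c₂ ≤ n) :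
    ∃ C : ℝ, ∀ (ρ₁ ρ₂ S₁ S₂ s : ℝ) (Ω : Set (Fin n → ℝ)) (F : (Fin n → ℝ) → ℂ)
      (G : (Fin n → ℝ) → ℝ) (H : (Fin n → ℝ) → ℂ),
      StandardSetting c₂ c₃ ρ₁ ρ₂ S₁ S₂ s Ω F G H →
      ‖relativeDeviation Ω F H‖ ≤ C *
        relError S₁ S₂ s (variance (fun y => (F y).im) (halfNormal n))
          (comparisonExponent F G) (Real.exp (-ρ₁ ^ 2 / 2)) := by
  obtain ⟨D, hD0, hD⟩ := exists_truncationError hn hc₂ hc₃ hnc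
  obtain ⟨D', hD'0, hD'⟩ := exists_secondCumulant_cond_le hn hc₂ hc₃ hnc
  refine ⟨max ((D + 1) * Real.exp D) (2 * Real.exp D'), fun ρ₁ ρ₂ S₁ S₂ s Ω F G H h => ?_⟩
  have hS₁ := h.S₁_nonneg
  have hS₂ := h.S₂_nonneg
  have hs := h.s_nonneg
  have hδ := Real.exp_pos (-ρ₁ ^ 2 / 2)
  have hE : 0 ≤ relError S₁ S₂ s (variance (fun y => (F y).im) (halfNormal n))
      (comparisonExponent F G) (Real.exp (-ρ₁ ^ 2 / 2)) := by
    exact relError_nonneg hS₁ hS₂ hs hδ.le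
  have hGr : GrowthLE c₂ c₃ fun y => (G y : ℂ) := fun y => by
    rw [Complex.norm_real]; exact h.growth_G y
  have hGm : Measurable fun y => (G y : ℂ) := Complex.measurable_ofReal.comp h.measurable_G
  rcases lt_or_ge ρ₁ 1 with h1 | h1
  · refine (h.norm_relativeDeviation_le_of_lt_one hD'0
      (fun h0 => hD' ρ₂ h0 G h.measurable_G h.growth_G) h1).trans ?_
    exact mul_le_mul_of_nonneg_right (le_max_right _ _) hE
  · have h2 : Real.exp (-ρ₂ ^ 2 / 2) ≤ Real.exp (-ρ₁ ^ 2 / 2) := by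
      have := h.ρ₁_le
      apply Real.exp_le_exp.2; nlinarith
    refine (h.norm_relativeDeviation_le_relError (hD ρ₁ h1 F h.measurable_F h.growth_F)
      (hD ρ₁ h1 _ hGm hGr) ((hD ρ₂ (h1.trans h.ρ₁_le) _ hGm hGr).mono (by gcongr))).trans ?_
    refine (relError_mul_le hS₁ hS₂ hs hD0 hδ.le ?_).trans
      (mul_le_mul_of_nonneg_right (le_max_left _ _) hE)
    exact Real.exp_le_one_iff.2 (by nlinarith)

lemma StandardSetting.norm_relativeDeviation_le_of_le_sq
    (h : StandardSetting c₂ c₃ ρ₁ ρ₂ S₁ S₂ s Ω F G H) (hnc : (1 + 2 * c₂) ^ 2 ≤ n)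
    (hρ : 15 + 4 * c₂ + (3 + 8 * c₃) * Real.log n ≤ ρ₁ ^ 2) :
    ‖relativeDeviation Ω F H‖ ≤
      relError S₁ S₂ s (variance (fun y => (F y).im) (halfNormal n))
        (comparisonExponent F G) (Real.exp (-ρ₁ ^ 2 / 2)) := by
  have hGr : GrowthLE c₂ c₃ fun y => (G y : ℂ) := fun y => by
    rw [Complex.norm_real]; exact h.growth_G y
  have hGm : Measurable fun y => (G y : ℂ) := Complex.measurable_ofReal.comp h.measurable_G
  have h1 := h.ρ₁_le
  have h0 := h.ρ₁_nonneg
  have h12 : ρ₁ ^ 2 ≤ ρ₂ ^ 2 := by gcongr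
  have h2 : Real.exp (-ρ₂ ^ 2 / 2) ≤ Real.exp (-ρ₁ ^ 2 / 2) :=
    Real.exp_le_exp.2 (by linarith)
  exact h.norm_relativeDeviation_le_relError
    (truncationError_of_le_sq h.one_le h.c₂_nonneg h.c₃_nonneg hnc h0 hρ h.measurable_F h.growth_F)
    (truncationError_of_le_sq h.one_le h.c₂_nonneg h.c₃_nonneg hnc h0 hρ hGm hGr)
    ((truncationError_of_le_sq h.one_le h.c₂_nonneg h.c₃_nonneg hnc (h0.trans h1)
      (hρ.trans h12) hGm hGr).mono h2)

/-- Squaring the hypothesis gives `ρ² ≥ c₁² (log n)^(1+2ε)`, which eventually exceeds any fixed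
multiple of `log n`. This is the only use of `ε > 0`. -/
lemma exists_forall_le_sq_of_log_rpow_le {c₁ ε : ℝ} (hc₁ : 0 < c₁) (hc₂ : 0 ≤ c₂) (hε : 0 < ε) :
    ∃ N : ℕ, ∀ n : ℕ, N ≤ n → (1 + 2 * c₂) ^ 2 ≤ (n : ℝ) ∧
      ∀ ρ : ℝ, c₁ * Real.log n ^ (1 / 2 + ε) ≤ ρ →
        15 + 4 * c₂ + (3 + 8 * c₃) * Real.log n ≤ ρ ^ 2 := by
  have h1 : Filter.Tendsto (fun n : ℕ => Real.log n) Filter.atTop Filter.atTop :=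
    Real.tendsto_log_atTop.comp tendsto_natCast_atTop_atTop
  have h2 := (tendsto_rpow_atTop (show 0 < 2 * ε by linarith)).comp h1
  have h3 := (h2.eventually_ge_atTop ((18 + 4 * c₂ + 8 * c₃) / c₁ ^ 2)).and
    ((h1.eventually_ge_atTop 1).and
      (tendsto_natCast_atTop_atTop.eventually_ge_atTop ((1 + 2 * c₂) ^ 2)))
  obtain ⟨N, hN⟩ := Filter.eventually_atTop.1 h3
  refine ⟨N, fun n hn => ⟨(hN n hn).2.2, fun ρ hρ => ?_⟩⟩
  obtain ⟨h4, h5, -⟩ := hN n hn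
  simp only [Function.comp] at h4
  set L := Real.log n
  have hL : 0 < L := by linarith
  rw [div_le_iff₀ (by positivity)] at h4
  have h6 : (c₁ * L ^ (1 / 2 + ε)) ^ 2 ≤ ρ ^ 2 := by gcongr
  have h7 : (L ^ (1 / 2 + ε)) ^ 2 = L * L ^ (2 * ε) := by
    rw [← Real.rpow_natCast, ← Real.rpow_mul hL.le]
    nth_rewrite 2 [← Real.rpow_one L]
    rw [← Real.rpow_add hL]
    congr 1; push_cast; ring
  rw [mul_pow, h7] at h6
  have h8 := mul_le_mul_of_nonneg_left h4 hL.le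
  have h9 : 15 + 4 * c₂ ≤ (15 + 4 * c₂) * L := le_mul_of_one_le_right (by linarith) h5
  linarith

theorem exists_forall_standardSetting {c₁ ε : ℝ} (hc₁ : 0 < c₁) (hc₂ : 0 ≤ c₂) (hc₃ : 0 ≤ c₃)
    (hε : 0 < ε) :
    ∃ C : ℝ, ∀ (n : ℕ) (ρ₁ ρ₂ S₁ S₂ s : ℝ) (Ω : Set (Fin n → ℝ)) (F : (Fin n → ℝ) → ℂ)
      (G : (Fin n → ℝ) → ℝ) (H : (Fin n → ℝ) → ℂ), c₁ * Real.log n ^ (1 / 2 + ε) ≤ ρ₁ →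
      StandardSetting c₂ c₃ ρ₁ ρ₂ S₁ S₂ s Ω F G H →
      ‖relativeDeviation Ω F H‖ ≤ C *
        relError S₁ S₂ s (variance (fun y => (F y).im) (halfNormal n))
          (comparisonExponent F G) (Real.exp (-ρ₁ ^ 2 / 2)) := by
  obtain ⟨N, hN⟩ := exists_forall_le_sq_of_log_rpow_le (c₃ := c₃) hc₁ hc₂ hε
  have hex : ∀ n : ℕ, ∃ C : ℝ, ∀ (ρ₁ ρ₂ S₁ S₂ s : ℝ) (Ω : Set (Fin n → ℝ))
      (F : (Fin n → ℝ) → ℂ) (G : (Fin n → ℝ) → ℝ) (H : (Fin n → ℝ) → ℂ),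
      StandardSetting c₂ c₃ ρ₁ ρ₂ S₁ S₂ s Ω F G H →
      ‖relativeDeviation Ω F H‖ ≤ C *
        relError S₁ S₂ s (variance (fun y => (F y).im) (halfNormal n))
          (comparisonExponent F G) (Real.exp (-ρ₁ ^ 2 / 2)) := fun n => by
    by_cases h : 1 ≤ n ∧ 4 * c₂ ≤ n
    · exact exists_forall_norm_relativeDeviation_le h.1 hc₂ hc₃ h.2
    · exact ⟨0, fun _ _ _ _ _ _ _ _ _ hs => absurd ⟨hs.one_le, hs.four_mul_le⟩ h⟩
  choose C hC using hex
  -- The summand `1` serves all `n ≥ N`; the sum dominates each of the finitely many remaining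
  -- constants.
  refine ⟨1 + ∑ n ∈ Finset.range N, |C n|, fun n ρ₁ ρ₂ S₁ S₂ s Ω F G H hρ h => ?_⟩
  have hsum : 0 ≤ ∑ n ∈ Finset.range N, |C n| := Finset.sum_nonneg fun _ _ => abs_nonneg _
  have hE : 0 ≤ relError S₁ S₂ s (variance (fun y => (F y).im) (halfNormal n))
      (comparisonExponent F G) (Real.exp (-ρ₁ ^ 2 / 2)) := by
    exact relError_nonneg h.S₁_nonneg h.S₂_nonneg h.s_nonneg (Real.exp_pos _).le
  rcases lt_or_ge n N with hn | hn
  · refine (hC n _ _ _ _ _ _ _ _ _ h).trans (mul_le_mul_of_nonneg_right ?_ hE)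
    have := Finset.single_le_sum (f := fun n => |C n|) (fun _ _ => abs_nonneg _)
      (Finset.mem_range.2 hn)
    linarith [le_abs_self (C n)]
  · obtain ⟨h1, h2⟩ := hN n hn
    refine (h.norm_relativeDeviation_le_of_le_sq h1 (h2 ρ₁ hρ)).trans ?_
    exact le_mul_of_one_le_left hE (by linarith)

end StandardisedTheorem

/-! ### Returning to the original variables. -/

section Transfer

variable {n : ℕ} {A T : Matrix (Fin n) (Fin n) ℝ}

lemma natCast_mul_rpow_neg_third_pow (hn : 1 ≤ n) (φ : ℝ) :
    (n : ℝ) * (φ * (n : ℝ) ^ (-(1 / 3) : ℝ)) ^ 3 = φ ^ 3 := by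
  have hn0 : (0 : ℝ) < n := by exact_mod_cast hn
  rw [mul_pow, ← Real.rpow_natCast ((n : ℝ) ^ (-(1 / 3) : ℝ)), ← Real.rpow_mul hn0.le]
  norm_num
  rw [Real.rpow_neg_one]
  field_simp

/-- Explains the normalisation `(2φ)^(3/2)` in the first order hypothesis: Hoeffding's exponent `n
a²/8` becomes exactly `φ³`. -/
lemma natCast_mul_rpow_neg_half_sq (hn : 1 ≤ n) {φ : ℝ} (hφ : 0 ≤ φ) :
    (n : ℝ) * ((2 * φ) ^ (3 / 2 : ℝ) * (n : ℝ) ^ (-(1 / 2) : ℝ)) ^ 2 / 8 = φ ^ 3 := by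
  have hn0 : (0 : ℝ) < n := by exact_mod_cast hn
  have h1 : ((2 * φ) ^ (3 / 2 : ℝ)) ^ 2 = (2 * φ) ^ 3 := by
    rw [← Real.rpow_natCast, ← Real.rpow_mul (by linarith), ← Real.rpow_natCast]
    norm_num
  have h2 : ((n : ℝ) ^ (-(1 / 2) : ℝ)) ^ 2 = (n : ℝ)⁻¹ := by
    rw [← Real.rpow_natCast, ← Real.rpow_mul hn0.le, ← Real.rpow_neg_one]
    norm_num
  rw [mul_pow, h1, h2]
  field_simp
  ring

lemma expControl_of_first {ρ₁ ρ₂ φ : ℝ} {g : (Fin n → ℝ) → ℝ} (hn : 1 ≤ n) (hρ₂ : 0 ≤ ρ₂)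
    (hφ : 0 ≤ φ) (hd : DifferentiableNear g ((fun y => T *ᵥ y) '' cube n ρ₂))
    (h1 : ∀ x ∈ (fun y => T *ᵥ y) '' cube n ρ₂, ∀ j,
      2 * ρ₂ * matrixNormOne T * |partialDerivative g j x|
        ≤ (2 * φ) ^ (3 / 2 : ℝ) * (n : ℝ) ^ (-(1 / 2) : ℝ)) :
    ExpControl ρ₁ ρ₂ (φ ^ 3) fun y => g (T *ᵥ y) := by
  refine ⟨(2 * φ) ^ (3 / 2 : ℝ) * (n : ℝ) ^ (-(1 / 2) : ℝ), by positivity,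
    oscillationLE_comp_clampCube hρ₂ (by positivity) (differentiableAt_of_differentiableNear hd)
      fun y hy i => h1 _ ⟨y, hy, rfl⟩ i, Or.inl (natCast_mul_rpow_neg_half_sq hn hφ).le⟩

lemma cube_mono {ρ₁ ρ₂ : ℝ} (h : ρ₁ ≤ ρ₂) : cube n ρ₁ ⊆ cube n ρ₂ :=
  fun _ hy j => (hy j).trans h

/-- The smaller cube inherits all derivative bounds from the larger one. Nothing is assumed about `a
≤ 2/3` for `g`, so large `a` needs its own argument. -/
lemma expControl_of_second {ρ₁ ρ₂ φ : ℝ} {g : (Fin n → ℝ) → ℝ} (hn : 1 ≤ n) (hρ₁ : 0 ≤ ρ₁)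
    (hρ : ρ₁ ≤ ρ₂) (hφ : 0 ≤ φ)
    (hb₁ : BddMeasurable fun y => g (T *ᵥ clampCube ρ₁ y))
    (hb₂ : BddMeasurable fun y => g (T *ᵥ clampCube ρ₂ y))
    (hd : TwiceDifferentiableNear g ((fun y => T *ᵥ y) '' cube n ρ₂))
    (hH : HessianBddOn g ((fun y => T *ᵥ y) '' cube n ρ₂))
    (h1 : ∀ x ∈ (fun y => T *ᵥ y) '' cube n ρ₂, ∀ j,
      2 * ρ₂ * matrixNormOne T * |partialDerivative g j x| ≤ φ * (n : ℝ) ^ (-(1 / 3) : ℝ))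
    (h2 : 4 * ρ₂ ^ 2 * matrixNormOne T * matrixNormInf T *
      matrixNormInf (hessianSup g ((fun y => T *ᵥ y) '' cube n ρ₂))
        ≤ φ * (n : ℝ) ^ (-(1 / 3) : ℝ)) :
    ExpControl ρ₁ ρ₂ (φ ^ 3) fun y => g (T *ᵥ y) := by
  have ha3 := natCast_mul_rpow_neg_third_pow hn φ
  set a := φ * (n : ℝ) ^ (-(1 / 3) : ℝ) with ha
  have ha0 : 0 ≤ a := by positivity
  have hρ₂ := hρ₁.trans hρ
  refine ⟨a, ha0, oscillationLE_comp_clampCube hρ₂ ha0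
    (differentiableAt_of_differentiableNear hd.differentiableNear)
      fun y hy i => h1 _ ⟨y, hy, rfl⟩ i, ?_⟩
  rcases le_or_gt a (2 / 3) with h | h
  · have hsub : (fun y => T *ᵥ y) '' cube n ρ₁ ⊆ (fun y => T *ᵥ y) '' cube n ρ₂ :=
      Set.image_mono (cube_mono hρ)
    have hT1 := matrixNormOne_nonneg T
    have hTi := matrixNormInf_nonneg T
    refine Or.inr ⟨h, ha3.le, ?_, smallDifferences_ofReal_comp_clampCube hρ₂ ha0 hb₂ hd hH h1 h2⟩
    refine smallDifferences_ofReal_comp_clampCube hρ₁ ha0 hb₁ ?_ ?_ ?_ ?_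
    · obtain ⟨S, hS, hB, hd1, hd2⟩ := hd
      exact ⟨S, hS, hsub.trans hB, hd1, hd2⟩
    · exact fun j k => (hH j k).mono (Set.image_mono hsub)
    · intro x hx j
      refine le_trans ?_ (h1 x (hsub hx) j)
      rw [Real.norm_eq_abs]
      gcongr
    · refine le_trans ?_ h2
      have := matrixNormInf_mono (fun j k => hessianSup_nonneg j k) (hessianSup_mono hsub hH)
      have := matrixNormInf_nonneg (hessianSup g ((fun y => T *ᵥ y) '' cube n ρ₁))
      gcongr
  -- For `a > 2/3` the first order estimate is already good enough, since `n a²/8 ≤ n a³ = φ³`.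
  · left
    have hn0 : (0 : ℝ) ≤ n := Nat.cast_nonneg n
    have h3 : n * a ^ 2 * (2 / 3) ≤ n * a ^ 2 * a := by gcongr
    have h4 : 0 ≤ n * a ^ 2 := by positivity
    have h5 : n * a ^ 2 * a = φ ^ 3 := by rw [← ha3]; ring
    linarith

lemma integral_normalMeasure {E : Type*} [NormedAddCommGroup E] [NormedSpace ℝ E]
    [MeasurableSpace E] [BorelSpace E] [SecondCountableTopology E] (hA : A.PosDef)
    (hT : Tᵀ * A * T = 1) {φ : (Fin n → ℝ) → E} (hφ : Measurable φ) :
    ∫ x, φ x ∂normalMeasure A = ∫ y, φ (T *ᵥ y) ∂halfNormal n := by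
  rw [normalMeasure_eq_map hA hT, integral_map measurable_mulVec.aemeasurable
    hφ.aestronglyMeasurable]

lemma variance_normalMeasure (hA : A.PosDef) (hT : Tᵀ * A * T = 1) {φ : (Fin n → ℝ) → ℝ}
    (hφ : Measurable φ) :
    variance φ (normalMeasure A) = variance (fun y => φ (T *ᵥ y)) (halfNormal n) := by
  rw [normalMeasure_eq_map hA hT, variance_map hφ.aemeasurable measurable_mulVec.aemeasurable]
  rfl

lemma memLp_comp_mulVec {E : Type*} [NormedAddCommGroup E]
    [MeasurableSpace E] [BorelSpace E] [SecondCountableTopology E] (hA : A.PosDef)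
    (hT : Tᵀ * A * T = 1) {φ : (Fin n → ℝ) → E} (hφ : Measurable φ)
    (h : MemLp φ 2 (normalMeasure A)) : MemLp (fun y => φ (T *ᵥ y)) 2 (halfNormal n) := by
  rw [normalMeasure_eq_map hA hT, memLp_map_measure_iff hφ.aestronglyMeasurable
    measurable_mulVec.aemeasurable] at h
  exact h

lemma pseudoVariance_eq_bilinearCov {α : Type*} [MeasurableSpace α] (ν : Measure α)
    [IsProbabilityMeasure ν] {F : α → ℂ} (hF : MemLp F 2 ν) :
    pseudoVariance ν F = bilinearCov ν F F := by
  have i1 : Integrable F ν := hF.integrable (by norm_num)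
  have i2 : Integrable (fun y => F y * F y) ν := hF.integrable_mul hF
  rw [pseudoVariance]
  set m := ∫ x, F x ∂ν with hm
  have : ∀ x, (F x - m) ^ 2 = F x * F x - 2 * m * F x + m ^ 2 := fun x => by ring
  simp_rw [this]
  rw [integral_add (by fun_prop) (by fun_prop), integral_sub (by fun_prop) (by fun_prop),
    integral_const_mul, bilinearCov, ← hm]
  simp
  ring

lemma mean_add_pseudoVariance_eq (hA : A.PosDef) (hT : Tᵀ * A * T = 1) {f : (Fin n → ℝ) → ℂ}
    (hf : Measurable f) (h : MemLp f 2 (normalMeasure A)) :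
    ∫ x, f x ∂normalMeasure A + 1 / 2 * pseudoVariance (normalMeasure A) f =
      secondCumulantSum (halfNormal n) fun y => f (T *ᵥ y) := by
  have := isProbabilityMeasure_normalMeasure hA hT
  rw [pseudoVariance_eq_bilinearCov _ h, bilinearCov, secondCumulantSum, bilinearCov,
    integral_normalMeasure hA hT hf, integral_normalMeasure hA hT (φ := fun x => f x * f x) (hf.mul hf)]
  ring

lemma errorBound_eq_relError (hA : A.PosDef) (hT : Tᵀ * A * T = 1) (Ω : Set (Fin n → ℝ))
    (ρ₁ φ₁ φ₂ : ℝ) {f : (Fin n → ℝ) → ℂ} {g : (Fin n → ℝ) → ℝ} (h : (Fin n → ℝ) → ℂ)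
    (hf : Measurable f) (hg : Measurable g) :
    errorBound A Ω ρ₁ φ₁ φ₂ f g h =
      relError (φ₁ ^ 3) (φ₂ ^ 3) (sSup ((fun x => ‖Complex.exp (h x) - 1‖) '' Ω))
        (variance (fun y => (f (T *ᵥ y)).im) (halfNormal n))
        (comparisonExponent (fun y => f (T *ᵥ y)) fun y => g (T *ᵥ y))
        (Real.exp (-ρ₁ ^ 2 / 2)) := by
  have hre : Measurable fun x => (f x).re := Complex.measurable_re.comp hf
  have him : Measurable fun x => (f x).im := Complex.measurable_im.comp hf
  rw [errorBound, relError, comparisonExponent, variance_normalMeasure hA hT him,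
    variance_normalMeasure hA hT hre, variance_normalMeasure hA hT hg,
    integral_normalMeasure hA hT (φ := fun x => g x - (f x).re) (hg.sub hre)]

lemma normalMeasure_const_pos (hA : A.PosDef) :
    0 < Real.pi ^ (-(n : ℝ) / 2) * A.det ^ (1 / 2 : ℝ) :=
  mul_pos (Real.rpow_pos_of_pos Real.pi_pos _) (Real.rpow_pos_of_pos hA.det_pos _)

lemma measurable_normalMeasure_density : Measurable fun x : Fin n → ℝ => ENNReal.ofReal
    (Real.pi ^ (-(n : ℝ) / 2) * A.det ^ (1 / 2 : ℝ) * Real.exp (-quadForm A x)) := by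
  have := measurable_quadForm (A := A)
  fun_prop

lemma density_smul_eq (hA : A.PosDef) (u : ℂ) (x : Fin n → ℝ) :
    (ENNReal.ofReal (Real.pi ^ (-(n : ℝ) / 2) * A.det ^ (1 / 2 : ℝ) *
      Real.exp (-quadForm A x))).toReal • Complex.exp u =
    ((Real.pi ^ (-(n : ℝ) / 2) * A.det ^ (1 / 2 : ℝ) : ℝ) : ℂ) *
      Complex.exp (-(quadForm A x : ℂ) + u) := by
  rw [ENNReal.toReal_ofReal (mul_nonneg (normalMeasure_const_pos hA).le (Real.exp_pos _).le),
    Complex.real_smul, Complex.ofReal_mul, Complex.ofReal_exp, Complex.exp_add, Complex.ofReal_neg,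
    mul_assoc]

lemma integrableOn_cexp_neg_quadForm_add (hA : A.PosDef) {Ω : Set (Fin n → ℝ)}
    (hΩ : MeasurableSet Ω) {u : (Fin n → ℝ) → ℂ}
    (hi : IntegrableOn (fun x => Complex.exp (u x)) Ω (normalMeasure A)) :
    IntegrableOn (fun x => Complex.exp (-(quadForm A x : ℂ) + u x)) Ω := by
  rw [IntegrableOn, normalMeasure, restrict_withDensity hΩ,
    integrable_withDensity_iff_integrable_smul' measurable_normalMeasure_density
      (.of_forall fun _ => ENNReal.ofReal_lt_top)] at hi
  simp_rw [density_smul_eq hA] at hi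
  have hc : ((Real.pi ^ (-(n : ℝ) / 2) * A.det ^ (1 / 2 : ℝ) : ℝ) : ℂ) ≠ 0 :=
    Complex.ofReal_ne_zero.2 (normalMeasure_const_pos hA).ne'
  exact (integrable_const_mul_iff (IsUnit.mk0 _ hc) _).1 hi

lemma setIntegral_cexp_neg_quadForm_add (hA : A.PosDef) {Ω : Set (Fin n → ℝ)}
    (hΩ : MeasurableSet Ω) (u : (Fin n → ℝ) → ℂ) :
    ∫ x in Ω, Complex.exp (-(quadForm A x : ℂ) + u x) =
      ((Real.pi ^ ((n : ℝ) / 2) * A.det ^ (-(1 / 2) : ℝ) : ℝ) : ℂ) *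
        ∫ x in Ω, Complex.exp (u x) ∂normalMeasure A := by
  rw [normalMeasure, setIntegral_withDensity_eq_setIntegral_toReal_smul
    measurable_normalMeasure_density (.of_forall fun _ => ENNReal.ofReal_lt_top) _ hΩ]
  simp_rw [density_smul_eq hA]
  rw [integral_const_mul, ← mul_assoc, ← Complex.ofReal_mul]
  have : Real.pi ^ ((n : ℝ) / 2) * A.det ^ (-(1 / 2) : ℝ) *
      (Real.pi ^ (-(n : ℝ) / 2) * A.det ^ (1 / 2 : ℝ)) = 1 := by
    have h1 : Real.pi ^ ((n : ℝ) / 2) * Real.pi ^ (-(n : ℝ) / 2) = 1 := by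
      rw [← Real.rpow_add Real.pi_pos]
      have : (n : ℝ) / 2 + -(n : ℝ) / 2 = 0 := by ring
      rw [this, Real.rpow_zero]
    have h2 : A.det ^ (-(1 / 2) : ℝ) * A.det ^ (1 / 2 : ℝ) = 1 := by
      rw [← Real.rpow_add hA.det_pos]
      norm_num
    calc _ = (Real.pi ^ ((n : ℝ) / 2) * Real.pi ^ (-(n : ℝ) / 2)) *
          (A.det ^ (-(1 / 2) : ℝ) * A.det ^ (1 / 2 : ℝ)) := by ring
      _ = 1 := by rw [h1, h2, one_mul]
  rw [this]
  simp

lemma setIntegral_normalMeasure (hA : A.PosDef) (hT : Tᵀ * A * T = 1) {Ω : Set (Fin n → ℝ)}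
    (hΩ : MeasurableSet Ω) {φ : (Fin n → ℝ) → ℂ} (hφ : Measurable φ) :
    ∫ x in Ω, φ x ∂normalMeasure A =
      ∫ y in (fun y => T *ᵥ y) ⁻¹' Ω, φ (T *ᵥ y) ∂halfNormal n := by
  rw [normalMeasure_eq_map hA hT, setIntegral_map hΩ hφ.aestronglyMeasurable
    measurable_mulVec.aemeasurable]

lemma measurable_indicator_of_domRestrict {α : Type*} [MeasurableSpace α] {Ω : Set α}
    (hΩ : MeasurableSet Ω) {h : α → ℂ} (hh : Measurable (Ω.domRestrict h)) :
    Measurable (Ω.indicator h) := by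
  refine measurable_of_restrict_of_restrict_compl hΩ ?_ ?_
  · convert hh using 1
    ext x
    simp [Set.domRestrict]
  · have : Ωᶜ.domRestrict (Ω.indicator h) = fun _ => 0 := by
      ext x
      simpa [Set.domRestrict] using fun hx => absurd hx x.2
    rw [this]
    exact measurable_const

lemma growthLE_comp_mulVec {E : Type*} [NormedAddCommGroup E] {c₂ c₃ : ℝ} (hT : Tᵀ * A * T = 1)
    {φ : (Fin n → ℝ) → E}
    (h : ∀ x, ‖φ x‖ ≤ (n : ℝ) ^ c₃ * Real.exp (c₂ * quadForm A x / n)) :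
    GrowthLE c₂ c₃ fun y => φ (T *ᵥ y) := fun y => by
  have := h (T *ᵥ y)
  rwa [quadForm_mulVec hT] at this

lemma bddAbove_norm_cexp_sub_one {α : Type*} {Ω : Set α} {h : α → ℂ}
    (hb : ∃ M : ℝ, ∀ x ∈ Ω, ‖h x‖ ≤ M) :
    BddAbove ((fun x => ‖Complex.exp (h x) - 1‖) '' Ω) := by
  obtain ⟨M, hM⟩ := hb
  refine ⟨Real.exp M + 1, ?_⟩
  rintro _ ⟨x, hx, rfl⟩
  refine (norm_sub_le _ _).trans ?_
  rw [norm_one, Complex.norm_exp]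
  gcongr
  exact (Complex.re_le_norm _).trans (hM x hx)

end Transfer

/-! ### The theorem in the original variables. -/

theorem mainTheorem5 (c₁ c₂ c₃ ε : ℝ) (hc₁ : 0 < c₁) (hc₂ : 0 ≤ c₂) (hc₃ : 0 ≤ c₃) (hε : 0 < ε) :
    ∃ C : ℝ, ∀ (n : ℕ) (ρ₁ ρ₂ φ₁ φ₂ : ℝ) (A T : Matrix (Fin n) (Fin n) ℝ)
      (Ω : Set (Fin n → ℝ)) (f : (Fin n → ℝ) → ℂ) (g : (Fin n → ℝ) → ℝ) (h : (Fin n → ℝ) → ℂ),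
      1 ≤ n → 4 * c₂ ≤ (n : ℝ) →
      0 ≤ ρ₁ → 0 ≤ ρ₂ → 0 ≤ φ₁ → 0 ≤ φ₂ →
      A.PosDef → Tᵀ * A * T = 1 →
      MeasurableSet Ω →
      cube n ρ₁ ⊆ (fun y => T *ᵥ y) ⁻¹' Ω → (fun y => T *ᵥ y) ⁻¹' Ω ⊆ cube n ρ₂ →
      Measurable f → Measurable g → Measurable (Ω.domRestrict h) →
      -- (a)
      c₁ * Real.log n ^ (1 / 2 + ε) ≤ ρ₁ → ρ₁ ≤ ρ₂ →
      -- (b)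
      TwiceDifferentiableNear f ((fun y => T *ᵥ y) '' cube n ρ₁) →
      HessianBddOn f ((fun y => T *ᵥ y) '' cube n ρ₁) →
      (∀ x ∈ (fun y => T *ᵥ y) '' cube n ρ₁, ∀ j,
        2 * ρ₁ * matrixNormOne T * ‖partialDerivative f j x‖ ≤ φ₁ * (n : ℝ) ^ (-(1 / 3) : ℝ)) →
      φ₁ * (n : ℝ) ^ (-(1 / 3) : ℝ) ≤ 2 / 3 →
      4 * ρ₁ ^ 2 * matrixNormOne T * matrixNormInf T *
          matrixNormInf (hessianSup f ((fun y => T *ᵥ y) '' cube n ρ₁))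
        ≤ φ₁ * (n : ℝ) ^ (-(1 / 3) : ℝ) →
      -- (c)
      (∀ x ∈ Ω, (f x).re ≤ g x) →
      ((DifferentiableNear g ((fun y => T *ᵥ y) '' cube n ρ₂) ∧
          ∀ x ∈ (fun y => T *ᵥ y) '' cube n ρ₂, ∀ j,
            2 * ρ₂ * matrixNormOne T * |partialDerivative g j x|
              ≤ (2 * φ₂) ^ (3 / 2 : ℝ) * (n : ℝ) ^ (-(1 / 2) : ℝ)) ∨
        (TwiceDifferentiableNear g ((fun y => T *ᵥ y) '' cube n ρ₂) ∧
          HessianBddOn g ((fun y => T *ᵥ y) '' cube n ρ₂) ∧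
          (∀ x ∈ (fun y => T *ᵥ y) '' cube n ρ₂, ∀ j,
            2 * ρ₂ * matrixNormOne T * |partialDerivative g j x|
              ≤ φ₂ * (n : ℝ) ^ (-(1 / 3) : ℝ)) ∧
          4 * ρ₂ ^ 2 * matrixNormOne T * matrixNormInf T *
              matrixNormInf (hessianSup g ((fun y => T *ᵥ y) '' cube n ρ₂))
            ≤ φ₂ * (n : ℝ) ^ (-(1 / 3) : ℝ))) →
      -- (d)
      (∀ x, ‖f x‖ ≤ (n : ℝ) ^ c₃ * Real.exp (c₂ * quadForm A x / n)) →
      (∀ x, |g x| ≤ (n : ℝ) ^ c₃ * Real.exp (c₂ * quadForm A x / n)) →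
      -- finite (pseudo)variances of `f(X)` and `g(X)`, and `h` bounded in `Ω`
      MemLp f 2 (normalMeasure A) → MemLp g 2 (normalMeasure A) →
      (∃ M : ℝ, ∀ x ∈ Ω, ‖h x‖ ≤ M) →
      ∃ K : ℂ,
        IntegrableOn (fun x => Complex.exp (-(quadForm A x : ℂ) + f x + h x)) Ω ∧
        ∫ x in Ω, Complex.exp (-(quadForm A x : ℂ) + f x + h x) =
          (1 + K) * ((Real.pi ^ ((n : ℝ) / 2) * A.det ^ (-(1 / 2) : ℝ) : ℝ) : ℂ) *
            Complex.exp ((∫ x, f x ∂normalMeasure A) +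
              1 / 2 * pseudoVariance (normalMeasure A) f) ∧
        ‖K‖ ≤ C * errorBound A Ω ρ₁ φ₁ φ₂ f g h ∧
        ((1 + 2 * c₂) ^ 2 ≤ (n : ℝ) →
          15 + 4 * c₂ + (3 + 8 * c₃) * Real.log n ≤ ρ₁ ^ 2 →
          ‖K‖ ≤ errorBound A Ω ρ₁ φ₁ φ₂ f g h) := by
  obtain ⟨C, hC⟩ := exists_forall_standardSetting (c₃ := c₃) hc₁ hc₂ hc₃ hε
  refine ⟨C, fun n ρ₁ ρ₂ φ₁ φ₂ A T Ω f g h hn hnc hρ₁ hρ₂ hφ₁ hφ₂ hA hT hΩ hΩ₁ hΩ₂ hf hg hh hlog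
    hρ hfd hfH hf1 hφ23 hf2 hfg hgc hfb hgb hfL hgL hhb => ?_⟩
  -- Measurability of `h` is given on `Ω` only; the extension by zero is measurable everywhere and
  -- leaves the integrals over `Ω` unchanged.
  set h' := Ω.indicator h with hh'
  have hh'm : Measurable h' := measurable_indicator_of_domRestrict hΩ hh
  have hh'Ω : ∀ x ∈ Ω, h' x = h x := fun x hx => Set.indicator_of_mem hx h
  have hFg : GrowthLE c₂ c₃ fun y => f (T *ᵥ y) := growthLE_comp_mulVec hT hfb
  have hGg : GrowthLE c₂ c₃ fun y => g (T *ᵥ y) := growthLE_comp_mulVec hT hgb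
  have hFm : Measurable fun y => f (T *ᵥ y) := hf.comp measurable_mulVec
  have hGm : Measurable fun y => g (T *ᵥ y) := hg.comp measurable_mulVec
  have hb : ∀ y ∈ (fun y => T *ᵥ y) ⁻¹' Ω, ‖Complex.exp (h' (T *ᵥ y)) - 1‖ ≤
      sSup ((fun x => ‖Complex.exp (h x) - 1‖) '' Ω) := fun y hy => by
    rw [hh'Ω _ hy]
    exact le_csSup (bddAbove_norm_cexp_sub_one hhb) ⟨_, hy, rfl⟩
  have hset : StandardSetting c₂ c₃ ρ₁ ρ₂ (φ₁ ^ 3) (φ₂ ^ 3)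
      (sSup ((fun x => ‖Complex.exp (h x) - 1‖) '' Ω)) ((fun y => T *ᵥ y) ⁻¹' Ω)
      (fun y => f (T *ᵥ y)) (fun y => g (T *ᵥ y)) fun y => h' (T *ᵥ y) :=
    { one_le := hn
      c₂_nonneg := hc₂
      c₃_nonneg := hc₃
      four_mul_le := hnc
      ρ₁_nonneg := hρ₁
      ρ₁_le := hρ
      S₁_nonneg := by positivity
      S₂_nonneg := by positivity
      measurableSet := measurable_mulVec hΩ
      cube_subset := hΩ₁
      subset_cube := hΩ₂
      measurable_F := hFm
      growth_F := hFg
      measurable_G := hGm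
      growth_G := hGg
      measurable_H := hh'm.comp measurable_mulVec
      bounded_H := by
        obtain ⟨M, hM⟩ := hhb
        exact ⟨M, fun y hy => by rw [hh'Ω _ hy]; exact hM _ hy⟩
      re_le := fun y hy => hfg _ hy
      s_nonneg := Real.sSup_nonneg (by rintro _ ⟨x, -, rfl⟩; exact norm_nonneg _)
      le_s := hb
      memLp_F := memLp_comp_mulVec hA hT hf hfL
      memLp_G := memLp_comp_mulVec hA hT hg hgL
      differences_F := ⟨φ₁ * (n : ℝ) ^ (-(1 / 3) : ℝ), by positivity, hφ23,
        (natCast_mul_rpow_neg_third_pow hn φ₁).le,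
        smallDifferences_comp_clampCube hρ₁ (by positivity)
          (hFg.bddMeasurable_clampCube hc₂ hFm hρ₁) hfd hfH hf1 hf2⟩
      control_G := by
        rcases hgc with ⟨hd, h1⟩ | ⟨hd, hH, h1, h2⟩
        · exact expControl_of_first hn hρ₂ hφ₂ hd h1
        · exact expControl_of_second hn hρ₁ hρ hφ₂ (hGg.bddMeasurable_clampCube hc₂ hGm hρ₁)
            (hGg.bddMeasurable_clampCube hc₂ hGm hρ₂) hd hH h1 h2 }
  have hexp : Measurable fun x => Complex.exp (f x + h' x) := (hf.add hh'm).cexp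
  -- `K` is the quotient of the two sides minus `1`, so the identity holds by construction and only
  -- its size is at issue.
  refine ⟨relativeDeviation ((fun y => T *ᵥ y) ⁻¹' Ω) (fun y => f (T *ᵥ y))
    fun y => h' (T *ᵥ y), ?_, ?_, ?_, fun hn2 hρ15 => ?_⟩
  · have hi : IntegrableOn (fun x => Complex.exp (f x + h' x)) Ω (normalMeasure A) := by
      have := isProbabilityMeasure_normalMeasure hA hT
      obtain ⟨B, hB⟩ := hFg.bounded_on_cube hc₂ ρ₂
      obtain ⟨M, hM⟩ := hhb
      refine integrableOn_cexp hΩ (hf.add hh'm) ⟨B + M, fun x hx => ?_⟩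
      -- Each point of `Ω` is the image under `T` of a point of the larger cube, where the growth
      -- bound makes `f` bounded.
      have hx' : T *ᵥ (T⁻¹ *ᵥ x) = x := by
        rw [Matrix.mulVec_mulVec, Matrix.mul_nonsing_inv _
          (det_ne_zero_of_transpose_mul_mul hT).isUnit, Matrix.one_mulVec]
      refine (norm_add_le _ _).trans (add_le_add ?_ ?_)
      · have := hB (T⁻¹ *ᵥ x) (hΩ₂ (by simpa only [Set.mem_preimage, hx'] using hx))
        rwa [hx'] at this
      · rw [hh'Ω x hx]
        exact hM x hx
    refine (integrableOn_cexp_neg_quadForm_add hA hΩ hi).congr_fun (fun x hx => ?_) hΩ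
    simp only [hh'Ω x hx, add_assoc]
  · have h1 : ∫ x in Ω, Complex.exp (-(quadForm A x : ℂ) + f x + h x) =
        ∫ x in Ω, Complex.exp (-(quadForm A x : ℂ) + (f x + h' x)) :=
      setIntegral_congr_fun hΩ fun x hx => by simp only [hh'Ω x hx, add_assoc]
    rw [h1, setIntegral_cexp_neg_quadForm_add hA hΩ, setIntegral_normalMeasure hA hT hΩ hexp,
      mean_add_pseudoVariance_eq hA hT hf hfL, relativeDeviation]
    have := Complex.exp_ne_zero (secondCumulantSum (halfNormal n) fun y => f (T *ᵥ y))
    field_simp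
    ring
  · rw [errorBound_eq_relError hA hT Ω ρ₁ φ₁ φ₂ h hf hg]
    exact hC n ρ₁ ρ₂ _ _ _ _ _ _ _ hlog hset
  · rw [errorBound_eq_relError hA hT Ω ρ₁ φ₁ φ₂ h hf hg]
    exact hset.norm_relativeDeviation_le_of_le_sq hn2 hρ15
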